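/- Let $M$ and $S$ be smooth manifolds and let $J:S\to M$ be a smooth (locally trivial) fibre bundle with compact connected fibres $S_m=J^{-1}(m)$. Let $(\mathcal A\to M,[\cdot,\cdot],\rho)$ be a regular Lie algebroid (the anchor $\rho:\mathcal A\to TM$ has locally constant rank), acting on $J$ by $\alpha:\Gamma^\infty(\mathcal A)\to\mathfrak X^\infty(S)$: $\alpha$ is additive, $\alpha(fX)=(f\circ J)\,\alpha(X)$, $[\alpha(X),\alpha(Y)]=\alpha([X,Y])$ and $TJ\circ\alpha(X)=\rho(X)\circ J$. Put $T^JS=\ker TJ$ and $T^{\tilde J}S=(TJ)^{-1}(\operatorname{im}\rho)\subseteq TS$. Suppose that: (a) $\tilde\omega$ is a smooth $2$-form on the involutive subbundle $T^{\tilde J}S$, closed along it, whose restriction $\omega$ to $T^JS$ is non-degenerate. (b) The action is Hamiltonian with momentum map $\tilde\mu\in\Gamma^\infty(J^*\mathcal A^*)$: writing $\tilde\mu_X=\langle\tilde\mu,J^*X\rangle$, for all $X,Y\in\Gamma^\infty(\mathcal A)$ and all $v\in T^JS$ $$\tilde\mu_{[X,Y]}-\alpha(X)\tilde\mu_Y+\alpha(Y)\tilde\mu_X=-\tilde\omega(\alpha(X),\alpha(Y)),\qquad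 v\cdot\tilde\mu_X=-\tilde\omega(\alpha(X),v).$$ (c) $j:T^JS\to T^JS$ is a smooth family of integrable complex structures on the fibres with $\omega(j\cdot,j\cdot)=\omega$ and $\omega(jv,v)>0$ for $v\ne0$ (so the fibres are Kähler), and $j$ is $\mathcal A$-equivariant: $[\alpha(X),jv]=j[\alpha(X),v]$ for all $X\in\Gamma^\infty(\mathcal A)$ and all vertical vector fields $v$. (d) $(L\to S,\nabla,h)$ is a prequantization: a smooth complex line bundle with a Hermitian metric $h$ and an $h$-Hermitian connection $\nabla$ along $T^{\tilde J}S$ with curvature $[\nabla_X,\nabla_Y]-\nabla_{[X,Y]}=2\pi i\,\tilde\omega(X,Y)$. Call $\sigma\in\Gamma^\infty(L)$ holomorphic if $\nabla_v\sigma=0$ for all $v\in T^JS\otimes\mathbb C$ with $j_{\mathbb C}v=-iv$, and let $\Delta_Q$ be the space of holomorphic sections. Assume that the spaces $Q_m$ of holomorphic smooth sections of $L|_{S_m}$ $(m\in M)$ are the fibres of a smooth complex vector bundle $Q\to M$ whose space of smooth sections is $\Delta_Q$ (a section $\sigma\in\Delta_Q$ being identified with $m\mapsto\sigma|_{S_m}$).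 Then $$\langle\sigma,\sigma'\rangle(m)=\int_{S_m}h(\sigma,\sigma')\,\frac{\omega_m^{d_m}}{d_m!},\qquad d_m=\tfrac12\dim S_m,$$ (where the integrals converge) defines a smooth Hermitian metric on $Q$, and $$\pi(X)\sigma=\nabla_{\alpha(X)}\sigma-2\pi i\,\langle\tilde\mu,J^*X\rangle\,\sigma\qquad(X\in\Gamma^\infty(\mathcal A),\ \sigma\in\Delta_Q)$$ maps $\Delta_Q$ to itself and is a Hermitian representation of $\mathcal A$ on $Q$: $\pi(X)$ is $C^\infty(M)$-linear in $X$ and $\mathbb C$-linear in $\sigma$, $\pi(X)(f\sigma)=f\,\pi(X)\sigma+(\rho(X)f)\,\sigma$ for $f\in C^\infty(M,\mathbb C)$, $\pi([X,Y])=[\pi(X),\pi(Y)]$, and $\langle\pi(X)\sigma,\sigma'\rangle+\langle\sigma,\pi(X)\sigma'\rangle=\rho(X)\langle\sigma,\sigma'\rangle$. In other words, the Hermitian representation on $Q$ is the restriction of the prequantization representation $\pi$ on $L$. -/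

import Mathlib

open scoped Manifold ContDiff Bundle TensorProduct ENNReal
open Bundle MeasureTheory

noncomputable section

namespace KahlerQuantization

set_option linter.unusedSectionVars false

universe uM uS

/-! ### Directional derivatives, sections, complex vector bundles -/

section Basics

variable {EB : Type*} [NormedAddCommGroup EB] [NormedSpace ℝ EB]
  {B : Type*} [TopologicalSpace B] [ChartedSpace EB B]

/-- The derivative `v · f` of a vector valued function `f` along the tangent vector `v`. -/
def dirDeriv {G : Type*} [NormedAddCommGroup G] [NormedSpace ℝ G] (f : B → G) (b : B)
    (v : TangentSpace 𝓘(ℝ, EB) b) : G :=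
  mfderiv 𝓘(ℝ, EB) 𝓘(ℝ, G) f b v

/-- The product of a smooth real function and a smooth section of a real vector bundle. -/
def realSmul {F : Type*} [NormedAddCommGroup F] [NormedSpace ℝ F]
    {E : B → Type*} [∀ b, AddCommGroup (E b)] [∀ b, Module ℝ (E b)]
    [TopologicalSpace (TotalSpace F E)] [∀ b, TopologicalSpace (E b)] [FiberBundle F E]
    [VectorBundle ℝ F E]
    (f : C^∞⟮𝓘(ℝ, EB), B; 𝓘(ℝ, ℝ), ℝ⟯) (σ : Cₛ^∞⟮𝓘(ℝ, EB); F, E⟯) :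
    Cₛ^∞⟮𝓘(ℝ, EB); F, E⟯ :=
  ⟨fun b => f b • σ b, f.contMDiff.smul_section σ.contMDiff⟩

/-! A smooth complex vector bundle over the real manifold `B` is a bundle whose fibres are complex
vector spaces, whose trivializations are complex linear (`VectorBundle ℂ F E`) and whose transition
functions are smooth over `ℝ` (`ContMDiffVectorBundle ∞ F E 𝓘(ℝ, EB)`). -/

variable {F : Type*} [NormedAddCommGroup F] [NormedSpace ℂ F]
  {E : B → Type*} [∀ b, AddCommGroup (E b)] [∀ b, Module ℂ (E b)]
  [TopologicalSpace (TotalSpace F E)] [∀ b, TopologicalSpace (E b)] [FiberBundle F E]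

theorem contMDiff_complexSmul [VectorBundle ℂ F E]
    (f : C^∞⟮𝓘(ℝ, EB), B; 𝓘(ℝ, ℂ), ℂ⟯) (σ : Cₛ^∞⟮𝓘(ℝ, EB); F, E⟯) :
    ContMDiff 𝓘(ℝ, EB) (𝓘(ℝ, EB).prod 𝓘(ℝ, F)) ∞
      (fun b => TotalSpace.mk' F b (f b • σ b)) := by
  intro b
  have hs := σ.contMDiff b
  have hf := f.contMDiff b
  rw [← contMDiffWithinAt_univ, contMDiffWithinAt_section] at hs ⊢
  rw [← contMDiffWithinAt_univ] at hf
  set e := trivializationAt F E b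
  have h : ContMDiffWithinAt 𝓘(ℝ, EB) 𝓘(ℝ, F) ∞ (fun x => f x • (e ⟨x, σ x⟩).2) Set.univ b := by
    have hsm : ContDiff ℝ ∞ (fun p : ℂ × F => p.1 • p.2) := contDiff_smul
    have hp := hf.prodMk_space hs
    exact (hsm.contMDiff.contMDiffAt.comp_contMDiffWithinAt b hp)
  refine h.congr_of_eventuallyEq ?_ ?_
  · apply Filter.eventually_of_mem (U := e.baseSet)
    · exact mem_nhdsWithin_of_mem_nhds
        (e.open_baseSet.mem_nhds (mem_baseSet_trivializationAt F E b))
    · intro x hx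
      exact (e.linear ℂ hx).2 _ _
  · exact (e.linear ℂ (FiberBundle.mem_baseSet_trivializationAt' b)).2 _ _

/-- The product of a smooth complex function and a smooth section of a complex vector bundle. -/
def complexSmul [VectorBundle ℂ F E]
    (f : C^∞⟮𝓘(ℝ, EB), B; 𝓘(ℝ, ℂ), ℂ⟯) (σ : Cₛ^∞⟮𝓘(ℝ, EB); F, E⟯) :
    Cₛ^∞⟮𝓘(ℝ, EB); F, E⟯ :=
  ⟨fun b => f b • σ b, contMDiff_complexSmul f σ⟩

variable (EB F E) in
/-- A smooth Hermitian metric on a complex vector bundle (conjugate linear in the first entry). -/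
structure HermitianMetric where
  inner : ∀ b, E b →ₗ⋆[ℂ] E b →ₗ[ℂ] ℂ
  conj_symm : ∀ b v w, starRingEnd ℂ (inner b v w) = inner b w v
  pos : ∀ b v, v ≠ 0 → 0 < (inner b v v).re
  smooth : ∀ σ τ : Cₛ^∞⟮𝓘(ℝ, EB); F, E⟯,
    ContMDiff 𝓘(ℝ, EB) 𝓘(ℝ, ℂ) ∞ (fun b => inner b (σ b) (τ b))

/-! ### Vector fields and connections along a distribution -/

variable [IsManifold 𝓘(ℝ, EB) ∞ B]

/-- Smooth vector fields with values in the distribution `D ⊆ TB`. -/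
structure FieldIn (D : ∀ b : B, Submodule ℝ (TangentSpace 𝓘(ℝ, EB) b)) where
  field : Cₛ^∞⟮𝓘(ℝ, EB); EB, (TangentSpace 𝓘(ℝ, EB) : B → Type _)⟯
  mem : ∀ b, field b ∈ D b

/-- The value of a vector field along `D` at a point. -/
def FieldIn.at {D : ∀ b : B, Submodule ℝ (TangentSpace 𝓘(ℝ, EB) b)} (X : FieldIn D) (b : B) :
    D b := ⟨X.field b, X.mem b⟩

/-- `W = [X, Y]` as vector fields. -/
def IsBracket (W X Y : ∀ b : B, TangentSpace 𝓘(ℝ, EB) b) : Prop :=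
  ∀ b, W b = VectorField.mlieBracket 𝓘(ℝ, EB) X Y b

variable (F E) in
/-- A connection on the complex vector bundle `E` that differentiates along the vectors of the
distribution `D` only: `toFun σ b v` is `∇_v σ`. -/
structure PartialConnection [VectorBundle ℝ F E] [VectorBundle ℂ F E]
    (D : ∀ b : B, Submodule ℝ (TangentSpace 𝓘(ℝ, EB) b)) where
  toFun : Cₛ^∞⟮𝓘(ℝ, EB); F, E⟯ → ∀ b, D b →ₗ[ℝ] E b
  add : ∀ σ τ b, toFun (σ + τ) b = toFun σ b + toFun τ b
  leibniz : ∀ (f : C^∞⟮𝓘(ℝ, EB), B; 𝓘(ℝ, ℂ), ℂ⟯) σ b (v : D b),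
    toFun (complexSmul f σ) b v = f b • toFun σ b v + dirDeriv f b v.1 • σ b
  smooth : ∀ (X : FieldIn D) (σ : Cₛ^∞⟮𝓘(ℝ, EB); F, E⟯),
    ContMDiff 𝓘(ℝ, EB) (𝓘(ℝ, EB).prod 𝓘(ℝ, F)) ∞
      (fun b => TotalSpace.mk' F b (toFun σ b (X.at b)))

/-- The section `∇_X σ`. -/
def PartialConnection.along [VectorBundle ℝ F E] [VectorBundle ℂ F E]
    {D : ∀ b : B, Submodule ℝ (TangentSpace 𝓘(ℝ, EB) b)} (nabla : PartialConnection F E D)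
    (X : FieldIn D) (σ : Cₛ^∞⟮𝓘(ℝ, EB); F, E⟯) : Cₛ^∞⟮𝓘(ℝ, EB); F, E⟯ :=
  ⟨fun b => nabla.toFun σ b (X.at b), nabla.smooth X σ⟩

end Basics

/-! ### Lie algebroids -/

section Algebroid

variable {EM : Type*} [NormedAddCommGroup EM] [NormedSpace ℝ EM]
  {M : Type uM} [TopologicalSpace M] [ChartedSpace EM M] [IsManifold 𝓘(ℝ, EM) ∞ M]
  {FA : Type*} [NormedAddCommGroup FA] [NormedSpace ℝ FA]
  {A : M → Type*} [∀ m, AddCommGroup (A m)] [∀ m, Module ℝ (A m)]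
  [TopologicalSpace (TotalSpace FA A)] [∀ m, TopologicalSpace (A m)] [FiberBundle FA A]
  [VectorBundle ℝ FA A]

variable (EM FA A) in
/-- A Lie algebroid structure on the smooth real vector bundle `A → M`. -/
structure LieAlgebroid where
  anchor : ∀ m, A m →ₗ[ℝ] TangentSpace 𝓘(ℝ, EM) m
  anchor_smooth : ∀ X : Cₛ^∞⟮𝓘(ℝ, EM); FA, A⟯,
    ContMDiff 𝓘(ℝ, EM) 𝓘(ℝ, EM).tangent ∞
      (fun m => (⟨m, anchor m (X m)⟩ : TangentBundle 𝓘(ℝ, EM) M))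
  bracket : Cₛ^∞⟮𝓘(ℝ, EM); FA, A⟯ →ₗ[ℝ] Cₛ^∞⟮𝓘(ℝ, EM); FA, A⟯ →ₗ[ℝ] Cₛ^∞⟮𝓘(ℝ, EM); FA, A⟯
  bracket_self : ∀ X, bracket X X = 0
  jacobi : ∀ X Y Z,
    bracket X (bracket Y Z) + bracket Y (bracket Z X) + bracket Z (bracket X Y) = 0
  leibniz : ∀ X Y (f : C^∞⟮𝓘(ℝ, EM), M; 𝓘(ℝ, ℝ), ℝ⟯) m,
    bracket X (realSmul f Y) m = f m • bracket X Y m + dirDeriv f m (anchor m (X m)) • Y m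

/-- A Lie algebroid is regular if its anchor has locally constant rank. -/
def LieAlgebroid.IsRegular (𝓐 : LieAlgebroid EM FA A) : Prop :=
  IsLocallyConstant (fun m => Module.finrank ℝ (LinearMap.range (𝓐.anchor m)))

variable {ES : Type*} [NormedAddCommGroup ES] [NormedSpace ℝ ES]
  {S : Type uS} [TopologicalSpace S] [ChartedSpace ES S] [IsManifold 𝓘(ℝ, ES) ∞ S]

variable (EM ES) in
/-- The vertical tangent spaces `T^J S = ker TJ`. -/
def vertical (J : S → M) (s : S) : Submodule ℝ (TangentSpace 𝓘(ℝ, ES) s) :=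
  LinearMap.ker (mfderiv 𝓘(ℝ, ES) 𝓘(ℝ, EM) J s).toLinearMap

variable (ES) in
/-- The tangent spaces `T^J̃ S = (TJ)⁻¹(im ρ)` of the foliation of `S` by the fibres of the map
`J̃ : S → M/ρ` to the leaf space of the anchor. -/
def leafTangent (𝓐 : LieAlgebroid EM FA A) (J : S → M) (s : S) :
    Submodule ℝ (TangentSpace 𝓘(ℝ, ES) s) :=
  (LinearMap.range (𝓐.anchor (J s))).comap
    (mfderiv 𝓘(ℝ, ES) 𝓘(ℝ, EM) J s).toLinearMap

theorem vertical_le_leafTangent (𝓐 : LieAlgebroid EM FA A) (J : S → M) (s : S) :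
    vertical EM ES J s ≤ leafTangent ES 𝓐 J s := by
  intro v hv
  have h : (mfderiv 𝓘(ℝ, ES) 𝓘(ℝ, EM) J s).toLinearMap v = 0 := hv
  refine Submodule.mem_comap.2 ?_
  rw [h]
  exact Submodule.zero_mem _

/-- The inclusion `T^J S ⊆ T^J̃ S`. -/
def vertIncl (𝓐 : LieAlgebroid EM FA A) (J : S → M) (s : S) :
    vertical EM ES J s →ₗ[ℝ] leafTangent ES 𝓐 J s :=
  Submodule.inclusion (vertical_le_leafTangent 𝓐 J s)

variable (ES) in
/-- An action of a Lie algebroid on a map `J : S → M`. -/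
structure Action (𝓐 : LieAlgebroid EM FA A) (J : S → M) where
  toFun : Cₛ^∞⟮𝓘(ℝ, EM); FA, A⟯ → Cₛ^∞⟮𝓘(ℝ, ES); ES, (TangentSpace 𝓘(ℝ, ES) : S → Type _)⟯
  add : ∀ X Y s, toFun (X + Y) s = toFun X s + toFun Y s
  smul : ∀ (f : C^∞⟮𝓘(ℝ, EM), M; 𝓘(ℝ, ℝ), ℝ⟯) X s, toFun (realSmul f X) s = f (J s) • toFun X s
  bracket : ∀ X Y, IsBracket (toFun (𝓐.bracket X Y)) (toFun X) (toFun Y)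
  anchor : ∀ X s, mfderiv 𝓘(ℝ, ES) 𝓘(ℝ, EM) J s (toFun X s) = 𝓐.anchor (J s) (X (J s))

/-- The vector field `α(X)`, which is tangent to the foliation of `S`. -/
def Action.leafField {𝓐 : LieAlgebroid EM FA A} {J : S → M} (α : Action ES 𝓐 J)
    (X : Cₛ^∞⟮𝓘(ℝ, EM); FA, A⟯) : FieldIn (leafTangent ES 𝓐 J) :=
  ⟨α.toFun X, fun s => ⟨X (J s), (α.anchor X s).symm⟩⟩

/-! ### Presymplectic forms and momentum maps -/

variable (ES) in
/-- A `J`-presymplectic form: a smooth closed two-form along `T^J̃ S` whose restriction to each fibre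
of `J` is non-degenerate. (The brackets in `closed` exist, as `T^J̃ S` is involutive.) -/
structure PresymplecticForm (𝓐 : LieAlgebroid EM FA A) (J : S → M) where
  form : ∀ s, leafTangent ES 𝓐 J s →ₗ[ℝ] leafTangent ES 𝓐 J s →ₗ[ℝ] ℝ
  alt : ∀ s v, form s v v = 0
  smooth : ∀ X Y : FieldIn (leafTangent ES 𝓐 J),
    ContMDiff 𝓘(ℝ, ES) 𝓘(ℝ, ℝ) ∞ (fun s => form s (X.at s) (Y.at s))
  closed : ∀ X Y Z XY YZ ZX : FieldIn (leafTangent ES 𝓐 J),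
    IsBracket XY.field X.field Y.field → IsBracket YZ.field Y.field Z.field →
    IsBracket ZX.field Z.field X.field → ∀ s,
      dirDeriv (fun t => form t (Y.at t) (Z.at t)) s (X.field s)
      + dirDeriv (fun t => form t (Z.at t) (X.at t)) s (Y.field s)
      + dirDeriv (fun t => form t (X.at t) (Y.at t)) s (Z.field s)
      - form s (XY.at s) (Z.at s) - form s (YZ.at s) (X.at s) - form s (ZX.at s) (Y.at s) = 0
  nondegenerate : ∀ s (v : vertical EM ES J s),
    (∀ w : vertical EM ES J s, form s (vertIncl 𝓐 J s v) (vertIncl 𝓐 J s w) = 0) → v = 0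

/-- The restriction `ω` of the form `ω̃` to the vertical tangent spaces. -/
def PresymplecticForm.vert {𝓐 : LieAlgebroid EM FA A} {J : S → M} (ωt : PresymplecticForm ES 𝓐 J)
    (s : S) (v w : vertical EM ES J s) : ℝ :=
  ωt.form s (vertIncl 𝓐 J s v) (vertIncl 𝓐 J s w)

/-- A momentum map for the action `α` on `(J : S → M, ω̃)`: a smooth section `μ̃` of the dual of the
action algebroid `A ⋉ J` (that is, of `J^*A^*`) that satisfies
`d_{A ⋉ J} μ̃ = - α^* ω̃` with `(d μ̃)(X, Y) = ⟨μ̃, [X, Y]⟩ - α(X)⟨μ̃, Y⟩ + α(Y)⟨μ̃, X⟩` (prequantization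
condition) and `d^J ⟨μ̃, J^*X⟩ = - (α(X) ⌟ ω̃)|_{T^J S}` (quantization condition). Both are tensorial,
so that it is enough to test the first one on pullbacks of sections of `A`. -/
structure MomentumMap {𝓐 : LieAlgebroid EM FA A} {J : S → M} (α : Action ES 𝓐 J)
    (ωt : PresymplecticForm ES 𝓐 J) where
  toFun : ∀ s, A (J s) →ₗ[ℝ] ℝ
  smooth : ∀ X : Cₛ^∞⟮𝓘(ℝ, EM); FA, A⟯,
    ContMDiff 𝓘(ℝ, ES) 𝓘(ℝ, ℝ) ∞ (fun s => toFun s (X (J s)))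
  prequantization : ∀ (X Y : Cₛ^∞⟮𝓘(ℝ, EM); FA, A⟯) s,
    toFun s (𝓐.bracket X Y (J s))
      - dirDeriv (fun t => toFun t (Y (J t))) s (α.toFun X s)
      + dirDeriv (fun t => toFun t (X (J t))) s (α.toFun Y s)
      = - ωt.form s ((α.leafField X).at s) ((α.leafField Y).at s)
  quantization : ∀ (X : Cₛ^∞⟮𝓘(ℝ, EM); FA, A⟯) s (v : vertical EM ES J s),
    dirDeriv (fun t => toFun t (X (J t))) s v.1
      = - ωt.form s ((α.leafField X).at s) (vertIncl 𝓐 J s v)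

/-! ### Bundles of compact Kähler manifolds -/

variable (EM ES) in
/-- `J : S → M` is a smooth, locally trivial fibre bundle with compact connected fibres. -/
def IsCompactFiberBundle (J : S → M) : Prop :=
  ContMDiff 𝓘(ℝ, ES) 𝓘(ℝ, EM) ∞ J ∧
  ∀ m : M, ∃ (k : ℕ) (N : Type uS) (_ : TopologicalSpace N)
    (_ : ChartedSpace (EuclideanSpace ℝ (Fin k)) N) (_ : IsManifold (𝓡 k) ∞ N)
    (_ : CompactSpace N) (_ : ConnectedSpace N) (U : Set M) (Φ : OpenPartialHomeomorph S (M × N)),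
    IsOpen U ∧ m ∈ U ∧ Φ.source = J ⁻¹' U ∧ Φ.target = U ×ˢ Set.univ ∧
    (∀ s ∈ Φ.source, (Φ s).1 = J s) ∧
    ContMDiffOn 𝓘(ℝ, ES) (𝓘(ℝ, EM).prod (𝓡 k)) ∞ Φ Φ.source ∧
    ContMDiffOn (𝓘(ℝ, EM).prod (𝓡 k)) 𝓘(ℝ, ES) ∞ Φ.symm Φ.target

variable (EM ES) in
/-- A smooth family of almost complex structures on the fibres of `J`. -/
structure AlmostComplex (J : S → M) where
  j : ∀ s, vertical EM ES J s →ₗ[ℝ] vertical EM ES J s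
  sq : ∀ s v, j s (j s v) = -v
  smooth : ∀ v : FieldIn (vertical EM ES J),
    ContMDiff 𝓘(ℝ, ES) 𝓘(ℝ, ES).tangent ∞
      (fun s => (⟨s, (j s (v.at s)).1⟩ : TangentBundle 𝓘(ℝ, ES) S))

/-- The vertical vector field `j v`. -/
def AlmostComplex.apply {J : S → M} (c : AlmostComplex EM ES J) (v : FieldIn (vertical EM ES J)) :
    FieldIn (vertical EM ES J) :=
  ⟨⟨fun s => (c.j s (v.at s)).1, c.smooth v⟩, fun s => (c.j s (v.at s)).2⟩

/-- The fibres of `J` with the form `ω` and the almost complex structure `j` are Kähler: `j` is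
integrable (vanishing Nijenhuis tensor), `ω(j·, j·) = ω` and `ω(j·, ·) > 0`.
(The brackets in `integrable` exist, as `T^J S` is involutive.) -/
structure IsKahler {𝓐 : LieAlgebroid EM FA A} {J : S → M} (ωt : PresymplecticForm ES 𝓐 J)
    (c : AlmostComplex EM ES J) : Prop where
  integrable : ∀ u v ab jab ajb jajb : FieldIn (vertical EM ES J),
    IsBracket ab.field u.field v.field → IsBracket jab.field (c.apply u).field v.field →
    IsBracket ajb.field u.field (c.apply v).field →
    IsBracket jajb.field (c.apply u).field (c.apply v).field →
    ∀ s, jajb.at s - c.j s (jab.at s) - c.j s (ajb.at s) - ab.at s = 0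
  compatible : ∀ s v w, ωt.vert s (c.j s v) (c.j s w) = ωt.vert s v w
  pos : ∀ s v, v ≠ 0 → 0 < ωt.vert s (c.j s v) v

/-- `A`-equivariance of the almost complex structure: `[α(X), j v] = j [α(X), v]` for all vertical
vector fields `v` (the bracket `[α(X), v]` is again vertical). -/
def IsEquivariant {𝓐 : LieAlgebroid EM FA A} {J : S → M} (α : Action ES 𝓐 J)
    (c : AlmostComplex EM ES J) : Prop :=
  ∀ (X : Cₛ^∞⟮𝓘(ℝ, EM); FA, A⟯) (v w : FieldIn (vertical EM ES J)),
    IsBracket w.field (α.toFun X) v.field →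
    IsBracket (c.apply w).field (α.toFun X) (c.apply v).field

/-- The Kähler polarization: the complexified vertical vectors `v` with `j_ℂ v = - i v`. -/
def kahlerPolarization {J : S → M} (c : AlmostComplex EM ES J) (s : S) :
    Submodule ℂ (ℂ ⊗[ℝ] vertical EM ES J s) :=
  LinearMap.ker ((c.j s).baseChange ℂ + Complex.I • LinearMap.id)

/-! ### The Liouville measures of the fibres -/

variable (EM ES) in
/-- A smooth parametrization of an open subset of the fibre of `J` over `m`. -/
structure FiberParam (J : S → M) (m : M) where
  dim : ℕ
  dom : Set (Fin dim → ℝ)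
  isOpen_dom : IsOpen dom
  map : (Fin dim → ℝ) → S
  smooth : ContMDiffOn 𝓘(ℝ, Fin dim → ℝ) 𝓘(ℝ, ES) ∞ map dom
  injOn : Set.InjOn map dom
  maps : ∀ y ∈ dom, J (map y) = m
  partialDeriv : ∀ y : dom, Fin dim → vertical EM ES J (map y)
  partialDeriv_eq : ∀ (y : dom) i,
    (partialDeriv y i).1
      = mfderiv 𝓘(ℝ, Fin dim → ℝ) 𝓘(ℝ, ES) map y (Pi.single i (1 : ℝ) : Fin dim → ℝ)
  linearIndependent : ∀ y : dom, LinearIndependent ℝ (partialDeriv y)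
  span : ∀ y : dom, Submodule.span ℝ (Set.range (partialDeriv y)) = ⊤

open Classical in
/-- The coordinate expression `√det ω(∂ᵢ, ∂ⱼ)` (the modulus of the Pfaffian) of the Liouville density
`ω^d / d!`, on the domain of the parametrization. -/
def liouvilleDensity {𝓐 : LieAlgebroid EM FA A} {J : S → M} (ωt : PresymplecticForm ES 𝓐 J) {m : M}
    (ψ : FiberParam EM ES J m) (y : Fin ψ.dim → ℝ) : ℝ :=
  if hy : y ∈ ψ.dom then
    √(Matrix.det (Matrix.of fun i k =>
      ωt.vert (ψ.map y) (ψ.partialDeriv ⟨y, hy⟩ i) (ψ.partialDeriv ⟨y, hy⟩ k)))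
  else 0

/-- The measure `Ω_m` on the fibre `S_m` of `J` (as a measure on `S` that is concentrated on `S_m`)
with density `ω^d / d!`: the least measure that dominates, hence restricts to, the
measures which this density gives in the parametrizations of the open subsets of `S_m`. -/
def liouvilleMeasure [MeasurableSpace S] {𝓐 : LieAlgebroid EM FA A} {J : S → M}
    (ωt : PresymplecticForm ES 𝓐 J) (m : M) : Measure S :=
  ⨆ ψ : FiberParam EM ES J m,
    Measure.map ψ.map
      ((volume.restrict ψ.dom).withDensity fun y => ENNReal.ofReal (liouvilleDensity ωt ψ y))

/-! ### Prequantization -/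

variable {L : S → Type*} [∀ s, AddCommGroup (L s)] [∀ s, Module ℂ (L s)]
  [TopologicalSpace (TotalSpace ℂ L)] [∀ s, TopologicalSpace (L s)] [FiberBundle ℂ L]
  [VectorBundle ℂ ℂ L] [VectorBundle ℝ ℂ L]

variable (L) in
/-- A prequantization structure on the complex line bundle `L → S`: a Hermitian metric `h` and a
Hermitian connection along `T^J̃ S` with curvature `ω̃`, in the normalization
`[∇_X, ∇_Y] - ∇_[X, Y] = 2πi ω̃(X, Y)`. -/
structure Prequantization {𝓐 : LieAlgebroid EM FA A} {J : S → M}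
    (ωt : PresymplecticForm ES 𝓐 J) where
  h : HermitianMetric ES ℂ L
  nabla : PartialConnection ℂ L (leafTangent ES 𝓐 J)
  hermitian : ∀ (σ τ : Cₛ^∞⟮𝓘(ℝ, ES); ℂ, L⟯) s (v : leafTangent ES 𝓐 J s),
    dirDeriv (fun t => h.inner t (σ t) (τ t)) s v.1
      = h.inner s (nabla.toFun σ s v) (τ s) + h.inner s (σ s) (nabla.toFun τ s v)
  curvature : ∀ X Y XY : FieldIn (leafTangent ES 𝓐 J),
    IsBracket XY.field X.field Y.field → ∀ (σ : Cₛ^∞⟮𝓘(ℝ, ES); ℂ, L⟯) s,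
      nabla.along X (nabla.along Y σ) s - nabla.along Y (nabla.along X σ) s - nabla.along XY σ s
        = (2 * Real.pi * Complex.I * (ωt.form s (X.at s) (Y.at s) : ℂ)) • σ s

/-- The prequantization representation `π(X) σ = ∇_{α(X)} σ - 2πi ⟨μ̃, J^*X⟩ σ`. -/
def prequantRep {𝓐 : LieAlgebroid EM FA A} {J : S → M} {ωt : PresymplecticForm ES 𝓐 J}
    (P : Prequantization L ωt) {α : Action ES 𝓐 J} (μ : MomentumMap α ωt)
    (X : Cₛ^∞⟮𝓘(ℝ, EM); FA, A⟯) (σ : Cₛ^∞⟮𝓘(ℝ, ES); ℂ, L⟯) (s : S) : L s :=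
  P.nabla.toFun σ s ((α.leafField X).at s)
    - (2 * Real.pi * Complex.I * (μ.toFun s (X (J s)) : ℂ)) • σ s

/-- `∇_v σ` for complexified vertical vectors `v`. -/
def complexNabla {𝓐 : LieAlgebroid EM FA A} {J : S → M} {ωt : PresymplecticForm ES 𝓐 J}
    (P : Prequantization L ωt) (σ : Cₛ^∞⟮𝓘(ℝ, ES); ℂ, L⟯) (s : S) :
    (ℂ ⊗[ℝ] vertical EM ES J s) →ₗ[ℂ] L s :=
  LinearMap.liftBaseChange ℂ (P.nabla.toFun σ s ∘ₗ vertIncl 𝓐 J s)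

/-- `∇_v σ = 0` for all polarized vectors `v` at `s`. -/
def IsHolomorphicAt {𝓐 : LieAlgebroid EM FA A} {J : S → M} {ωt : PresymplecticForm ES 𝓐 J}
    (P : Prequantization L ωt) (c : AlmostComplex EM ES J) (σ : Cₛ^∞⟮𝓘(ℝ, ES); ℂ, L⟯) (s : S) :
    Prop :=
  ∀ v ∈ kahlerPolarization c s, complexNabla P σ s v = 0

/-- The geometric quantization `Δ_Q`: the holomorphic smooth sections of `L → S`. -/
def geometricQuantization {𝓐 : LieAlgebroid EM FA A} {J : S → M} {ωt : PresymplecticForm ES 𝓐 J}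
    (P : Prequantization L ωt) (c : AlmostComplex EM ES J) : Set Cₛ^∞⟮𝓘(ℝ, ES); ℂ, L⟯ :=
  {σ | ∀ s, IsHolomorphicAt P c σ s}

theorem complexNabla_add {𝓐 : LieAlgebroid EM FA A} {J : S → M} {ωt : PresymplecticForm ES 𝓐 J}
    (P : Prequantization L ωt) (σ τ : Cₛ^∞⟮𝓘(ℝ, ES); ℂ, L⟯) (s : S) :
    complexNabla P (σ + τ) s = complexNabla P σ s + complexNabla P τ s := by
  ext v
  simp [complexNabla, P.nabla.add]

theorem complexNabla_smul {𝓐 : LieAlgebroid EM FA A} {J : S → M} {ωt : PresymplecticForm ES 𝓐 J}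
    (P : Prequantization L ωt) (a : ℂ) (σ : Cₛ^∞⟮𝓘(ℝ, ES); ℂ, L⟯) (s : S) :
    complexNabla P (complexSmul (ContMDiffMap.const a) σ) s = a • complexNabla P σ s := by
  have h : ∀ (v : TangentSpace 𝓘(ℝ, ES) s),
      dirDeriv (ContMDiffMap.const a : C^∞⟮𝓘(ℝ, ES), S; 𝓘(ℝ, ℂ), ℂ⟯) s v = 0 := by
    intro v
    have : (⇑(ContMDiffMap.const a : C^∞⟮𝓘(ℝ, ES), S; 𝓘(ℝ, ℂ), ℂ⟯)) = fun _ => a := rfl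
    rw [dirDeriv, this, mfderiv_const]
    rfl
  ext v
  have hc : (ContMDiffMap.const a : C^∞⟮𝓘(ℝ, ES), S; 𝓘(ℝ, ℂ), ℂ⟯) s = a := rfl
  simp [complexNabla, P.nabla.leibniz, h, hc]

/-- The space of holomorphic sections of `L` over the fibre `S_m`: a section over the (closed)
submanifold `S_m` is smooth iff it is the restriction of a smooth section over `S`, and its
derivatives along `S_m` are those of any such extension. -/
def holomorphicSections {𝓐 : LieAlgebroid EM FA A} {J : S → M} {ωt : PresymplecticForm ES 𝓐 J}
    (P : Prequantization L ωt) (c : AlmostComplex EM ES J) (m : M) :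
    Submodule ℂ (∀ s : J ⁻¹' {m}, L s) where
  carrier := {q | ∃ σ : Cₛ^∞⟮𝓘(ℝ, ES); ℂ, L⟯,
    ∀ s : J ⁻¹' {m}, σ s = q s ∧ IsHolomorphicAt P c σ s}
  zero_mem' := by
    refine ⟨complexSmul (ContMDiffMap.const 0) 0, fun s => ⟨?_, ?_⟩⟩
    · change (0 : ℂ) • (0 : L s) = 0
      simp
    · intro v _
      rw [complexNabla_smul]
      simp
  add_mem' := by
    rintro q r ⟨σ, hσ⟩ ⟨τ, hτ⟩
    refine ⟨σ + τ, fun s => ⟨?_, ?_⟩⟩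
    · change σ s + τ s = q s + r s
      rw [(hσ s).1, (hτ s).1]
    · intro v hv
      rw [complexNabla_add, LinearMap.add_apply, (hσ s).2 v hv, (hτ s).2 v hv, add_zero]
  smul_mem' := by
    rintro a q ⟨σ, hσ⟩
    refine ⟨complexSmul (ContMDiffMap.const a) σ, fun s => ⟨?_, ?_⟩⟩
    · change a • σ s = a • q s
      rw [(hσ s).1]
    · intro v hv
      rw [complexNabla_smul, LinearMap.smul_apply, (hσ s).2 v hv, smul_zero]

/-! ### The quantization bundle and representations -/

variable {FQ : Type*} [NormedAddCommGroup FQ] [NormedSpace ℂ FQ]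
  {Q : M → Type*} [∀ m, AddCommGroup (Q m)] [∀ m, Module ℂ (Q m)]
  [TopologicalSpace (TotalSpace FQ Q)] [∀ m, TopologicalSpace (Q m)] [FiberBundle FQ Q]
  [VectorBundle ℂ FQ Q] [VectorBundle ℝ FQ Q]

/-- The section of `L → S` which corresponds to a family of sections of `L` over the fibres. -/
def glue {𝓐 : LieAlgebroid EM FA A} {J : S → M} {ωt : PresymplecticForm ES 𝓐 J}
    {P : Prequantization L ωt} {c : AlmostComplex EM ES J}
    (ev : ∀ m, Q m ≃ₗ[ℂ] holomorphicSections P c m) (q : ∀ m, Q m) (s : S) : L s :=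
  (ev (J s) (q (J s))).1 ⟨s, rfl⟩

variable (FQ Q) in
/-- An identification of the smooth complex vector bundle `Q → M` with the geometric quantization:
the fibre `Q_m` is the space of holomorphic sections of `L` over `S_m`, and the smooth sections of
`Q` are the families that glue to an element of `Δ_Q`. -/
structure QuantizationBundle {𝓐 : LieAlgebroid EM FA A} {J : S → M} {ωt : PresymplecticForm ES 𝓐 J}
    (P : Prequantization L ωt) (c : AlmostComplex EM ES J) where
  ev : ∀ m, Q m ≃ₗ[ℂ] holomorphicSections P c m
  smooth_iff : ∀ q : ∀ m, Q m,
    ContMDiff 𝓘(ℝ, EM) (𝓘(ℝ, EM).prod 𝓘(ℝ, FQ)) ∞ (fun m => TotalSpace.mk' FQ m (q m)) ↔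
    ∃ σ ∈ geometricQuantization P c, ∀ s, σ s = glue ev q s

/-- The smooth section of `L → S` that corresponds to a smooth section of `Q → M`. -/
def QuantizationBundle.toSection {𝓐 : LieAlgebroid EM FA A} {J : S → M}
    {ωt : PresymplecticForm ES 𝓐 J} {P : Prequantization L ωt} {c : AlmostComplex EM ES J}
    (𝓠 : QuantizationBundle FQ Q P c) (q : Cₛ^∞⟮𝓘(ℝ, EM); FQ, Q⟯) : Cₛ^∞⟮𝓘(ℝ, ES); ℂ, L⟯ :=
  ⟨glue 𝓠.ev q, by
    obtain ⟨σ, -, hσ⟩ := (𝓠.smooth_iff q).1 q.contMDiff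
    have h : glue 𝓠.ev q = ⇑σ := funext fun s => (hσ s).symm
    rw [h]
    exact σ.contMDiff⟩

variable (FQ Q) in
/-- A representation (flat `A`-connection) of the Lie algebroid `A → M` on a complex vector bundle
over the same base `M`. -/
structure Representation (𝓐 : LieAlgebroid EM FA A) where
  toFun : Cₛ^∞⟮𝓘(ℝ, EM); FA, A⟯ → Cₛ^∞⟮𝓘(ℝ, EM); FQ, Q⟯ → Cₛ^∞⟮𝓘(ℝ, EM); FQ, Q⟯
  add_left : ∀ X Y σ, toFun (X + Y) σ = toFun X σ + toFun Y σ
  smul_left : ∀ (f : C^∞⟮𝓘(ℝ, EM), M; 𝓘(ℝ, ℝ), ℝ⟯) X σ m,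
    toFun (realSmul f X) σ m = f m • toFun X σ m
  add_right : ∀ X σ τ, toFun X (σ + τ) = toFun X σ + toFun X τ
  leibniz : ∀ X (f : C^∞⟮𝓘(ℝ, EM), M; 𝓘(ℝ, ℂ), ℂ⟯) σ m,
    toFun X (complexSmul f σ) m
      = f m • toFun X σ m + dirDeriv f m (𝓐.anchor m (X m)) • σ m
  flat : ∀ X Y σ, toFun (𝓐.bracket X Y) σ = toFun X (toFun Y σ) - toFun Y (toFun X σ)

/-- The representation is Hermitian with respect to the Hermitian metric `g`. -/
def Representation.IsHermitian {𝓐 : LieAlgebroid EM FA A} (R : Representation FQ Q 𝓐)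
    (g : HermitianMetric EM FQ Q) : Prop :=
  ∀ X σ τ m, g.inner m (R.toFun X σ m) (τ m) + g.inner m (σ m) (R.toFun X τ m)
    = dirDeriv (fun m' => g.inner m' (σ m') (τ m')) m (𝓐.anchor m (X m))

end Algebroid

end KahlerQuantization

end

/-!
The operator `π(X) = ∇_{α(X)} - 2πi ⟨μ̃, J^*X⟩` acts on all sections of `L`. There are two things to
show: that it preserves the holomorphic sections, and that it differentiates the `L²` metric along
the anchor.

*Algebra on `L`.* The prequantization condition on `μ̃` cancels the curvature `2πi ω̃`, so that `π` is
a representation (`prequantSection_bracket`). For vertical `v`, the quantization condition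
`v · μ̃_X = - ω̃(α(X), v)` does the same in the commutator of `π(X)` with `∇_v`, which is therefore
`∇_{[α(X), v]}` (`nabla_vertical_prequantSection`). Together with `[α(X), j v] = j [α(X), v]` this
shows that `π(X)` commutes with `∇_v + i ∇_{j v}` up to an operator of the same form, so it preserves
`Δ_Q` (`prequantSection_mem`). As `μ̃` is real, `π(X)` satisfies
`h(π(X) σ, τ) + h(σ, π(X) τ) = α(X) · h(σ, τ)` (`hermitian_prequantSection`).

*Integration over the fibres.* In a chart in which `J` is a projection `O × W → O`
(`AdaptedChart`), the measure `Ω_m` has the density `√det ω(∂ᵢ, ∂ⱼ)`; this is the change of variables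
formula (`AdaptedChart.liouvilleMeasure_restrict`). The density is smooth and positive, because the
determinant of an invertible skew-symmetric matrix is positive (`det_pos_of_skew`). With a partition
of unity it follows that fibre integrals of smooth functions are smooth on `M`
(`contMDiff_integral_liouvilleMeasure`).

*Invariance of the Liouville measures.* Since `ω̃` is closed and `ω̃(α(X), ·)` is exact along the
fibres, the flow of `α(X)` preserves `ω` (`MomentumMap.dirDeriv_vertForm`). In an adapted chart this
says that the derivative of the density along `α(X)` is minus its product with the divergence of the
components of `α(X)` along the fibres (`AdaptedChart.dirDeriv_density`). Differentiation under the
integral sign and partial integration along the fibres then give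
`ρ(X) · ∫ f Ω_m = ∫ (α(X) · f) Ω_m` (`dirDeriv_integral_liouvilleMeasure`); for `f = h(σ, τ)` this is
the Hermitian property of the representation on `Q`.
-/

noncomputable section

namespace KahlerQuantization

set_option linter.unusedSectionVars false

universe uM uS

open scoped Topology

/-! ### Directional derivatives in charts -/

section ChartCalculus

variable {EB : Type*} [NormedAddCommGroup EB] [NormedSpace ℝ EB]
  {B : Type*} [TopologicalSpace B] [ChartedSpace EB B] [IsManifold 𝓘(ℝ, EB) ∞ B]
  {V : Type*} [NormedAddCommGroup V] [NormedSpace ℝ V]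
  {G : Type*} [NormedAddCommGroup G] [NormedSpace ℝ G]
  {G' : Type*} [NormedAddCommGroup G'] [NormedSpace ℝ G']

variable (EB) in
/-- A smooth chart with values in a normed space `V`, which need not be the model space. -/
structure IsSmoothChart (e : OpenPartialHomeomorph B V) : Prop where
  smooth : ContMDiffOn 𝓘(ℝ, EB) 𝓘(ℝ, V) ∞ e e.source
  smooth_symm : ContMDiffOn 𝓘(ℝ, V) 𝓘(ℝ, EB) ∞ e.symm e.target

theorem isSmoothChart_chartAt (b : B) : IsSmoothChart EB (chartAt EB b) :=
  ⟨contMDiffOn_chart, contMDiffOn_chart_symm⟩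

theorem dirDeriv_comp {H : Type*} [NormedAddCommGroup H] [NormedSpace ℝ H]
    {C : Type*} [TopologicalSpace C] [ChartedSpace H C]
    {f : C → G} {g : B → C} {b : B}
    (hf : MDifferentiableAt 𝓘(ℝ, H) 𝓘(ℝ, G) f (g b))
    (hg : MDifferentiableAt 𝓘(ℝ, EB) 𝓘(ℝ, H) g b) (v : TangentSpace 𝓘(ℝ, EB) b) :
    dirDeriv (f ∘ g) b v = dirDeriv f (g b) (mfderiv 𝓘(ℝ, EB) 𝓘(ℝ, H) g b v) := by
  rw [dirDeriv, dirDeriv, mfderiv_comp b hf hg]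
  rfl

theorem dirDeriv_congr {f g : B → G} {b : B} (h : f =ᶠ[𝓝 b] g) (v : TangentSpace 𝓘(ℝ, EB) b) :
    dirDeriv f b v = dirDeriv g b v := by
  unfold dirDeriv
  exact congrArg (fun L : TangentSpace 𝓘(ℝ, EB) b →L[ℝ] G => L v) h.mfderiv_eq

/-- The derivative at `x` of a map `g : V → B` on a normed space. Its domain is written as `V` rather
than as the tangent space of `V` at `x`. -/
def pushVec (g : V → B) (x : V) : V →ₗ[ℝ] TangentSpace 𝓘(ℝ, EB) (g x) :=
  (mfderiv 𝓘(ℝ, V) 𝓘(ℝ, EB) g x).toLinearMap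

/-- The derivative `v ↦ v · f` as a linear map. -/
def dirDerivLin (f : B → G) (b : B) : TangentSpace 𝓘(ℝ, EB) b →ₗ[ℝ] G :=
  (mfderiv 𝓘(ℝ, EB) 𝓘(ℝ, G) f b).toLinearMap

theorem dirDeriv_eq_fderiv (f : V → G) (x : V) (v : V) :
    dirDeriv (EB := V) f x v = fderiv ℝ f x v := by
  unfold dirDeriv
  exact congrArg (fun L : V →L[ℝ] G => L v) mfderiv_eq_fderiv

theorem dirDeriv_comp_pushVec {f : B → G} {g : V → B} {x : V}
    (hf : MDifferentiableAt 𝓘(ℝ, EB) 𝓘(ℝ, G) f (g x))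
    (hg : MDifferentiableAt 𝓘(ℝ, V) 𝓘(ℝ, EB) g x) (v : V) :
    fderiv ℝ (f ∘ g) x v = dirDeriv f (g x) (pushVec (EB := EB) g x v) :=
  (dirDeriv_eq_fderiv _ _ _).symm.trans (dirDeriv_comp hf hg v)

theorem dirDeriv_clm_comp (Λ : G →L[ℝ] G') {f : B → G} {b : B}
    (hf : MDifferentiableAt 𝓘(ℝ, EB) 𝓘(ℝ, G) f b) (v : TangentSpace 𝓘(ℝ, EB) b) :
    dirDeriv (fun t => Λ (f t)) b v = Λ (dirDeriv f b v) := by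
  have := dirDeriv_comp (f := Λ) (g := f) (b := b)
    Λ.differentiable.mdifferentiable.mdifferentiableAt hf v
  rw [show (fun t => Λ (f t)) = Λ ∘ f from rfl, this]
  exact (dirDeriv_eq_fderiv _ _ _).trans (by rw [Λ.fderiv]; rfl)

/-- The chain rule for a function of two variables. -/
theorem dirDeriv_fst_add_snd {f : G × G' → V} {b : B} {p : B → G} {q : B → G'}
    (hf : DifferentiableAt ℝ f (p b, q b))
    (hp : MDifferentiableAt 𝓘(ℝ, EB) 𝓘(ℝ, G) p b) (hq : MDifferentiableAt 𝓘(ℝ, EB) 𝓘(ℝ, G') q b)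
    (v : TangentSpace 𝓘(ℝ, EB) b) :
    dirDeriv (fun t => f (p t, q t)) b v
      = fderiv ℝ f (p b, q b) (dirDeriv p b v, dirDeriv q b v) := by
  have hpq := hp.prodMk_space hq
  have h := dirDeriv_comp (f := f) (g := fun t => (p t, q t)) (b := b) hf.mdifferentiableAt hpq v
  rw [show (fun t => f (p t, q t)) = f ∘ (fun t => (p t, q t)) from rfl, h]
  refine (dirDeriv_eq_fderiv _ _ _).trans ?_
  congr 1
  refine Prod.ext ?_ ?_
  · exact (dirDeriv_clm_comp (ContinuousLinearMap.fst ℝ G G') hpq v).symm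
  · exact (dirDeriv_clm_comp (ContinuousLinearMap.snd ℝ G G') hpq v).symm

theorem dirDeriv_mul {𝔸 : Type*} [NormedCommRing 𝔸] [NormedAlgebra ℝ 𝔸] {f g : B → 𝔸} {b : B}
    (hf : MDifferentiableAt 𝓘(ℝ, EB) 𝓘(ℝ, 𝔸) f b) (hg : MDifferentiableAt 𝓘(ℝ, EB) 𝓘(ℝ, 𝔸) g b)
    (v : TangentSpace 𝓘(ℝ, EB) b) :
    dirDeriv (fun t => f t * g t) b v = f b * dirDeriv g b v + dirDeriv f b v * g b := by
  rw [dirDeriv_fst_add_snd (f := fun p : 𝔸 × 𝔸 => p.1 * p.2)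
    (differentiableAt_fst.mul differentiableAt_snd) hf hg,
    fderiv_fun_mul differentiableAt_fst differentiableAt_snd]
  simp [fderiv_fst, fderiv_snd, mul_comm]

theorem dirDeriv_add {f g : B → G} {b : B}
    (hf : MDifferentiableAt 𝓘(ℝ, EB) 𝓘(ℝ, G) f b) (hg : MDifferentiableAt 𝓘(ℝ, EB) 𝓘(ℝ, G) g b)
    (v : TangentSpace 𝓘(ℝ, EB) b) :
    dirDeriv (fun t => f t + g t) b v = dirDeriv f b v + dirDeriv g b v := by
  rw [dirDeriv_fst_add_snd (f := fun p : G × G => p.1 + p.2)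
    (differentiableAt_fst.add differentiableAt_snd) hf hg,
    fderiv_fun_add differentiableAt_fst differentiableAt_snd]
  simp [fderiv_fst, fderiv_snd]

theorem dirDeriv_const (a : G) (b : B) (v : TangentSpace 𝓘(ℝ, EB) b) :
    dirDeriv (fun _ => a) b v = 0 := by
  rw [dirDeriv, mfderiv_const]
  rfl

theorem dirDeriv_sum {ι : Type*} {T : Finset ι} {g : ι → B → G} {b : B}
    (hg : ∀ i ∈ T, MDifferentiableAt 𝓘(ℝ, EB) 𝓘(ℝ, G) (g i) b) (v : TangentSpace 𝓘(ℝ, EB) b) :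
    dirDeriv (fun t => ∑ i ∈ T, g i t) b v = ∑ i ∈ T, dirDeriv (g i) b v := by
  classical
  have key : ∀ T' ⊆ T, MDifferentiableAt 𝓘(ℝ, EB) 𝓘(ℝ, G) (fun t => ∑ i ∈ T', g i t) b ∧
      dirDeriv (fun t => ∑ i ∈ T', g i t) b v = ∑ i ∈ T', dirDeriv (g i) b v := by
    intro T'
    induction T' using Finset.induction_on with
    | empty => exact fun _ => ⟨mdifferentiableAt_const, dirDeriv_const 0 b v⟩
    | insert i T' hi ih =>
      intro hT
      obtain ⟨h1, h2⟩ := ih ((Finset.subset_insert i T').trans hT)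
      have h3 := hg i (hT (Finset.mem_insert_self i T'))
      simp only [Finset.sum_insert hi]
      exact ⟨h3.add h1, by rw [dirDeriv_add h3 h1, h2]⟩
  exact (key T subset_rfl).2

theorem IsSmoothChart.mdifferentiableAt {e : OpenPartialHomeomorph B V} (he : IsSmoothChart EB e)
    {b : B} (hb : b ∈ e.source) : MDifferentiableAt 𝓘(ℝ, EB) 𝓘(ℝ, V) e b :=
  (he.smooth.contMDiffAt (e.open_source.mem_nhds hb)).mdifferentiableAt (by simp)

theorem IsSmoothChart.mdifferentiableAt_symm {e : OpenPartialHomeomorph B V}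
    (he : IsSmoothChart EB e) {x : V} (hx : x ∈ e.target) :
    MDifferentiableAt 𝓘(ℝ, V) 𝓘(ℝ, EB) e.symm x :=
  (he.smooth_symm.contMDiffAt (e.open_target.mem_nhds hx)).mdifferentiableAt (by simp)

theorem IsSmoothChart.pushVec_dirDeriv {e : OpenPartialHomeomorph B V} (he : IsSmoothChart EB e)
    {b : B} (hb : b ∈ e.source) (v : TangentSpace 𝓘(ℝ, EB) b) :
    pushVec (EB := EB) e.symm (e b) (dirDeriv e b v) = v := by
  have h1 := mfderiv_comp b (he.mdifferentiableAt_symm (e.map_source hb)) (he.mdifferentiableAt hb)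
  have h2 : (e.symm ∘ e) =ᶠ[𝓝 b] id := by
    filter_upwards [e.open_source.mem_nhds hb] with t ht using e.left_inv ht
  have h3 := h1.symm.trans (h2.mfderiv_eq.trans mfderiv_id)
  exact congrArg (fun L : EB →L[ℝ] EB => L v) h3

theorem IsSmoothChart.dirDeriv_pushVec {e : OpenPartialHomeomorph B V}
    (he : IsSmoothChart EB e) {x : V} (hx : x ∈ e.target) (v : V) :
    dirDeriv e (e.symm x) (pushVec (EB := EB) e.symm x v) = v := by
  rw [← dirDeriv_comp_pushVec (he.mdifferentiableAt (e.map_target hx))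
    (he.mdifferentiableAt_symm hx)]
  have h2 : (e ∘ e.symm) =ᶠ[𝓝 x] id := by
    filter_upwards [e.open_target.mem_nhds hx] with t ht using e.right_inv ht
  rw [h2.fderiv_eq, fderiv_id]
  rfl

/-- The derivative of a function along a tangent vector, computed in a smooth chart. -/
theorem IsSmoothChart.dirDeriv_eq {e : OpenPartialHomeomorph B V} (he : IsSmoothChart EB e)
    {f : B → G} {b : B} (hb : b ∈ e.source) (hf : MDifferentiableAt 𝓘(ℝ, EB) 𝓘(ℝ, G) f b)
    (v : TangentSpace 𝓘(ℝ, EB) b) :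
    dirDeriv f b v = fderiv ℝ (f ∘ e.symm) (e b) (dirDeriv e b v) := by
  have hf' : MDifferentiableAt 𝓘(ℝ, EB) 𝓘(ℝ, G) f (e.symm (e b)) := by rwa [e.left_inv hb]
  have h := dirDeriv_comp (f := f ∘ e.symm) (g := e) (b := b)
    (hf'.comp (e b) (he.mdifferentiableAt_symm (e.map_source hb))) (he.mdifferentiableAt hb) v
  rw [← dirDeriv_congr (f := (f ∘ e.symm) ∘ e)]
  · rw [h]
    exact dirDeriv_eq_fderiv _ _ _
  · filter_upwards [e.open_source.mem_nhds hb] with t ht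
    simp [e.left_inv ht]

theorem contMDiffOn_dirDeriv {U : Set B} (hU : IsOpen U) {f : B → G}
    (hf : ContMDiffOn 𝓘(ℝ, EB) 𝓘(ℝ, G) ∞ f U) {Z : ∀ b : B, TangentSpace 𝓘(ℝ, EB) b}
    (hZ : ContMDiffOn 𝓘(ℝ, EB) 𝓘(ℝ, EB).tangent ∞
      (fun b => (⟨b, Z b⟩ : TangentBundle 𝓘(ℝ, EB) B)) U) :
    ContMDiffOn 𝓘(ℝ, EB) 𝓘(ℝ, G) ∞ (fun b => dirDeriv f b (Z b)) U := by
  have h1 := hf.contMDiffOn_tangentMapWithin (m := ∞) le_rfl hU.uniqueMDiffOn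
  have h2 := h1.comp hZ (fun b hb => hb)
  have h3 := (contMDiff_snd_tangentBundle_modelSpace G 𝓘(ℝ, G) (n := ∞)).comp_contMDiffOn h2
  refine h3.congr fun b hb => ?_
  simp only [Function.comp, tangentMapWithin, dirDeriv]
  rw [mfderivWithin_of_isOpen hU hb]

theorem contMDiff_dirDeriv {f : B → G}
    (hf : ContMDiff 𝓘(ℝ, EB) 𝓘(ℝ, G) ∞ f) {Z : ∀ b : B, TangentSpace 𝓘(ℝ, EB) b}
    (hZ : ContMDiff 𝓘(ℝ, EB) 𝓘(ℝ, EB).tangent ∞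
      (fun b => (⟨b, Z b⟩ : TangentBundle 𝓘(ℝ, EB) B))) :
    ContMDiff 𝓘(ℝ, EB) 𝓘(ℝ, G) ∞ (fun b => dirDeriv f b (Z b)) :=
  contMDiffOn_univ.1 (contMDiffOn_dirDeriv isOpen_univ hf.contMDiffOn hZ.contMDiffOn)

theorem IsSmoothChart.dirDeriv_pushVec_apply {e : OpenPartialHomeomorph B V}
    (he : IsSmoothChart EB e) {b : B} (hb : b ∈ e.source) (v : V) :
    dirDeriv e b (pushVec (EB := EB) e.symm (e b) v) = v := by
  have h : ∀ b', b' = b → ∀ w : EB, dirDeriv e b' w = dirDeriv e b w := by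
    rintro b' rfl w
    rfl
  exact (h _ (e.left_inv hb) _).symm.trans (he.dirDeriv_pushVec (e.map_source hb) v)

theorem IsSmoothChart.contMDiffOn_pushVec {e : OpenPartialHomeomorph B V}
    (he : IsSmoothChart EB e) (v : V) :
    ContMDiffOn 𝓘(ℝ, EB) 𝓘(ℝ, EB).tangent ∞
      (fun b => (⟨b, pushVec (EB := EB) e.symm (e b) v⟩ : TangentBundle 𝓘(ℝ, EB) B)) e.source := by
  have h1 := he.smooth_symm.contMDiffOn_tangentMapWithin (m := ∞) le_rfl
    e.open_target.uniqueMDiffOn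
  have h2 : ContMDiffOn 𝓘(ℝ, V) 𝓘(ℝ, V).tangent ∞
      (fun x : V => (⟨x, v⟩ : TangentBundle 𝓘(ℝ, V) V)) Set.univ :=
    (contMDiffOn_vectorSpace_iff_contDiffOn (V := fun _ => v)).2 contDiffOn_const
  have h3 := h1.comp ((h2.mono (Set.subset_univ e.target)).comp he.smooth
    fun b hb => e.map_source hb) (fun b hb => e.map_source hb)
  refine h3.congr fun b hb => ?_
  have h4 : ∀ b' : B, b' = b → ∀ w : EB, (⟨b, w⟩ : TangentBundle 𝓘(ℝ, EB) B) = ⟨b', w⟩ := by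
    rintro b' rfl w
    rfl
  refine (h4 _ (e.left_inv hb) _).trans ?_
  simp only [Function.comp, tangentMapWithin]
  rw [mfderivWithin_of_isOpen e.open_target (e.map_source hb)]
  rfl

variable [CompleteSpace EB]

/-- In the preferred chart, the bracket of vector fields is the bracket of their local
expressions. -/
theorem dirDeriv_chartAt_mlieBracket (Z Y : ∀ b : B, TangentSpace 𝓘(ℝ, EB) b) (s : B) :
    dirDeriv (chartAt EB s) s (VectorField.mlieBracket 𝓘(ℝ, EB) Z Y s)
      = VectorField.lieBracket ℝ
        (fun x => dirDeriv (chartAt EB s) ((chartAt EB s).symm x) (Z ((chartAt EB s).symm x)))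
        (fun x => dirDeriv (chartAt EB s) ((chartAt EB s).symm x) (Y ((chartAt EB s).symm x)))
        (chartAt EB s s) := by
  have hs : s ∈ (chartAt EB s).source := mem_chart_source EB s
  have key : ∀ (W : ∀ b : B, TangentSpace 𝓘(ℝ, EB) b), ∀ x ∈ (chartAt EB s).target,
      VectorField.mpullbackWithin 𝓘(ℝ, EB) 𝓘(ℝ, EB) (extChartAt 𝓘(ℝ, EB) s).symm W
        (Set.range 𝓘(ℝ, EB)) x
      = dirDeriv (chartAt EB s) ((chartAt EB s).symm x) (W ((chartAt EB s).symm x)) := by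
    intro W x hx
    have hx' : x ∈ (extChartAt 𝓘(ℝ, EB) s).target := by simpa using hx
    have h := ContinuousLinearMap.inverse_eq
      (mfderivWithin_extChartAt_symm_comp_mfderiv_extChartAt hx')
      (mfderiv_extChartAt_comp_mfderivWithin_extChartAt_symm hx')
    exact congrArg (fun L : EB →L[ℝ] EB => L (W ((chartAt EB s).symm x))) h
  have hinv := isInvertible_mfderiv_extChartAt (mem_extChartAt_source (I := 𝓘(ℝ, EB)) s)
  have h1 : ∀ w : EB, dirDeriv (chartAt EB s) s
      ((mfderiv 𝓘(ℝ, EB) 𝓘(ℝ, EB) (extChartAt 𝓘(ℝ, EB) s) s).inverse w) = w :=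
    fun w => hinv.self_apply_inverse w
  refine (h1 _).trans ?_
  have hset : (extChartAt 𝓘(ℝ, EB) s).symm ⁻¹' Set.univ ∩ Set.range 𝓘(ℝ, EB) = Set.univ := by simp
  have hnhds : (chartAt EB s).target ∈ 𝓝 (chartAt EB s s) := chart_target_mem_nhds EB s
  rw [hset]
  refine (congrFun (VectorField.lieBracketWithin_univ (𝕜 := ℝ) (E := EB)) _).trans ?_
  refine Filter.EventuallyEq.lieBracket_vectorField_eq (𝕜 := ℝ) (E := EB) ?_ ?_
  · filter_upwards [hnhds] with x hx using key Z x hx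
  · filter_upwards [hnhds] with x hx using key Y x hx

/-- The bracket of vector fields is the commutator of the derivations. -/
theorem dirDeriv_mlieBracket {U : Set B} (hU : IsOpen U) {s : B} (hs : s ∈ U) {f : B → G}
    (hf : ContMDiffOn 𝓘(ℝ, EB) 𝓘(ℝ, G) ∞ f U) {Z Y : ∀ b : B, TangentSpace 𝓘(ℝ, EB) b}
    (hZ : ContMDiff 𝓘(ℝ, EB) 𝓘(ℝ, EB).tangent ∞
      (fun b => (⟨b, Z b⟩ : TangentBundle 𝓘(ℝ, EB) B)))
    (hY : ContMDiff 𝓘(ℝ, EB) 𝓘(ℝ, EB).tangent ∞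
      (fun b => (⟨b, Y b⟩ : TangentBundle 𝓘(ℝ, EB) B))) :
    dirDeriv f s (VectorField.mlieBracket 𝓘(ℝ, EB) Z Y s)
      = dirDeriv (fun t => dirDeriv f t (Y t)) s (Z s)
        - dirDeriv (fun t => dirDeriv f t (Z t)) s (Y s) := by
  set φ := chartAt EB s with hφ
  have hφs : IsSmoothChart EB φ := isSmoothChart_chartAt s
  have hsφ : s ∈ φ.source := mem_chart_source EB s
  have hT : IsOpen (φ.target ∩ φ.symm ⁻¹' U) := φ.isOpen_inter_preimage_symm hU
  have hx0 : φ s ∈ φ.target ∩ φ.symm ⁻¹' U :=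
    ⟨φ.map_source hsφ, by rwa [Set.mem_preimage, φ.left_inv hsφ]⟩
  have hloc : ∀ W : ∀ b : B, TangentSpace 𝓘(ℝ, EB) b,
      ContMDiff 𝓘(ℝ, EB) 𝓘(ℝ, EB).tangent ∞
        (fun b => (⟨b, W b⟩ : TangentBundle 𝓘(ℝ, EB) B)) →
      DifferentiableAt ℝ (fun x => dirDeriv φ (φ.symm x) (W (φ.symm x))) (φ s) := by
    intro W hW
    have h := (contMDiffOn_dirDeriv φ.open_source hφs.smooth hW.contMDiffOn).comp
      hφs.smooth_symm (fun x hx => φ.map_target hx)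
    exact (h.contMDiffAt (φ.open_target.mem_nhds hx0.1)).contDiffAt.differentiableAt (by simp)
  have hfc : ContDiffAt ℝ ∞ (f ∘ φ.symm) (φ s) := by
    have h := hf.comp (hφs.smooth_symm.mono Set.inter_subset_left)
      (s := φ.target ∩ φ.symm ⁻¹' U) (fun x hx => hx.2)
    exact (h.contMDiffAt (hT.mem_nhds hx0)).contDiffAt
  have hfd : ∀ b ∈ U, MDifferentiableAt 𝓘(ℝ, EB) 𝓘(ℝ, G) f b := fun b hb =>
    (hf.contMDiffAt (hU.mem_nhds hb)).mdifferentiableAt (by simp)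
  -- an iterated derivative is one in the chart, along the local expressions of the fields
  have houter : ∀ W W' : ∀ b : B, TangentSpace 𝓘(ℝ, EB) b,
      ContMDiff 𝓘(ℝ, EB) 𝓘(ℝ, EB).tangent ∞
        (fun b => (⟨b, W b⟩ : TangentBundle 𝓘(ℝ, EB) B)) →
      dirDeriv (fun t => dirDeriv f t (W t)) s (W' s)
        = fderiv ℝ (fun x => fderiv ℝ (f ∘ φ.symm) x (dirDeriv φ (φ.symm x) (W (φ.symm x)))) (φ s)
          (dirDeriv φ s (W' s)) := by
    intro W W' hW
    rw [hφs.dirDeriv_eq hsφ ((contMDiffOn_dirDeriv hU hf hW.contMDiffOn).contMDiffAt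
      (hU.mem_nhds hs) |>.mdifferentiableAt (by simp))]
    congr 1
    refine Filter.EventuallyEq.fderiv_eq ?_
    filter_upwards [hT.mem_nhds hx0] with x hx
    have := hφs.dirDeriv_eq (φ.map_target hx.1) (hfd _ hx.2) (W (φ.symm x))
    rw [φ.right_inv hx.1] at this
    exact this
  rw [houter Y Z hY, houter Z Y hZ, hφs.dirDeriv_eq hsφ (hfd s hs), dirDeriv_chartAt_mlieBracket,
    VectorField.fderiv_apply_lieBracket hfc
      (by rw [minSmoothness_of_isRCLikeNormedField]; exact WithTop.coe_le_coe.2 le_top)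
      (hloc Y hY) (hloc Z hZ)]
  have hback : ∀ W : ∀ b : B, TangentSpace 𝓘(ℝ, EB) b,
      dirDeriv φ (φ.symm (φ s)) (W (φ.symm (φ s))) = dirDeriv φ s (W s) := by
    intro W
    rw [φ.left_inv hsφ]
  rw [hback, hback]

variable (EB) in
theorem exists_bump_of_mem_nhds [FiniteDimensional ℝ EB] [T2Space B] {U : Set B} {s : B}
    (hU : U ∈ 𝓝 s) :
    ∃ χ : B → ℝ, ContMDiff 𝓘(ℝ, EB) 𝓘(ℝ, ℝ) ∞ χ ∧ tsupport χ ⊆ U ∧ χ =ᶠ[𝓝 s] 1 := by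
  obtain ⟨χ, -, hχ⟩ := (SmoothBumpFunction.nhds_basis_tsupport (I := 𝓘(ℝ, EB)) s).mem_iff.1 hU
  exact ⟨χ, χ.contMDiff, hχ, χ.eventuallyEq_one⟩

/-- A vector field along `D` that is smooth near a point agrees near that point with a global smooth
vector field along `D`. -/
theorem exists_fieldIn_eventuallyEq [FiniteDimensional ℝ EB] [T2Space B]
    {D : ∀ b : B, Submodule ℝ (TangentSpace 𝓘(ℝ, EB) b)}
    {U : Set B} (hU : IsOpen U) {s : B} (hs : s ∈ U) (W : ∀ b : B, D b)
    (hW : ContMDiffOn 𝓘(ℝ, EB) 𝓘(ℝ, EB).tangent ∞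
      (fun b => (⟨b, (W b).1⟩ : TangentBundle 𝓘(ℝ, EB) B)) U) :
    ∃ X : FieldIn D, ∀ᶠ t in 𝓝 s, X.at t = W t := by
  obtain ⟨χ, hχ, hχU, hχ1⟩ := exists_bump_of_mem_nhds EB (hU.mem_nhds hs)
  refine ⟨⟨⟨fun b => χ b • (W b).1, ?_⟩, fun b => (D b).smul_mem _ (W b).2⟩, ?_⟩
  · exact ContMDiffOn.smul_section_of_tsupport hχ.contMDiffOn hU hχU hW
  · filter_upwards [hχ1] with t ht
    refine Subtype.ext ?_
    change χ t • (W t).1 = (W t).1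
    rw [ht]
    exact one_smul _ _

end ChartCalculus

/-! ### Brackets with vertical vector fields -/

section VerticalBracket

variable {EM : Type*} [NormedAddCommGroup EM] [NormedSpace ℝ EM]
  {M : Type uM} [TopologicalSpace M] [ChartedSpace EM M] [IsManifold 𝓘(ℝ, EM) ∞ M]
  {ES : Type*} [NormedAddCommGroup ES] [NormedSpace ℝ ES]
  {S : Type uS} [TopologicalSpace S] [ChartedSpace ES S] [IsManifold 𝓘(ℝ, ES) ∞ S]

theorem mem_vertical_iff {J : S → M} {s : S} {v : TangentSpace 𝓘(ℝ, ES) s} :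
    v ∈ vertical EM ES J s ↔ mfderiv 𝓘(ℝ, ES) 𝓘(ℝ, EM) J s v = 0 := Iff.rfl

/-- Vertical vectors annihilate the functions that are pulled back from the base. -/
theorem dirDeriv_comp_of_vertical {G : Type*} [NormedAddCommGroup G] [NormedSpace ℝ G]
    {J : S → M} {f : M → G} {s : S}
    (hf : MDifferentiableAt 𝓘(ℝ, EM) 𝓘(ℝ, G) f (J s))
    (hJ : MDifferentiableAt 𝓘(ℝ, ES) 𝓘(ℝ, EM) J s) {v : TangentSpace 𝓘(ℝ, ES) s}
    (hv : v ∈ vertical EM ES J s) : dirDeriv (fun t => f (J t)) s v = 0 := by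
  have h := dirDeriv_comp hf hJ v
  rw [mem_vertical_iff.1 hv] at h
  exact h.trans (map_zero (dirDerivLin f (J s)))

variable [CompleteSpace ES]

/-- The bracket of a projectable vector field with a vertical one is vertical. -/
theorem mlieBracket_mem_vertical {J : S → M} (hJ : ContMDiff 𝓘(ℝ, ES) 𝓘(ℝ, EM) ∞ J)
    {Z Y : ∀ b : S, TangentSpace 𝓘(ℝ, ES) b}
    (hZ : ContMDiff 𝓘(ℝ, ES) 𝓘(ℝ, ES).tangent ∞
      (fun b => (⟨b, Z b⟩ : TangentBundle 𝓘(ℝ, ES) S)))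
    (hY : ContMDiff 𝓘(ℝ, ES) 𝓘(ℝ, ES).tangent ∞
      (fun b => (⟨b, Y b⟩ : TangentBundle 𝓘(ℝ, ES) S)))
    {ζ : ∀ m : M, TangentSpace 𝓘(ℝ, EM) m}
    (hζ : ContMDiff 𝓘(ℝ, EM) 𝓘(ℝ, EM).tangent ∞
      (fun m => (⟨m, ζ m⟩ : TangentBundle 𝓘(ℝ, EM) M)))
    (hZζ : ∀ s, mfderiv 𝓘(ℝ, ES) 𝓘(ℝ, EM) J s (Z s) = ζ (J s))
    (hYv : ∀ s, Y s ∈ vertical EM ES J s) (s : S) :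
    VectorField.mlieBracket 𝓘(ℝ, ES) Z Y s ∈ vertical EM ES J s := by
  set κ := chartAt EM (J s) with hκ
  have hκs : IsSmoothChart EM κ := isSmoothChart_chartAt (J s)
  have hU : IsOpen (J ⁻¹' κ.source) := κ.open_source.preimage hJ.continuous
  have hsU : s ∈ J ⁻¹' κ.source := mem_chart_source EM (J s)
  have hJd : ∀ t, MDifferentiableAt 𝓘(ℝ, ES) 𝓘(ℝ, EM) J t := fun t =>
    (hJ t).mdifferentiableAt (by simp)
  have hf : ContMDiffOn 𝓘(ℝ, ES) 𝓘(ℝ, EM) ∞ (fun t => κ (J t)) (J ⁻¹' κ.source) :=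
    hκs.smooth.comp hJ.contMDiffOn (fun t ht => ht)
  -- `Y` annihilates the coordinates `κ ∘ J` of the base, and `Z` maps them to functions that are
  -- again pulled back from the base, so that `[Z, Y]` annihilates them as well
  have hYf : (fun t => dirDeriv (fun t => κ (J t)) t (Y t)) =ᶠ[𝓝 s] fun _ => (0 : EM) := by
    filter_upwards [hU.mem_nhds hsU] with t ht
    exact dirDeriv_comp_of_vertical (hκs.mdifferentiableAt ht) (hJd t) (hYv t)
  have hZf : (fun t => dirDeriv (fun t => κ (J t)) t (Z t)) =ᶠ[𝓝 s]
      fun t => (fun m => dirDeriv κ m (ζ m)) (J t) := by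
    filter_upwards [hU.mem_nhds hsU] with t ht
    exact (dirDeriv_comp (hκs.mdifferentiableAt ht) (hJd t) (Z t)).trans (by rw [hZζ])
  have hbr := dirDeriv_mlieBracket hU hsU hf hZ hY
  rw [dirDeriv_congr hYf, dirDeriv_const, dirDeriv_congr hZf, dirDeriv_comp_of_vertical
    (((contMDiffOn_dirDeriv κ.open_source hκs.smooth hζ.contMDiffOn).contMDiffAt
      (κ.open_source.mem_nhds hsU)).mdifferentiableAt (by simp)) (hJd s) (hYv s), sub_zero] at hbr
  have h2 := dirDeriv_comp (hκs.mdifferentiableAt hsU) (hJd s)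
    (VectorField.mlieBracket 𝓘(ℝ, ES) Z Y s)
  have h3 := hκs.pushVec_dirDeriv hsU
    (mfderiv 𝓘(ℝ, ES) 𝓘(ℝ, EM) J s (VectorField.mlieBracket 𝓘(ℝ, ES) Z Y s))
  rw [← h2, show dirDeriv (κ ∘ J) s (VectorField.mlieBracket 𝓘(ℝ, ES) Z Y s) = 0 from hbr,
    map_zero] at h3
  exact mem_vertical_iff.2 h3.symm

theorem contMDiff_mlieBracket {Z Y : ∀ b : S, TangentSpace 𝓘(ℝ, ES) b}
    (hZ : ContMDiff 𝓘(ℝ, ES) 𝓘(ℝ, ES).tangent ∞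
      (fun b => (⟨b, Z b⟩ : TangentBundle 𝓘(ℝ, ES) S)))
    (hY : ContMDiff 𝓘(ℝ, ES) 𝓘(ℝ, ES).tangent ∞
      (fun b => (⟨b, Y b⟩ : TangentBundle 𝓘(ℝ, ES) S))) :
    ContMDiff 𝓘(ℝ, ES) 𝓘(ℝ, ES).tangent ∞
      (fun b => (⟨b, VectorField.mlieBracket 𝓘(ℝ, ES) Z Y b⟩ : TangentBundle 𝓘(ℝ, ES) S)) := by
  -- over `ℝ`, brackets need a manifold of class `C^n` with `n = minSmoothness ℝ 2 = 2`
  have : IsManifold 𝓘(ℝ, ES) (minSmoothness ℝ 2) S := by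
    rw [minSmoothness_of_isRCLikeNormedField]
    exact IsManifold.of_le (n := ∞) (WithTop.coe_le_coe.2 le_top)
  have : IsManifold 𝓘(ℝ, ES) (((⊤ : ℕ∞) : WithTop ℕ∞) + 1) S :=
    inferInstanceAs (IsManifold 𝓘(ℝ, ES) ∞ S)
  exact ContDiff.mlieBracket_vectorField (m := ⊤) (n := ⊤) hZ hY
    (by rw [minSmoothness_of_isRCLikeNormedField]; exact le_rfl)

/-- The bracket of a projectable vector field with a vertical one, as a vertical vector field. -/
def verticalBracket {J : S → M} (hJ : ContMDiff 𝓘(ℝ, ES) 𝓘(ℝ, EM) ∞ J)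
    (Z : Cₛ^∞⟮𝓘(ℝ, ES); ES, (TangentSpace 𝓘(ℝ, ES) : S → Type _)⟯)
    {ζ : ∀ m : M, TangentSpace 𝓘(ℝ, EM) m}
    (hζ : ContMDiff 𝓘(ℝ, EM) 𝓘(ℝ, EM).tangent ∞
      (fun m => (⟨m, ζ m⟩ : TangentBundle 𝓘(ℝ, EM) M)))
    (hZζ : ∀ s, mfderiv 𝓘(ℝ, ES) 𝓘(ℝ, EM) J s (Z s) = ζ (J s))
    (v : FieldIn (vertical EM ES J)) : FieldIn (vertical EM ES J) :=
  ⟨⟨VectorField.mlieBracket 𝓘(ℝ, ES) Z v.field,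
    contMDiff_mlieBracket Z.contMDiff v.field.contMDiff⟩,
    mlieBracket_mem_vertical hJ Z.contMDiff v.field.contMDiff hζ hZζ v.mem⟩

end VerticalBracket

/-! ### Charts adapted to a fibre bundle -/

section AdaptedCharts

variable {EM : Type*} [NormedAddCommGroup EM] [NormedSpace ℝ EM]
  {M : Type uM} [TopologicalSpace M] [ChartedSpace EM M] [IsManifold 𝓘(ℝ, EM) ∞ M]
  {ES : Type*} [NormedAddCommGroup ES] [NormedSpace ℝ ES]
  {S : Type uS} [TopologicalSpace S] [ChartedSpace ES S] [IsManifold 𝓘(ℝ, ES) ∞ S]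

variable (EM ES) in
/-- A chart of `S` in which `J` becomes the projection `O × W → O`, where `O` is an open set in the
model space of `M`. The base `O` is identified with a subset of `M` by the preferred chart at `m₀`. -/
structure AdaptedChart (J : S → M) (m₀ : M) (O : Set EM) (k : ℕ) where
  chart : OpenPartialHomeomorph S (EM × (Fin k → ℝ))
  isSmoothChart : IsSmoothChart ES chart
  fibreDom : Set (Fin k → ℝ)
  isOpen_fibreDom : IsOpen fibreDom
  isOpen_base : IsOpen O
  target_eq : chart.target = O ×ˢ fibreDom
  mem_base : ∀ s ∈ chart.source, J s ∈ (chartAt EM m₀).source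
  fst_eq : ∀ s ∈ chart.source, (chart s).1 = chartAt EM m₀ (J s)

/-- Adapted charts over a common base, which cover the part of the bundle over that base. -/
theorem IsCompactFiberBundle.exists_adaptedChart {J : S → M} (hJ : IsCompactFiberBundle EM ES J)
    (m₀ : M) :
    ∃ (k : ℕ) (O : Set EM), IsOpen O ∧ chartAt EM m₀ m₀ ∈ O ∧ ∀ s, J s ∈ (chartAt EM m₀).source →
      chartAt EM m₀ (J s) ∈ O → ∃ e : AdaptedChart EM ES J m₀ O k, s ∈ e.chart.source := by
  obtain ⟨k, N, _, _, _, _, _, U, Φ, hU, hmU, hsrc, htgt, hfst, hsm, hsm'⟩ := hJ.2 m₀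
  set κ := chartAt EM m₀ with hκ
  have hO : IsOpen (κ.target ∩ κ.symm ⁻¹' U) := κ.isOpen_inter_preimage_symm hU
  refine ⟨k, κ.target ∩ κ.symm ⁻¹' U, hO, ⟨mem_chart_target EM m₀, ?_⟩, ?_⟩
  · rw [Set.mem_preimage, κ.left_inv (mem_chart_source EM m₀)]
    exact hmU
  intro s hs hsO
  have hsU : J s ∈ U := by
    have := hsO.2
    rwa [Set.mem_preimage, κ.left_inv hs] at this
  have hsΦ : s ∈ Φ.source := by rw [hsrc]; exact hsU
  -- the local trivialization, followed by charts of the base and of the typical fibre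
  set φ := chartAt (EuclideanSpace ℝ (Fin k)) (Φ s).2 with hφ
  let ε := EuclideanSpace.equiv (Fin k) ℝ
  let φ' := φ.trans ε.toHomeomorph.toOpenPartialHomeomorph
  have hφ's : φ'.source = φ.source := by simp [φ']
  have hmem : ∀ t, t ∈ (Φ.trans (κ.prod φ')).source ↔
      t ∈ Φ.source ∧ J t ∈ κ.source ∧ (Φ t).2 ∈ φ.source := by
    intro t
    rw [OpenPartialHomeomorph.trans_source, Set.mem_inter_iff, Set.mem_preimage,
      OpenPartialHomeomorph.prod_source, Set.mem_prod, hφ's]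
    constructor
    · rintro ⟨h1, h2, h3⟩
      exact ⟨h1, by rwa [← hfst t h1], h3⟩
    · rintro ⟨h1, h2, h3⟩
      exact ⟨h1, by rwa [hfst t h1], h3⟩
  have htarget : (Φ.trans (κ.prod φ')).target = (κ.target ∩ κ.symm ⁻¹' U) ×ˢ φ'.target := by
    ext ⟨x, y⟩
    simp only [OpenPartialHomeomorph.trans_target, OpenPartialHomeomorph.prod_target, htgt,
      OpenPartialHomeomorph.prod_symm, OpenPartialHomeomorph.prod_apply, Set.mem_inter_iff,
      Set.mem_prod, Set.mem_preimage, Set.mem_univ, and_true]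
    tauto
  refine ⟨⟨Φ.trans (κ.prod φ'), ⟨?_, ?_⟩, φ'.target, φ'.open_target, hO,
    htarget, fun t ht => ((hmem t).1 ht).2.1, fun t ht => ?_⟩, (hmem s).2 ⟨hsΦ, hs, ?_⟩⟩
  · have hΦ : ContMDiffOn 𝓘(ℝ, ES) (𝓘(ℝ, EM).prod (𝓡 k)) ∞ Φ (Φ.trans (κ.prod φ')).source :=
      hsm.mono fun t ht => ((hmem t).1 ht).1
    refine ContMDiffOn.prodMk_space ?_ ?_
    · refine (contMDiffOn_chart (I := 𝓘(ℝ, EM)) (x := m₀)).comp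
        (contMDiff_fst.comp_contMDiffOn hΦ) fun t ht => ?_
      have := (hmem t).1 ht
      change (Φ t).1 ∈ κ.source
      rw [hfst t this.1]
      exact this.2.1
    · refine ε.contDiff.contMDiff.comp_contMDiffOn ((contMDiffOn_chart (I := 𝓡 k)
        (x := (Φ s).2)).comp (contMDiff_snd.comp_contMDiffOn hΦ) fun t ht => ((hmem t).1 ht).2.2)
  · rw [htarget]
    refine hsm'.comp (t := Φ.target) (g := Φ.symm)
      (f := fun z : EM × (Fin k → ℝ) => (κ.symm z.1, φ.symm (ε.symm z.2))) ?_ ?_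
    · refine ContMDiffOn.prodMk ?_ ?_
      · exact (contMDiffOn_chart_symm (I := 𝓘(ℝ, EM)) (x := m₀)).comp
          contDiff_fst.contMDiff.contMDiffOn fun z hz => hz.1.1
      · refine (contMDiffOn_chart_symm (I := 𝓡 k) (x := (Φ s).2)).comp
          (ε.symm.contDiff.comp contDiff_snd).contMDiff.contMDiffOn fun z hz => ?_
        have := hz.2
        simpa [φ'] using this
    · intro z hz
      rw [htgt]
      exact ⟨hz.1.2, Set.mem_univ _⟩
  · change κ (Φ t).1 = κ (J t)
    rw [hfst t ((hmem t).1 ht).1]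
  · exact mem_chart_source _ _

/-- `J` is proper near each point of the base. -/
theorem IsCompactFiberBundle.exists_isCompact_preimage [FiniteDimensional ℝ EM] [T2Space M]
    {J : S → M} (hJ : IsCompactFiberBundle EM ES J) {m₀ : M} {V : Set M} (hV : V ∈ 𝓝 m₀) :
    ∃ K ∈ 𝓝 m₀, K ⊆ V ∧ IsClosed K ∧ IsCompact (J ⁻¹' K) := by
  obtain ⟨k, N, _, _, _, _, _, U, Φ, hU, hmU, hsrc, htgt, hfst, hsm, hsm'⟩ := hJ.2 m₀
  have : LocallyCompactSpace M := ChartedSpace.locallyCompactSpace EM M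
  obtain ⟨K, hK, hKV, hKc⟩ := local_compact_nhds (Filter.inter_mem hV (hU.mem_nhds hmU))
  refine ⟨K, hK, fun m hm => (hKV hm).1, hKc.isClosed, ?_⟩
  have h : J ⁻¹' K = Φ.symm '' (K ×ˢ Set.univ) := by
    ext s
    constructor
    · intro hs
      have hsΦ : s ∈ Φ.source := by rw [hsrc]; exact (hKV hs).2
      refine ⟨Φ s, ⟨?_, Set.mem_univ _⟩, Φ.left_inv hsΦ⟩
      rwa [hfst s hsΦ]
    · rintro ⟨p, hp, rfl⟩
      have hpt : p ∈ Φ.target := by rw [htgt]; exact ⟨(hKV hp.1).2, Set.mem_univ _⟩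
      rw [Set.mem_preimage, ← hfst _ (Φ.map_target hpt), Φ.right_inv hpt]
      exact hp.1
  rw [h]
  refine (hKc.prod isCompact_univ).image_of_continuousOn (Φ.continuousOn_symm.mono ?_)
  rw [htgt]
  exact Set.prod_mono (fun m hm => (hKV hm).2) le_rfl

namespace AdaptedChart

variable {J : S → M} {m₀ : M} {O : Set EM} {k : ℕ} (e : AdaptedChart EM ES J m₀ O k)

theorem symm_mem_source {x : EM} (hx : x ∈ O) {y : Fin k → ℝ} (hy : y ∈ e.fibreDom) :
    e.chart.symm (x, y) ∈ e.chart.source :=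
  e.chart.map_target (by rw [e.target_eq]; exact ⟨hx, hy⟩)

theorem mem_target {s : S} (hs : s ∈ e.chart.source) :
    (e.chart s).1 ∈ O ∧ (e.chart s).2 ∈ e.fibreDom := by
  have h := e.chart.map_source hs
  rwa [e.target_eq] at h

theorem base_apply {x : EM} (hx : x ∈ O) {y : Fin k → ℝ} (hy : y ∈ e.fibreDom) :
    J (e.chart.symm (x, y)) = (chartAt EM m₀).symm x := by
  have hs := e.symm_mem_source hx hy
  have h := e.fst_eq _ hs
  rw [e.chart.right_inv (by rw [e.target_eq]; exact ⟨hx, hy⟩)] at h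
  rw [show x = chartAt EM m₀ (J (e.chart.symm (x, y))) from h,
    (chartAt EM m₀).left_inv (e.mem_base _ hs), ← h]

/-- In an adapted chart, the first component of a tangent vector is its projection to the base. -/
theorem fst_dirDeriv (hJ : ContMDiff 𝓘(ℝ, ES) 𝓘(ℝ, EM) ∞ J) {s : S} (hs : s ∈ e.chart.source)
    (v : TangentSpace 𝓘(ℝ, ES) s) :
    (dirDeriv e.chart s v).1
      = dirDeriv (chartAt EM m₀) (J s) (mfderiv 𝓘(ℝ, ES) 𝓘(ℝ, EM) J s v) := by
  have hκd := (isSmoothChart_chartAt (EB := EM) m₀).mdifferentiableAt (e.mem_base s hs)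
  rw [← dirDeriv_comp hκd ((hJ s).mdifferentiableAt (by simp)) v,
    ← dirDeriv_congr (f := fun t => (ContinuousLinearMap.fst ℝ EM (Fin k → ℝ)) (e.chart t)),
    dirDeriv_clm_comp _ (e.isSmoothChart.mdifferentiableAt hs)]
  · rfl
  · filter_upwards [e.chart.open_source.mem_nhds hs] with t ht using e.fst_eq t ht

/-- In an adapted chart, a tangent vector is vertical if its first component vanishes. -/
theorem mem_vertical_iff (hJ : ContMDiff 𝓘(ℝ, ES) 𝓘(ℝ, EM) ∞ J) {s : S} (hs : s ∈ e.chart.source)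
    {v : TangentSpace 𝓘(ℝ, ES) s} :
    v ∈ vertical EM ES J s ↔ (dirDeriv e.chart s v).1 = 0 := by
  have hκ := isSmoothChart_chartAt (EB := EM) m₀
  rw [e.fst_dirDeriv hJ hs, KahlerQuantization.mem_vertical_iff]
  constructor
  · intro h
    rw [h]
    exact map_zero (dirDerivLin (chartAt EM m₀) (J s))
  · intro h
    have h3 := hκ.pushVec_dirDeriv (e.mem_base s hs) (mfderiv 𝓘(ℝ, ES) 𝓘(ℝ, EM) J s v)
    rw [h, map_zero] at h3
    exact h3.symm

open Classical in
/-- The inverse of the chart, differentiated along the fibres: the identification of `ℝᵏ` with the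
vertical tangent spaces (zero outside the domain of the chart). -/
def frame (hJ : ContMDiff 𝓘(ℝ, ES) 𝓘(ℝ, EM) ∞ J) (s : S) :
    (Fin k → ℝ) →ₗ[ℝ] vertical EM ES J s :=
  if hs : s ∈ e.chart.source then
    LinearMap.codRestrict (vertical EM ES J s)
      ((pushVec (EB := ES) e.chart.symm (e.chart s)) ∘ₗ LinearMap.inr ℝ EM (Fin k → ℝ))
      fun w => (e.mem_vertical_iff hJ hs).2
        (congrArg Prod.fst (e.isSmoothChart.dirDeriv_pushVec_apply hs (0, w)))
  else 0

variable {e} (hJ : ContMDiff 𝓘(ℝ, ES) 𝓘(ℝ, EM) ∞ J)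

theorem frame_coe {s : S} (hs : s ∈ e.chart.source) (w : Fin k → ℝ) :
    (e.frame hJ s w).1 = pushVec (EB := ES) e.chart.symm (e.chart s) (0, w) := by
  rw [frame, dif_pos hs]
  rfl

theorem dirDeriv_frame {s : S} (hs : s ∈ e.chart.source) (w : Fin k → ℝ) :
    dirDeriv e.chart s (e.frame hJ s w).1 = (0, w) := by
  rw [frame_coe hJ hs]
  exact e.isSmoothChart.dirDeriv_pushVec_apply hs (0, w)

theorem frame_dirDeriv {s : S} (hs : s ∈ e.chart.source) (v : vertical EM ES J s) :
    e.frame hJ s (dirDeriv e.chart s v.1).2 = v := by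
  refine Subtype.ext ?_
  rw [frame_coe hJ hs]
  have h : ((0, (dirDeriv e.chart s v.1).2) : EM × (Fin k → ℝ)) = dirDeriv e.chart s v.1 :=
    Prod.ext ((e.mem_vertical_iff hJ hs).1 v.2).symm rfl
  rw [h]
  exact e.isSmoothChart.pushVec_dirDeriv hs v.1

theorem contMDiffOn_frame (w : Fin k → ℝ) :
    ContMDiffOn 𝓘(ℝ, ES) 𝓘(ℝ, ES).tangent ∞
      (fun s => (⟨s, (e.frame hJ s w).1⟩ : TangentBundle 𝓘(ℝ, ES) S)) e.chart.source := by
  refine (e.isSmoothChart.contMDiffOn_pushVec (0, w)).congr fun s hs => ?_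
  rw [frame_coe hJ hs]

variable [FiniteDimensional ℝ ES] [T2Space S]

/-- The coordinate fields along the fibres extend to global vertical vector fields. -/
theorem exists_fieldIn_frame {s : S} (hs : s ∈ e.chart.source) (w : Fin k → ℝ) :
    ∃ X : FieldIn (vertical EM ES J), ∀ᶠ t in 𝓝 s, X.at t = e.frame hJ t w :=
  exists_fieldIn_eventuallyEq e.chart.open_source hs _ (contMDiffOn_frame hJ w)

end AdaptedChart

/-- Every vertical vector extends to a global vertical vector field. -/
theorem IsCompactFiberBundle.exists_fieldIn_at [FiniteDimensional ℝ ES] [T2Space S]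
    {J : S → M} (hJ : IsCompactFiberBundle EM ES J) {s : S} (v : vertical EM ES J s) :
    ∃ X : FieldIn (vertical EM ES J), X.at s = v := by
  obtain ⟨k, O, hO, hmO, he⟩ := hJ.exists_adaptedChart (J s)
  obtain ⟨e, hs⟩ := he s (mem_chart_source EM _) hmO
  obtain ⟨X, hX⟩ := AdaptedChart.exists_fieldIn_frame hJ.1 hs (dirDeriv e.chart s v.1).2
  exact ⟨X, hX.self_of_nhds.trans (AdaptedChart.frame_dirDeriv hJ.1 hs v)⟩

end AdaptedCharts

/-! ### The prequantization representation preserves the holomorphic sections -/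

section Holomorphic

variable {EM : Type*} [NormedAddCommGroup EM] [NormedSpace ℝ EM]
  {M : Type uM} [TopologicalSpace M] [ChartedSpace EM M] [IsManifold 𝓘(ℝ, EM) ∞ M]
  {FA : Type*} [NormedAddCommGroup FA] [NormedSpace ℝ FA]
  {A : M → Type*} [∀ m, AddCommGroup (A m)] [∀ m, Module ℝ (A m)]
  [TopologicalSpace (TotalSpace FA A)] [∀ m, TopologicalSpace (A m)] [FiberBundle FA A]
  [VectorBundle ℝ FA A]
  {ES : Type*} [NormedAddCommGroup ES] [NormedSpace ℝ ES]
  {S : Type uS} [TopologicalSpace S] [ChartedSpace ES S] [IsManifold 𝓘(ℝ, ES) ∞ S]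
  {L : S → Type*} [∀ s, AddCommGroup (L s)] [∀ s, Module ℂ (L s)]
  [TopologicalSpace (TotalSpace ℂ L)] [∀ s, TopologicalSpace (L s)] [FiberBundle ℂ L]
  [VectorBundle ℂ ℂ L] [VectorBundle ℝ ℂ L]
  {𝓐 : LieAlgebroid EM FA A} {J : S → M} {ωt : PresymplecticForm ES 𝓐 J} {α : Action ES 𝓐 J}

/-- A vertical vector field as a vector field along the leaves. -/
def FieldIn.toLeaf (𝓐 : LieAlgebroid EM FA A) {J : S → M} (v : FieldIn (vertical EM ES J)) :
    FieldIn (leafTangent ES 𝓐 J) :=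
  ⟨v.field, fun s => vertical_le_leafTangent 𝓐 J s (v.mem s)⟩

theorem FieldIn.toLeaf_at (v : FieldIn (vertical EM ES J)) (s : S) :
    (v.toLeaf 𝓐).at s = vertIncl 𝓐 J s (v.at s) := rfl

/-- The vertical vector field `[α(X), v]`. -/
def Action.bracketField [CompleteSpace ES] (α : Action ES 𝓐 J)
    (hJ : ContMDiff 𝓘(ℝ, ES) 𝓘(ℝ, EM) ∞ J)
    (X : Cₛ^∞⟮𝓘(ℝ, EM); FA, A⟯) (v : FieldIn (vertical EM ES J)) : FieldIn (vertical EM ES J) :=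
  verticalBracket hJ (α.toFun X) (𝓐.anchor_smooth X) (α.anchor X) v

theorem Action.isBracket_bracketField [CompleteSpace ES] (α : Action ES 𝓐 J)
    (hJ : ContMDiff 𝓘(ℝ, ES) 𝓘(ℝ, EM) ∞ J)
    (X : Cₛ^∞⟮𝓘(ℝ, EM); FA, A⟯) (v : FieldIn (vertical EM ES J)) :
    IsBracket (α.bracketField hJ X v).field (α.toFun X) v.field := fun _ => rfl

/-- The polarization consists of the vectors `v + i j v` with `v` real and vertical, so that a section
is holomorphic if and only if `∇_v σ + i ∇_{j v} σ = 0` for these `v`. -/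
theorem isHolomorphicAt_iff (P : Prequantization L ωt) (c : AlmostComplex EM ES J)
    (σ : Cₛ^∞⟮𝓘(ℝ, ES); ℂ, L⟯) (s : S) :
    IsHolomorphicAt P c σ s ↔ ∀ v : vertical EM ES J s,
      P.nabla.toFun σ s (vertIncl 𝓐 J s v)
        + Complex.I • P.nabla.toFun σ s (vertIncl 𝓐 J s (c.j s v)) = 0 := by
  constructor
  · intro h v
    have hv : (1 : ℂ) ⊗ₜ[ℝ] v + Complex.I ⊗ₜ[ℝ] (c.j s v) ∈ kahlerPolarization c s := by
      refine LinearMap.mem_ker.2 ?_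
      simp [c.sq, TensorProduct.smul_tmul', TensorProduct.tmul_neg, TensorProduct.neg_tmul]
    have := h _ hv
    simpa [complexNabla] using this
  · intro h w hw
    have hw' := LinearMap.mem_ker.1 hw
    have hzero : complexNabla P σ s ∘ₗ
        (LinearMap.id + Complex.I • (c.j s).baseChange ℂ) = 0 := by
      ext v
      simpa [complexNabla] using h v
    have h1 : (c.j s).baseChange ℂ w = -(Complex.I • w) := by
      rw [LinearMap.add_apply] at hw'
      exact eq_neg_of_add_eq_zero_left hw'
    have h2 := congrArg (fun T => T w) hzero
    simp only [LinearMap.comp_apply, LinearMap.add_apply, LinearMap.id_apply, LinearMap.smul_apply,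
      h1, LinearMap.zero_apply, smul_neg, smul_smul, Complex.I_mul_I, neg_smul, one_smul, neg_neg,
      map_add] at h2
    -- `w = (w + i j w) / 2` for polarized vectors `w`
    have h3 : (2 : ℂ) • complexNabla P σ s w = 0 := by rw [two_smul]; exact h2
    exact (smul_eq_zero.1 h3).resolve_left two_ne_zero

theorem PartialConnection.toFun_sub {D : ∀ b : S, Submodule ℝ (TangentSpace 𝓘(ℝ, ES) b)}
    (nabla : PartialConnection ℂ L D) (σ τ : Cₛ^∞⟮𝓘(ℝ, ES); ℂ, L⟯) (s : S) :
    nabla.toFun (σ - τ) s = nabla.toFun σ s - nabla.toFun τ s := by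
  rw [eq_sub_iff_add_eq, ← nabla.add, sub_add_cancel]

theorem PartialConnection.toFun_const_smul {D : ∀ b : S, Submodule ℝ (TangentSpace 𝓘(ℝ, ES) b)}
    (nabla : PartialConnection ℂ L D) (a : ℂ) (σ : Cₛ^∞⟮𝓘(ℝ, ES); ℂ, L⟯) (s : S) (v : D s) :
    nabla.toFun (complexSmul (ContMDiffMap.const a) σ) s v = a • nabla.toFun σ s v := by
  rw [nabla.leibniz]
  have h : dirDeriv (ContMDiffMap.const a : C^∞⟮𝓘(ℝ, ES), S; 𝓘(ℝ, ℂ), ℂ⟯) s v.1 = 0 :=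
    dirDeriv_const a s v.1
  rw [h, zero_smul, add_zero]
  rfl

/-- The function `2πi ⟨μ̃, J^*X⟩`. -/
def MomentumMap.phase (μ : MomentumMap α ωt) (X : Cₛ^∞⟮𝓘(ℝ, EM); FA, A⟯) :
    C^∞⟮𝓘(ℝ, ES), S; 𝓘(ℝ, ℂ), ℂ⟯ :=
  ⟨fun s => ((2 * Real.pi * Complex.I : ℂ) • Complex.ofRealCLM) (μ.toFun s (X (J s))),
    ((2 * Real.pi * Complex.I : ℂ) • Complex.ofRealCLM).contDiff.contMDiff.comp (μ.smooth X)⟩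

theorem MomentumMap.phase_apply (μ : MomentumMap α ωt) (X : Cₛ^∞⟮𝓘(ℝ, EM); FA, A⟯) (s : S) :
    μ.phase X s = 2 * Real.pi * Complex.I * (μ.toFun s (X (J s)) : ℂ) := rfl

theorem MomentumMap.dirDeriv_phase (μ : MomentumMap α ωt) (X : Cₛ^∞⟮𝓘(ℝ, EM); FA, A⟯) (s : S)
    (v : TangentSpace 𝓘(ℝ, ES) s) :
    dirDeriv (μ.phase X) s v
      = 2 * Real.pi * Complex.I * ((dirDeriv (fun t => μ.toFun t (X (J t))) s v : ℝ) : ℂ) :=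
  dirDeriv_clm_comp ((2 * Real.pi * Complex.I : ℂ) • Complex.ofRealCLM)
    ((μ.smooth X s).mdifferentiableAt (by simp)) v

/-- The section `π(X) σ` of `L`. -/
def prequantSection (P : Prequantization L ωt) (μ : MomentumMap α ωt)
    (X : Cₛ^∞⟮𝓘(ℝ, EM); FA, A⟯) (σ : Cₛ^∞⟮𝓘(ℝ, ES); ℂ, L⟯) : Cₛ^∞⟮𝓘(ℝ, ES); ℂ, L⟯ :=
  P.nabla.along (α.leafField X) σ - complexSmul (μ.phase X) σ

theorem prequantSection_apply (P : Prequantization L ωt) (μ : MomentumMap α ωt)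
    (X : Cₛ^∞⟮𝓘(ℝ, EM); FA, A⟯) (σ : Cₛ^∞⟮𝓘(ℝ, ES); ℂ, L⟯) (s : S) :
    prequantSection P μ X σ s = prequantRep P μ X σ s := rfl

/-- The derivative of `π(X) σ`, by the Leibniz rule for the phase `2πi ⟨μ̃, J^*X⟩`. -/
theorem nabla_prequantSection (P : Prequantization L ωt) (μ : MomentumMap α ωt)
    (X : Cₛ^∞⟮𝓘(ℝ, EM); FA, A⟯) (σ : Cₛ^∞⟮𝓘(ℝ, ES); ℂ, L⟯) (s : S) (v : leafTangent ES 𝓐 J s) :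
    P.nabla.toFun (prequantSection P μ X σ) s v
      = P.nabla.toFun (P.nabla.along (α.leafField X) σ) s v - μ.phase X s • P.nabla.toFun σ s v
        - (2 * Real.pi * Complex.I * ((dirDeriv (fun t => μ.toFun t (X (J t))) s v.1 : ℝ) : ℂ))
          • σ s := by
  rw [prequantSection, P.nabla.toFun_sub, LinearMap.sub_apply, P.nabla.leibniz, μ.dirDeriv_phase,
    sub_sub]

/-- The curvature and the quantization condition on the momentum map cancel: `π(X)` commutes with
`∇_v` up to `∇_{[α(X), v]}`, for vertical vector fields `v`. -/
theorem nabla_vertical_prequantSection (P : Prequantization L ωt) (μ : MomentumMap α ωt)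
    (X : Cₛ^∞⟮𝓘(ℝ, EM); FA, A⟯) (σ : Cₛ^∞⟮𝓘(ℝ, ES); ℂ, L⟯) (v w : FieldIn (vertical EM ES J))
    (hw : IsBracket w.field (α.toFun X) v.field) (s : S) :
    P.nabla.toFun (prequantSection P μ X σ) s (vertIncl 𝓐 J s (v.at s))
      = prequantRep P μ X (P.nabla.along (v.toLeaf 𝓐) σ) s
        - P.nabla.toFun σ s (vertIncl 𝓐 J s (w.at s)) := by
  have hc := P.curvature (α.leafField X) (v.toLeaf 𝓐) (w.toLeaf 𝓐) hw σ s
  have hq := μ.quantization X s (v.at s)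
  rw [nabla_prequantSection]
  have h2 : (vertIncl 𝓐 J s (v.at s)).1 = (v.at s).1 := rfl
  rw [h2, hq, prequantRep]
  simp only [PartialConnection.along, ContMDiffSection.coeFn_mk, FieldIn.toLeaf_at] at hc ⊢
  rw [MomentumMap.phase_apply]
  push_cast
  linear_combination (norm := module) -hc

/-- `π(X)` preserves the holomorphic sections: it commutes with `∇_v + i ∇_{j v}` up to the operator
`∇_w + i ∇_{j w}` with `w = [α(X), v]`, because `[α(X), j v] = j w`. -/
theorem prequantSection_mem [FiniteDimensional ℝ ES] [T2Space S]
    (hJ : IsCompactFiberBundle EM ES J) (P : Prequantization L ωt) (μ : MomentumMap α ωt)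
    {c : AlmostComplex EM ES J} (hequiv : IsEquivariant α c)
    (X : Cₛ^∞⟮𝓘(ℝ, EM); FA, A⟯) {σ : Cₛ^∞⟮𝓘(ℝ, ES); ℂ, L⟯} (hσ : σ ∈ geometricQuantization P c) :
    prequantSection P μ X σ ∈ geometricQuantization P c := by
  have : CompleteSpace ES := FiniteDimensional.complete ℝ ES
  intro s
  rw [isHolomorphicAt_iff]
  intro v₀
  obtain ⟨v, rfl⟩ := hJ.exists_fieldIn_at v₀
  have hw := α.isBracket_bracketField hJ.1 X v
  have h1 := nabla_vertical_prequantSection P μ X σ v _ hw s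
  have h2 := nabla_vertical_prequantSection P μ X σ (c.apply v) _ (hequiv X v _ hw) s
  -- as `σ` is holomorphic, `∇_v σ = - i ∇_{j v} σ`
  have hjv : P.nabla.along (v.toLeaf 𝓐) σ
      = complexSmul (ContMDiffMap.const (-Complex.I)) (P.nabla.along ((c.apply v).toLeaf 𝓐) σ) := by
    ext t
    have := (isHolomorphicAt_iff P c σ t).1 (hσ t) (v.at t)
    have h3 := eq_neg_of_add_eq_zero_left this
    rw [← neg_smul] at h3
    exact h3
  have h4 := (isHolomorphicAt_iff P c σ s).1 (hσ s) ((α.bracketField hJ.1 X v).at s)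
  have h5 : (c.apply v).at s = c.j s (v.at s) := rfl
  have h6 : (c.apply (α.bracketField hJ.1 X v)).at s = c.j s ((α.bracketField hJ.1 X v).at s) := rfl
  rw [h5, h6] at h2
  rw [h1, h2, hjv]
  rw [prequantRep, P.nabla.toFun_const_smul, prequantRep]
  have h7 : complexSmul (ContMDiffMap.const (-Complex.I)) (P.nabla.along ((c.apply v).toLeaf 𝓐) σ) s
    = (-Complex.I) • (P.nabla.along ((c.apply v).toLeaf 𝓐) σ) s := rfl
  rw [h7]
  linear_combination (norm := module) -h4

end Holomorphic

/-! ### The representation on the quantization bundle -/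

section QuantizationRepresentation

variable {EM : Type*} [NormedAddCommGroup EM] [NormedSpace ℝ EM]
  {M : Type uM} [TopologicalSpace M] [ChartedSpace EM M] [IsManifold 𝓘(ℝ, EM) ∞ M]
  {FA : Type*} [NormedAddCommGroup FA] [NormedSpace ℝ FA]
  {A : M → Type*} [∀ m, AddCommGroup (A m)] [∀ m, Module ℝ (A m)]
  [TopologicalSpace (TotalSpace FA A)] [∀ m, TopologicalSpace (A m)] [FiberBundle FA A]
  [VectorBundle ℝ FA A]
  {ES : Type*} [NormedAddCommGroup ES] [NormedSpace ℝ ES]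
  {S : Type uS} [TopologicalSpace S] [ChartedSpace ES S] [IsManifold 𝓘(ℝ, ES) ∞ S]
  {L : S → Type*} [∀ s, AddCommGroup (L s)] [∀ s, Module ℂ (L s)]
  [TopologicalSpace (TotalSpace ℂ L)] [∀ s, TopologicalSpace (L s)] [FiberBundle ℂ L]
  [VectorBundle ℂ ℂ L] [VectorBundle ℝ ℂ L]
  {𝓐 : LieAlgebroid EM FA A} {J : S → M} {ωt : PresymplecticForm ES 𝓐 J} {α : Action ES 𝓐 J}
  {FQ : Type*} [NormedAddCommGroup FQ] [NormedSpace ℂ FQ]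
  {Q : M → Type*} [∀ m, AddCommGroup (Q m)] [∀ m, Module ℂ (Q m)]
  [TopologicalSpace (TotalSpace FQ Q)] [∀ m, TopologicalSpace (Q m)] [FiberBundle FQ Q]
  [VectorBundle ℂ FQ Q] [VectorBundle ℝ FQ Q]
  {P : Prequantization L ωt} {c : AlmostComplex EM ES J}

/-- The restriction of a holomorphic section of `L` to the fibre over `m`. -/
def restrictToFibre {σ : Cₛ^∞⟮𝓘(ℝ, ES); ℂ, L⟯} (hσ : σ ∈ geometricQuantization P c) (m : M) :
    holomorphicSections P c m :=
  ⟨fun s => σ s, σ, fun s => ⟨rfl, hσ s⟩⟩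

namespace QuantizationBundle

variable (𝓠 : QuantizationBundle FQ Q P c)

theorem toSection_apply (q : Cₛ^∞⟮𝓘(ℝ, EM); FQ, Q⟯) (s : S) :
    𝓠.toSection q s = (𝓠.ev (J s) (q (J s))).1 ⟨s, rfl⟩ := rfl

theorem ev_apply (q : Cₛ^∞⟮𝓘(ℝ, EM); FQ, Q⟯) {m : M} (s : J ⁻¹' {m}) :
    (𝓠.ev m (q m)).1 s = 𝓠.toSection q s := by
  obtain ⟨s, rfl⟩ := s
  rfl

theorem toSection_mem (q : Cₛ^∞⟮𝓘(ℝ, EM); FQ, Q⟯) :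
    𝓠.toSection q ∈ geometricQuantization P c := by
  obtain ⟨σ, hσ, h⟩ := (𝓠.smooth_iff q).1 q.contMDiff
  have : 𝓠.toSection q = σ := by
    ext s
    exact (h s).symm
  rw [this]
  exact hσ

theorem toSection_injective : Function.Injective 𝓠.toSection := by
  intro q r h
  ext m
  refine (𝓠.ev m).injective (Subtype.ext (funext fun s => ?_))
  rw [𝓠.ev_apply, 𝓠.ev_apply, h]

/-- The smooth section of `Q` that corresponds to a holomorphic section of `L`. -/
def ofSection {σ : Cₛ^∞⟮𝓘(ℝ, ES); ℂ, L⟯} (hσ : σ ∈ geometricQuantization P c) :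
    Cₛ^∞⟮𝓘(ℝ, EM); FQ, Q⟯ :=
  ⟨fun m => (𝓠.ev m).symm (restrictToFibre hσ m),
    (𝓠.smooth_iff _).2 ⟨σ, hσ, fun s => by rw [glue, LinearEquiv.apply_symm_apply]; rfl⟩⟩

theorem toSection_ofSection {σ : Cₛ^∞⟮𝓘(ℝ, ES); ℂ, L⟯} (hσ : σ ∈ geometricQuantization P c) :
    𝓠.toSection (𝓠.ofSection hσ) = σ := by
  ext s
  rw [toSection_apply]
  change (𝓠.ev (J s) ((𝓠.ev (J s)).symm (restrictToFibre hσ (J s)))).1 ⟨s, rfl⟩ = σ s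
  rw [LinearEquiv.apply_symm_apply]
  rfl

theorem toSection_add (q r : Cₛ^∞⟮𝓘(ℝ, EM); FQ, Q⟯) :
    𝓠.toSection (q + r) = 𝓠.toSection q + 𝓠.toSection r := by
  ext s
  simp [toSection_apply]

theorem toSection_sub (q r : Cₛ^∞⟮𝓘(ℝ, EM); FQ, Q⟯) :
    𝓠.toSection (q - r) = 𝓠.toSection q - 𝓠.toSection r := by
  ext s
  simp [toSection_apply]

/-- The pullback of a smooth function on the base. -/
def pullbackFun (hJ : ContMDiff 𝓘(ℝ, ES) 𝓘(ℝ, EM) ∞ J) (f : C^∞⟮𝓘(ℝ, EM), M; 𝓘(ℝ, ℂ), ℂ⟯) :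
    C^∞⟮𝓘(ℝ, ES), S; 𝓘(ℝ, ℂ), ℂ⟯ :=
  ⟨fun s => f (J s), f.contMDiff.comp hJ⟩

theorem toSection_complexSmul (hJ : ContMDiff 𝓘(ℝ, ES) 𝓘(ℝ, EM) ∞ J)
    (f : C^∞⟮𝓘(ℝ, EM), M; 𝓘(ℝ, ℂ), ℂ⟯) (q : Cₛ^∞⟮𝓘(ℝ, EM); FQ, Q⟯) :
    𝓠.toSection (complexSmul f q) = complexSmul (pullbackFun hJ f) (𝓠.toSection q) := by
  ext s
  rw [toSection_apply]
  change (𝓠.ev (J s) (f (J s) • q (J s))).1 ⟨s, rfl⟩ = f (J s) • 𝓠.toSection q s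
  rw [map_smul]
  rfl

theorem toSection_realSmul_apply (f : C^∞⟮𝓘(ℝ, EM), M; 𝓘(ℝ, ℝ), ℝ⟯)
    (q : Cₛ^∞⟮𝓘(ℝ, EM); FQ, Q⟯) (s : S) :
    𝓠.toSection (realSmul f q) s = f (J s) • 𝓠.toSection q s := by
  rw [toSection_apply]
  change (𝓠.ev (J s) (f (J s) • q (J s))).1 ⟨s, rfl⟩ = f (J s) • 𝓠.toSection q s
  rw [← Complex.coe_smul, map_smul, ← Complex.coe_smul]
  rfl

end QuantizationBundle

open QuantizationBundle

theorem prequantSection_complexSmul (hJ : ContMDiff 𝓘(ℝ, ES) 𝓘(ℝ, EM) ∞ J) (μ : MomentumMap α ωt)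
    (X : Cₛ^∞⟮𝓘(ℝ, EM); FA, A⟯) (f : C^∞⟮𝓘(ℝ, EM), M; 𝓘(ℝ, ℂ), ℂ⟯) (σ : Cₛ^∞⟮𝓘(ℝ, ES); ℂ, L⟯)
    (s : S) :
    prequantSection P μ X (complexSmul (pullbackFun hJ f) σ) s
      = f (J s) • prequantSection P μ X σ s
        + dirDeriv f (J s) (𝓐.anchor (J s) (X (J s))) • σ s := by
  have h : dirDeriv (pullbackFun hJ f) s ((α.leafField X).at s).1
      = dirDeriv f (J s) (𝓐.anchor (J s) (X (J s))) := by
    rw [← α.anchor X s]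
    exact dirDeriv_comp ((f.contMDiff (J s)).mdifferentiableAt (by simp))
      ((hJ s).mdifferentiableAt (by simp)) _
  rw [prequantSection_apply, prequantSection_apply, prequantRep, prequantRep, P.nabla.leibniz, h]
  change f (J s) • _ + _ - _ • (f (J s) • σ s) = _
  module

theorem prequantSection_add_right (μ : MomentumMap α ωt)
    (X : Cₛ^∞⟮𝓘(ℝ, EM); FA, A⟯) (σ τ : Cₛ^∞⟮𝓘(ℝ, ES); ℂ, L⟯) :
    prequantSection P μ X (σ + τ) = prequantSection P μ X σ + prequantSection P μ X τ := by
  ext s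
  rw [ContMDiffSection.coe_add, Pi.add_apply, prequantSection_apply, prequantSection_apply,
    prequantSection_apply, prequantRep, prequantRep, prequantRep, P.nabla.add,
    LinearMap.add_apply, ContMDiffSection.coe_add, Pi.add_apply]
  module

theorem prequantSection_add_left (μ : MomentumMap α ωt)
    (X Y : Cₛ^∞⟮𝓘(ℝ, EM); FA, A⟯) (σ : Cₛ^∞⟮𝓘(ℝ, ES); ℂ, L⟯) :
    prequantSection P μ (X + Y) σ = prequantSection P μ X σ + prequantSection P μ Y σ := by
  ext s
  have h : (α.leafField (X + Y)).at s = (α.leafField X).at s + (α.leafField Y).at s :=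
    Subtype.ext (α.add X Y s)
  rw [ContMDiffSection.coe_add, Pi.add_apply, prequantSection_apply, prequantSection_apply,
    prequantSection_apply, prequantRep, prequantRep, prequantRep, h, map_add,
    ContMDiffSection.coe_add, Pi.add_apply, map_add]
  push_cast
  module

theorem prequantSection_realSmul_left (μ : MomentumMap α ωt) (f : C^∞⟮𝓘(ℝ, EM), M; 𝓘(ℝ, ℝ), ℝ⟯)
    (X : Cₛ^∞⟮𝓘(ℝ, EM); FA, A⟯) (σ : Cₛ^∞⟮𝓘(ℝ, ES); ℂ, L⟯) (s : S) :
    prequantSection P μ (realSmul f X) σ s = f (J s) • prequantSection P μ X σ s := by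
  have h : (α.leafField (realSmul f X)).at s = f (J s) • (α.leafField X).at s :=
    Subtype.ext (α.smul f X s)
  have h2 : realSmul f X (J s) = f (J s) • X (J s) := rfl
  rw [prequantSection_apply, prequantSection_apply, prequantRep, prequantRep, h, map_smul, h2,
    map_smul, ← Complex.coe_smul, ← Complex.coe_smul, smul_eq_mul]
  push_cast
  module

/-- The prequantization condition on the momentum map cancels the curvature of `∇`. -/
theorem prequantSection_bracket (μ : MomentumMap α ωt)
    (X Y : Cₛ^∞⟮𝓘(ℝ, EM); FA, A⟯) (σ : Cₛ^∞⟮𝓘(ℝ, ES); ℂ, L⟯) :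
    prequantSection P μ (𝓐.bracket X Y) σ
      = prequantSection P μ X (prequantSection P μ Y σ)
        - prequantSection P μ Y (prequantSection P μ X σ) := by
  ext s
  have hc := P.curvature (α.leafField X) (α.leafField Y) (α.leafField (𝓐.bracket X Y))
    (α.bracket X Y) σ s
  have hq : (μ.toFun s (𝓐.bracket X Y (J s)) : ℂ)
      = ((dirDeriv (fun t => μ.toFun t (Y (J t))) s (α.toFun X s) : ℝ) : ℂ)
        - ((dirDeriv (fun t => μ.toFun t (X (J t))) s (α.toFun Y s) : ℝ) : ℂ)
        - (ωt.form s ((α.leafField X).at s) ((α.leafField Y).at s) : ℂ) := by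
    have h := μ.prequantization X Y s
    have h' : μ.toFun s (𝓐.bracket X Y (J s))
      = dirDeriv (fun t => μ.toFun t (Y (J t))) s (α.toFun X s)
        - dirDeriv (fun t => μ.toFun t (X (J t))) s (α.toFun Y s)
        - ωt.form s ((α.leafField X).at s) ((α.leafField Y).at s) := by linarith
    rw [h']
    push_cast
    rfl
  have hX : ((α.leafField X).at s).1 = α.toFun X s := rfl
  have hY : ((α.leafField Y).at s).1 = α.toFun Y s := rfl
  rw [ContMDiffSection.coe_sub, Pi.sub_apply, prequantSection_apply, prequantRep, hq,
    prequantSection_apply, prequantRep, nabla_prequantSection, prequantSection_apply, prequantRep,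
    prequantSection_apply, prequantRep, nabla_prequantSection, prequantSection_apply, prequantRep,
    hX, hY, μ.phase_apply, μ.phase_apply]
  simp only [PartialConnection.along, ContMDiffSection.coeFn_mk] at hc ⊢
  linear_combination (norm := module) -hc

/-- The restriction of the prequantization representation to the quantization bundle. -/
def quantizationRep [FiniteDimensional ℝ ES] [T2Space S] (hJ : IsCompactFiberBundle EM ES J)
    (μ : MomentumMap α ωt) (hequiv : IsEquivariant α c) (𝓠 : QuantizationBundle FQ Q P c) :
    Representation FQ Q 𝓐 where
  toFun X q := 𝓠.ofSection (prequantSection_mem hJ P μ hequiv X (𝓠.toSection_mem q))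
  add_left X Y q := 𝓠.toSection_injective (by
    rw [toSection_add, toSection_ofSection, toSection_ofSection, toSection_ofSection,
      prequantSection_add_left])
  smul_left f X q m := by
    -- `toSection` is injective on global sections, so the identity is shown for these
    suffices h : 𝓠.ofSection (prequantSection_mem hJ P μ hequiv (realSmul f X) (𝓠.toSection_mem q))
        = realSmul f (𝓠.ofSection (prequantSection_mem hJ P μ hequiv X (𝓠.toSection_mem q))) from
      congrArg (fun r => r m) h
    refine 𝓠.toSection_injective (ContMDiffSection.ext fun s => ?_)
    rw [toSection_realSmul_apply, toSection_ofSection, toSection_ofSection,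
      prequantSection_realSmul_left]
  add_right X q r := 𝓠.toSection_injective (by
    rw [toSection_ofSection, toSection_add, toSection_add, toSection_ofSection,
      toSection_ofSection, prequantSection_add_right])
  leibniz X f q m := by
    -- the function `ρ(X) f`, whose product with `q` is needed as a global section
    let f' : C^∞⟮𝓘(ℝ, EM), M; 𝓘(ℝ, ℂ), ℂ⟯ :=
      ⟨fun m => dirDeriv f m (𝓐.anchor m (X m)), contMDiff_dirDeriv f.contMDiff (𝓐.anchor_smooth X)⟩
    suffices h : 𝓠.ofSection
          (prequantSection_mem hJ P μ hequiv X (𝓠.toSection_mem (complexSmul f q)))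
        = complexSmul f (𝓠.ofSection (prequantSection_mem hJ P μ hequiv X (𝓠.toSection_mem q)))
          + complexSmul f' q from congrArg (fun r => r m) h
    refine 𝓠.toSection_injective (ContMDiffSection.ext fun s => ?_)
    rw [toSection_ofSection, toSection_add, toSection_complexSmul _ hJ.1,
      toSection_complexSmul _ hJ.1, toSection_complexSmul _ hJ.1, toSection_ofSection,
      prequantSection_complexSmul]
    rfl
  flat X Y q := 𝓠.toSection_injective (by
    rw [toSection_sub, toSection_ofSection, toSection_ofSection, toSection_ofSection,
      prequantSection_bracket, toSection_ofSection, toSection_ofSection])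

theorem toSection_quantizationRep [FiniteDimensional ℝ ES] [T2Space S]
    (hJ : IsCompactFiberBundle EM ES J) (μ : MomentumMap α ωt) (hequiv : IsEquivariant α c)
    (𝓠 : QuantizationBundle FQ Q P c) (X : Cₛ^∞⟮𝓘(ℝ, EM); FA, A⟯)
    (q : Cₛ^∞⟮𝓘(ℝ, EM); FQ, Q⟯) :
    𝓠.toSection ((quantizationRep hJ μ hequiv 𝓠).toFun X q)
      = prequantSection P μ X (𝓠.toSection q) :=
  𝓠.toSection_ofSection _

/-- The momentum map contributes only imaginary multiples of the identity, so that `π(X)` differentiates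
the Hermitian metric of `L` along `α(X)`. -/
theorem hermitian_prequantSection (μ : MomentumMap α ωt) (X : Cₛ^∞⟮𝓘(ℝ, EM); FA, A⟯)
    (σ τ : Cₛ^∞⟮𝓘(ℝ, ES); ℂ, L⟯) (s : S) :
    P.h.inner s (prequantSection P μ X σ s) (τ s) + P.h.inner s (σ s) (prequantSection P μ X τ s)
      = dirDeriv (fun t => P.h.inner t (σ t) (τ t)) s (α.toFun X s) := by
  have h := P.hermitian σ τ s ((α.leafField X).at s)
  rw [prequantSection_apply, prequantSection_apply, prequantRep, prequantRep]
  refine Eq.trans ?_ h.symm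
  simp only [map_sub, map_smulₛₗ, LinearMap.sub_apply, LinearMap.smul_apply, smul_eq_mul, map_mul,
    Complex.conj_I, Complex.conj_ofReal, RingHom.id_apply, map_ofNat]
  ring

end QuantizationRepresentation

/-! ### Determinants of skew-symmetric matrices -/

section SkewDeterminant

/-- A skew-symmetric matrix `W` with nonzero determinant has positive determinant: the matrices
`(1 - t) W + t` are invertible and connect it to the identity. -/
theorem det_pos_of_skew {k : ℕ} {W : Matrix (Fin k) (Fin k) ℝ} (hW : W.transpose = -W)
    (h0 : W.det ≠ 0) : 0 < W.det := by
  let f : ℝ → ℝ := fun t => Matrix.det ((1 - t) • W + t • (1 : Matrix (Fin k) (Fin k) ℝ))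
  have hf : Continuous f := by
    refine Continuous.matrix_det ?_
    fun_prop
  -- as `v ⬝ W v = 0`, a vector in the kernel satisfies `t (v ⬝ v) = 0`
  have hne : ∀ t ∈ Set.Icc (0 : ℝ) 1, f t ≠ 0 := by
    intro t ht hft
    rcases ht.1.eq_or_lt with rfl | ht0
    · apply h0
      simpa [f] using hft
    · obtain ⟨v, hv, hv0⟩ := Matrix.exists_mulVec_eq_zero_iff.2 hft
      have h1 : v ⬝ᵥ (W.mulVec v) = 0 := by
        have h2 : v ⬝ᵥ (W.mulVec v) = -(v ⬝ᵥ (W.mulVec v)) := by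
          conv_lhs => rw [Matrix.dotProduct_mulVec, ← Matrix.mulVec_transpose, hW,
            Matrix.neg_mulVec, neg_dotProduct, dotProduct_comm]
        linarith
      have h3 := congrArg (fun w => v ⬝ᵥ w) hv0
      simp only [Matrix.add_mulVec, Matrix.smul_mulVec, dotProduct_add, dotProduct_smul, h1,
        Matrix.one_mulVec, dotProduct_zero, smul_eq_mul, mul_zero, zero_add] at h3
      exact hv (dotProduct_self_eq_zero.1 ((mul_eq_zero.1 h3).resolve_left ht0.ne'))
  by_contra hneg
  have hf0 : f 0 ≤ 0 := by simpa [f] using not_lt.1 hneg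
  have hf1 : 0 ≤ f 1 := by simp [f]
  obtain ⟨t, ht, hft⟩ := intermediate_value_Icc zero_le_one hf.continuousOn ⟨hf0, hf1⟩
  exact hne t ht hft

theorem contDiff_det {k : ℕ} :
    ContDiff ℝ ∞ (fun W : Fin k → Fin k → ℝ => Matrix.det (Matrix.of W)) := by
  simp only [Matrix.det_apply', Matrix.of_apply]
  refine ContDiff.sum fun τ _ => contDiff_const.mul (contDiff_prod fun i _ => ?_)
  fun_prop

/-- The derivative of `√det` in the direction of the infinitesimal congruence `-(B W + W Bᵀ)`. -/
theorem fderiv_sqrt_det_congruence {k : ℕ} {W : Fin k → Fin k → ℝ}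
    (hW : 0 < Matrix.det (Matrix.of W)) (B : Matrix (Fin k) (Fin k) ℝ) {V : Fin k → Fin k → ℝ}
    (hV : Matrix.of V = -(B * Matrix.of W + Matrix.of W * B.transpose)) :
    fderiv ℝ (fun W : Fin k → Fin k → ℝ => √(Matrix.det (Matrix.of W))) W V
      = -(B.trace * √(Matrix.det (Matrix.of W))) := by
  -- the curve `(1 - t B) W (1 - t B)ᵀ`, whose velocity at `t = 0` is `V`
  let R : Fin k → Fin k → ℝ := fun i j => (B * Matrix.of W * B.transpose) i j
  let c : ℝ → Fin k → Fin k → ℝ := fun t => W + t • V + (t ^ 2) • R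
  have hc : ∀ t, Matrix.of (c t) = (1 + t • (-B)) * Matrix.of W * (1 + t • (-B)).transpose := by
    intro t
    have : Matrix.of (c t) = Matrix.of W + t • Matrix.of V
      + (t ^ 2) • (B * Matrix.of W * B.transpose) := by
      ext i j
      simp [c, R]
    rw [this, hV]
    simp only [Matrix.transpose_add, Matrix.transpose_one, Matrix.transpose_smul,
      Matrix.transpose_neg, add_mul, mul_add, Matrix.smul_mul, Matrix.mul_smul, one_mul, mul_one,
      neg_mul, mul_neg, smul_neg, smul_add, smul_smul, pow_two]
    abel
  have hc' : HasDerivAt c V 0 := by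
    have h1 : HasDerivAt (fun t : ℝ => W + t • V) V 0 := by
      simpa using ((hasDerivAt_id (0 : ℝ)).smul_const V).const_add W
    have h2 : HasDerivAt (fun t : ℝ => (t ^ 2) • R) 0 0 := by
      simpa using (hasDerivAt_pow 2 (0 : ℝ)).smul_const R
    have h3 := h1.add h2
    rw [add_zero] at h3
    exact h3
  have hc0 : c 0 = W := by simp [c]
  have hs : DifferentiableAt ℝ (fun W : Fin k → Fin k → ℝ => √(Matrix.det (Matrix.of W))) (c 0) := by
    rw [hc0]
    exact (contDiff_det.differentiable (by simp) W).sqrt hW.ne'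
  have h1 := hs.hasFDerivAt.comp_hasDerivAt (0 : ℝ) hc'
  rw [hc0] at h1
  have h2 : (fun t => √(Matrix.det (Matrix.of (c t)))) =ᶠ[𝓝 0]
      fun t => Matrix.det (1 + t • (-B)) * √(Matrix.det (Matrix.of W)) := by
    have hpos : ∀ᶠ t : ℝ in 𝓝 0, 0 < Matrix.det (1 + t • (-B)) := by
      have hcont : Continuous fun t : ℝ => Matrix.det (1 + t • (-B)) :=
        Continuous.matrix_det (by fun_prop)
      exact hcont.continuousAt.eventually (lt_mem_nhds (by simp))
    filter_upwards [hpos] with t ht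
    rw [hc, Matrix.det_mul, Matrix.det_mul, Matrix.det_transpose, mul_right_comm, ← pow_two,
      Real.sqrt_mul (sq_nonneg _), Real.sqrt_sq ht.le]
  have h3 : HasDerivAt (fun t : ℝ => Matrix.det (1 + t • (-B))) (-B.trace) 0 := by
    let q : Polynomial ℝ :=
      Matrix.det (1 + (Polynomial.X : Polynomial ℝ) • (-B).map Polynomial.C)
    have hq : ∀ t, q.eval t = Matrix.det (1 + t • (-B)) := by
      intro t
      rw [← Polynomial.coe_evalRingHom, RingHom.map_det]
      congr 1
      ext i j
      simp [Matrix.one_apply, apply_ite]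
      ring
    have h4 := q.hasDerivAt 0
    rw [Matrix.derivative_det_one_add_X_smul, Matrix.trace_neg] at h4
    simpa only [hq] using h4
  have h5 := (h3.mul_const √(Matrix.det (Matrix.of W))).congr_of_eventuallyEq h2
  rw [neg_mul] at h5
  exact h1.unique h5

end SkewDeterminant

/-! ### The Liouville density in adapted charts -/

section CoordDensity

variable {EM : Type*} [NormedAddCommGroup EM] [NormedSpace ℝ EM]
  {M : Type uM} [TopologicalSpace M] [ChartedSpace EM M] [IsManifold 𝓘(ℝ, EM) ∞ M]
  {FA : Type*} [NormedAddCommGroup FA] [NormedSpace ℝ FA]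
  {A : M → Type*} [∀ m, AddCommGroup (A m)] [∀ m, Module ℝ (A m)]
  [TopologicalSpace (TotalSpace FA A)] [∀ m, TopologicalSpace (A m)] [FiberBundle FA A]
  [VectorBundle ℝ FA A]
  {ES : Type*} [NormedAddCommGroup ES] [NormedSpace ℝ ES]
  {S : Type uS} [TopologicalSpace S] [ChartedSpace ES S] [IsManifold 𝓘(ℝ, ES) ∞ S]
  {𝓐 : LieAlgebroid EM FA A} {J : S → M} (ωt : PresymplecticForm ES 𝓐 J)

namespace PresymplecticForm

/-- The restriction of the form to the vertical tangent space, as a bilinear form. -/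
def vertForm (s : S) : vertical EM ES J s →ₗ[ℝ] vertical EM ES J s →ₗ[ℝ] ℝ :=
  (ωt.form s).compl₁₂ (vertIncl 𝓐 J s) (vertIncl 𝓐 J s)

theorem vertForm_apply (s : S) (v w : vertical EM ES J s) : ωt.vertForm s v w = ωt.vert s v w := rfl

theorem form_swap (s : S) (v w : leafTangent ES 𝓐 J s) : ωt.form s v w = -ωt.form s w v := by
  have h := ωt.alt s (v + w)
  simp only [map_add, LinearMap.add_apply, ωt.alt] at h
  linarith

theorem vertForm_swap (s : S) (v w : vertical EM ES J s) :
    ωt.vertForm s v w = -ωt.vertForm s w v := ωt.form_swap s _ _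

theorem contMDiff_vertForm (u v : FieldIn (vertical EM ES J)) :
    ContMDiff 𝓘(ℝ, ES) 𝓘(ℝ, ℝ) ∞ (fun s => ωt.vertForm s (u.at s) (v.at s)) :=
  ωt.smooth (u.toLeaf 𝓐) (v.toLeaf 𝓐)

end PresymplecticForm

namespace AdaptedChart

variable {m₀ : M} {O : Set EM} {k : ℕ} (e : AdaptedChart EM ES J m₀ O k)
  (hJ : ContMDiff 𝓘(ℝ, ES) 𝓘(ℝ, EM) ∞ J)

/-- The matrix of the form in the coordinate frame of an adapted chart. -/
def gram (s : S) : Fin k → Fin k → ℝ := fun i j =>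
  ωt.vertForm s (e.frame hJ s (Pi.single i 1)) (e.frame hJ s (Pi.single j 1))

/-- The density of `ω^d / d!` in an adapted chart, that is, the modulus of the Pfaffian of the matrix
of the form. -/
def density (s : S) : ℝ := √(Matrix.det (Matrix.of (e.gram ωt hJ s)))

theorem vertForm_frame (s : S) (v w : Fin k → ℝ) :
    ωt.vertForm s (e.frame hJ s v) (e.frame hJ s w)
      = v ⬝ᵥ ((Matrix.of (e.gram ωt hJ s)).mulVec w) := by
  have hexp : ∀ u : Fin k → ℝ, u = ∑ i, u i • (Pi.single i 1 : Fin k → ℝ) := fun u => by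
    simpa using pi_eq_sum_univ' u
  conv_lhs => rw [hexp v, hexp w]
  simp only [map_sum, map_smul, LinearMap.sum_apply, LinearMap.smul_apply, smul_eq_mul,
    dotProduct, Matrix.mulVec, Matrix.of_apply, gram, Finset.mul_sum]
  rw [Finset.sum_comm]
  refine Finset.sum_congr rfl fun i _ => Finset.sum_congr rfl fun j _ => ?_
  ring

theorem gram_swap (s : S) (i j : Fin k) : e.gram ωt hJ s i j = -e.gram ωt hJ s j i :=
  ωt.vertForm_swap s _ _

theorem det_gram_pos {s : S} (hs : s ∈ e.chart.source) :
    0 < Matrix.det (Matrix.of (e.gram ωt hJ s)) := by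
  refine det_pos_of_skew ?_ ?_
  · ext i j
    exact e.gram_swap ωt hJ s j i
  · intro h0
    obtain ⟨w, hw, hw0⟩ := Matrix.exists_mulVec_eq_zero_iff.2 h0
    have h1 : e.frame hJ s w = 0 := by
      refine ωt.nondegenerate s _ fun v => ?_
      have h2 := e.vertForm_frame ωt hJ s (dirDeriv e.chart s v.1).2 w
      rw [hw0, dotProduct_zero, frame_dirDeriv hJ hs, ωt.vertForm_swap, neg_eq_zero] at h2
      exact h2
    have h3 := dirDeriv_frame hJ hs w
    rw [h1] at h3
    apply hw
    have h4 : dirDeriv e.chart s (0 : vertical EM ES J s).1 = 0 := map_zero (dirDerivLin e.chart s)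
    exact congrArg Prod.snd (h3.symm.trans h4)

theorem density_pos {s : S} (hs : s ∈ e.chart.source) : 0 < e.density ωt hJ s :=
  Real.sqrt_pos.2 (e.det_gram_pos ωt hJ hs)

variable [FiniteDimensional ℝ ES] [T2Space S]

theorem contMDiffOn_gram :
    ContMDiffOn 𝓘(ℝ, ES) 𝓘(ℝ, Fin k → Fin k → ℝ) ∞ (e.gram ωt hJ) e.chart.source := by
  rw [contMDiffOn_pi_space]
  intro i
  rw [contMDiffOn_pi_space]
  intro j s hs
  obtain ⟨X, hX⟩ := exists_fieldIn_frame hJ hs (Pi.single i 1)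
  obtain ⟨Y, hY⟩ := exists_fieldIn_frame hJ hs (Pi.single j 1)
  refine ContMDiffAt.contMDiffWithinAt ((ωt.contMDiff_vertForm X Y s).congr_of_eventuallyEq ?_)
  filter_upwards [hX, hY] with t h1 h2
  rw [h1, h2]
  rfl

/-- The density is smooth, because the determinant does not vanish. -/
theorem contMDiffOn_density :
    ContMDiffOn 𝓘(ℝ, ES) 𝓘(ℝ, ℝ) ∞ (e.density ωt hJ) e.chart.source := by
  intro s hs
  have h1 : ContDiffAt ℝ ∞ (fun W : Fin k → Fin k → ℝ => √(Matrix.det (Matrix.of W)))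
      (e.gram ωt hJ s) :=
    contDiff_det.contDiffAt.sqrt (e.det_gram_pos ωt hJ hs).ne'
  exact h1.contMDiffAt.comp_contMDiffWithinAt s (e.contMDiffOn_gram ωt hJ s hs)

end AdaptedChart

end CoordDensity

/-! ### The Liouville measures in adapted charts -/

section MeasureLemmas

variable {V : Type*} [TopologicalSpace V] [MeasurableSpace V] [OpensMeasurableSpace V]
  {S : Type*} [TopologicalSpace S] [MeasurableSpace S] [BorelSpace S]

theorem measurableSet_inter_preimage_of_continuousOn {U : Set V} (hU : IsOpen U) {g : V → S}
    (hg : ContinuousOn g U) {B : Set S} (hB : MeasurableSet B) : MeasurableSet (U ∩ g ⁻¹' B) := by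
  have h1 : Measurable (U.domRestrict g) :=
    (continuousOn_iff_continuous_domRestrict.1 hg).measurable
  have h2 := MeasurableSet.subtype_image hU.measurableSet (h1 hB)
  have h3 : U ∩ g ⁻¹' B = Subtype.val '' (U.domRestrict g ⁻¹' B) := by
    ext y
    simp [and_comm]
  rwa [h3]

theorem aemeasurable_withDensity_of_continuousOn {ν : Measure V} {U : Set V} (hU : IsOpen U)
    {g : V → S} (hg : ContinuousOn g U) (ρ : V → ℝ≥0∞) :
    AEMeasurable g ((ν.restrict U).withDensity ρ) :=
  (hg.aemeasurable hU.measurableSet).mono_ac (withDensity_absolutelyContinuous _ _)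

theorem map_withDensity_apply {ν : Measure V} [SFinite ν] {U : Set V} (hU : IsOpen U)
    {g : V → S} (hg : ContinuousOn g U) (ρ : V → ℝ≥0∞) {B : Set S} (hB : MeasurableSet B) :
    Measure.map g ((ν.restrict U).withDensity ρ) B = ∫⁻ y in U ∩ g ⁻¹' B, ρ y ∂ν := by
  rw [Measure.map_apply_of_aemeasurable (aemeasurable_withDensity_of_continuousOn hU hg ρ) hB,
    withDensity_apply', Measure.restrict_restrict' hU.measurableSet, Set.inter_comm]

end MeasureLemmas

section LiouvilleMeasure

variable {EM : Type*} [NormedAddCommGroup EM] [NormedSpace ℝ EM]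
  {M : Type uM} [TopologicalSpace M] [ChartedSpace EM M] [IsManifold 𝓘(ℝ, EM) ∞ M]
  {FA : Type*} [NormedAddCommGroup FA] [NormedSpace ℝ FA]
  {A : M → Type*} [∀ m, AddCommGroup (A m)] [∀ m, Module ℝ (A m)]
  [TopologicalSpace (TotalSpace FA A)] [∀ m, TopologicalSpace (A m)] [FiberBundle FA A]
  [VectorBundle ℝ FA A]
  {ES : Type*} [NormedAddCommGroup ES] [NormedSpace ℝ ES]
  {S : Type uS} [TopologicalSpace S] [ChartedSpace ES S] [IsManifold 𝓘(ℝ, ES) ∞ S]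
  {𝓐 : LieAlgebroid EM FA A} {J : S → M} (ωt : PresymplecticForm ES 𝓐 J)

theorem liouvilleDensity_of_mem {m : M} (ψ : FiberParam EM ES J m) {y : Fin ψ.dim → ℝ}
    (hy : y ∈ ψ.dom) :
    liouvilleDensity ωt ψ y = √(Matrix.det (Matrix.of fun i j =>
      ωt.vert (ψ.map y) (ψ.partialDeriv ⟨y, hy⟩ i) (ψ.partialDeriv ⟨y, hy⟩ j))) :=
  dif_pos hy

namespace AdaptedChart

variable {m₀ : M} {O : Set EM} {k : ℕ} (e : AdaptedChart EM ES J m₀ O k)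

/-- The inverse of an adapted chart, restricted to the fibre over `m`. -/
def slice (m : M) (y : Fin k → ℝ) : S := e.chart.symm (chartAt EM m₀ m, y)

section Slice

variable {m : M} (hm : m ∈ (chartAt EM m₀).source) (hmO : chartAt EM m₀ m ∈ O)
include hmO

theorem mem_target_of_mem_fibreDom {y : Fin k → ℝ} (hy : y ∈ e.fibreDom) :
    (chartAt EM m₀ m, y) ∈ e.chart.target := by
  rw [e.target_eq]
  exact ⟨hmO, hy⟩

theorem slice_mem_source {y : Fin k → ℝ} (hy : y ∈ e.fibreDom) : e.slice m y ∈ e.chart.source :=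
  e.symm_mem_source hmO hy

theorem chart_slice {y : Fin k → ℝ} (hy : y ∈ e.fibreDom) :
    e.chart (e.slice m y) = (chartAt EM m₀ m, y) :=
  e.chart.right_inv (e.mem_target_of_mem_fibreDom hmO hy)

theorem contMDiffOn_slice :
    ContMDiffOn 𝓘(ℝ, Fin k → ℝ) 𝓘(ℝ, ES) ∞ (e.slice m) e.fibreDom :=
  e.isSmoothChart.smooth_symm.comp (g := e.chart.symm) (f := fun y => (chartAt EM m₀ m, y))
    (contDiff_prodMk_right _).contMDiff.contMDiffOn
    fun _ hy => e.mem_target_of_mem_fibreDom hmO hy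

include hm in
theorem base_slice {y : Fin k → ℝ} (hy : y ∈ e.fibreDom) : J (e.slice m y) = m := by
  rw [slice, e.base_apply hmO hy, (chartAt EM m₀).left_inv hm]

end Slice

theorem slice_chart {s : S} (hs : s ∈ e.chart.source) : e.slice (J s) (e.chart s).2 = s := by
  rw [slice, ← e.fst_eq s hs]
  exact e.chart.left_inv hs

section

variable (hJ : ContMDiff 𝓘(ℝ, ES) 𝓘(ℝ, EM) ∞ J)

/-- The derivative of a map into a fibre, expressed by the coordinate frame. -/
theorem pushVec_eq_frame {d : ℕ} {g : (Fin d → ℝ) → S} {y : Fin d → ℝ}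
    (hg : MDifferentiableAt 𝓘(ℝ, Fin d → ℝ) 𝓘(ℝ, ES) g y) (hy : g y ∈ e.chart.source) {m : M}
    (hgm : ∀ᶠ z in 𝓝 y, J (g z) = m) :
    DifferentiableAt ℝ (fun z => (e.chart (g z)).2) y ∧ ∀ w,
    pushVec (EB := ES) g y w
      = (e.frame hJ (g y) (fderiv ℝ (fun z => (e.chart (g z)).2) y w)).1 := by
  have hed := e.isSmoothChart.mdifferentiableAt hy
  have hd : DifferentiableAt ℝ (e.chart ∘ g) y := (hed.comp y hg).differentiableAt
  have hF : DifferentiableAt ℝ (fun z => (e.chart (g z)).2) y := hd.snd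
  refine ⟨hF, fun w => ?_⟩
  have hev : (e.chart ∘ g) =ᶠ[𝓝 y] fun z => (chartAt EM m₀ m, (e.chart (g z)).2) := by
    filter_upwards [hgm, hg.continuousAt.eventually (e.chart.open_source.mem_nhds hy)] with z h1 h2
    refine Prod.ext ?_ rfl
    change (e.chart (g z)).1 = _
    rw [e.fst_eq _ h2, h1]
  have h1 := dirDeriv_comp_pushVec hed hg w
  have h2 := ((hasFDerivAt_const (chartAt EM m₀ m) y).prodMk hF.hasFDerivAt).congr_of_eventuallyEq
    hev
  rw [h2.fderiv] at h1
  have h3 := e.isSmoothChart.pushVec_dirDeriv hy (pushVec (EB := ES) g y w)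
  rw [← h1] at h3
  rw [frame_coe hJ hy]
  exact h3.symm

theorem frame_injective {s : S} (hs : s ∈ e.chart.source) :
    Function.Injective (e.frame hJ s) := by
  intro v w h
  have h1 := dirDeriv_frame hJ hs v
  rw [h, dirDeriv_frame hJ hs w] at h1
  exact (congrArg Prod.snd h1).symm

theorem frame_surjective {s : S} (hs : s ∈ e.chart.source) :
    Function.Surjective (e.frame hJ s) := fun v => ⟨_, frame_dirDeriv hJ hs v⟩

include hJ in
theorem finrank_vertical {s : S} (hs : s ∈ e.chart.source) :
    Module.finrank ℝ (vertical EM ES J s) = k := by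
  rw [← (LinearEquiv.ofBijective (e.frame hJ s)
    ⟨e.frame_injective hJ hs, e.frame_surjective hJ hs⟩).finrank_eq]
  simp

include hJ in
/-- A parametrization of a part of the fibre has the dimension of the fibre coordinates. -/
theorem dim_eq {m : M} (ψ : FiberParam EM ES J m) {y : Fin ψ.dim → ℝ} (hy : y ∈ ψ.dom)
    (hs : ψ.map y ∈ e.chart.source) : ψ.dim = k := by
  rw [← e.finrank_vertical hJ hs, Module.finrank_eq_card_basis
    (Module.Basis.mk (ψ.linearIndependent ⟨y, hy⟩) (ψ.span ⟨y, hy⟩).ge), Fintype.card_fin]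

/-- The densities in a parametrization and in an adapted chart differ by the Jacobian determinant of
the change of coordinates. -/
theorem liouvilleDensity_eq {m : M} (ψ : FiberParam EM ES J m) {y : Fin ψ.dim → ℝ}
    (hy : y ∈ ψ.dom) (e : AdaptedChart EM ES J m₀ O ψ.dim) (hs : ψ.map y ∈ e.chart.source) :
    liouvilleDensity ωt ψ y
      = |(fderiv ℝ (fun z => (e.chart (ψ.map z)).2) y).det| * e.density ωt hJ (ψ.map y) := by
  have hd := (ψ.smooth.contMDiffAt (ψ.isOpen_dom.mem_nhds hy)).mdifferentiableAt (by simp)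
  have hgm : ∀ᶠ z in 𝓝 y, J (ψ.map z) = m := by
    filter_upwards [ψ.isOpen_dom.mem_nhds hy] with z hz using ψ.maps z hz
  set T := fderiv ℝ (fun z => (e.chart (ψ.map z)).2) y with hT
  have h1 : ∀ i, ψ.partialDeriv ⟨y, hy⟩ i = e.frame hJ (ψ.map y) (T (Pi.single i 1)) := fun i =>
    Subtype.ext ((ψ.partialDeriv_eq ⟨y, hy⟩ i).trans ((e.pushVec_eq_frame hJ hd hs hgm).2 _))
  rw [liouvilleDensity_of_mem ωt ψ hy]
  have h2 : (Matrix.of fun i j => ωt.vert (ψ.map y) (ψ.partialDeriv ⟨y, hy⟩ i)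
      (ψ.partialDeriv ⟨y, hy⟩ j))
      = (LinearMap.toMatrix' T.toLinearMap).transpose * Matrix.of (e.gram ωt hJ (ψ.map y))
        * LinearMap.toMatrix' T.toLinearMap := by
    ext i j
    rw [Matrix.of_apply, h1, h1, ← ωt.vertForm_apply, e.vertForm_frame ωt hJ, Matrix.mul_assoc,
      Matrix.mul_apply']
    rfl
  rw [h2, Matrix.det_mul, Matrix.det_mul, Matrix.det_transpose, mul_right_comm, ← pow_two,
    Real.sqrt_mul (sq_nonneg _), Real.sqrt_sq_eq_abs, LinearMap.det_toMatrix']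
  rfl

/-- The parametrization of a part of a fibre by an adapted chart. -/
def fiberParam {m : M} (hm : m ∈ (chartAt EM m₀).source) (hmO : chartAt EM m₀ m ∈ O) :
    FiberParam EM ES J m where
  dim := k
  dom := e.fibreDom
  isOpen_dom := e.isOpen_fibreDom
  map := e.slice m
  smooth := e.contMDiffOn_slice hmO
  injOn y hy z hz h := by
    have h1 := e.chart_slice hmO hy
    rw [h, e.chart_slice hmO hz] at h1
    exact (congrArg Prod.snd h1).symm
  maps _ hy := e.base_slice hm hmO hy
  partialDeriv y i := e.frame hJ (e.slice m y) (Pi.single i 1)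
  partialDeriv_eq y i := by
    have hd := ((e.contMDiffOn_slice hmO).contMDiffAt
      (e.isOpen_fibreDom.mem_nhds y.2)).mdifferentiableAt (by simp)
    have hgm : ∀ᶠ z in 𝓝 y.1, J (e.slice m z) = m := by
      filter_upwards [e.isOpen_fibreDom.mem_nhds y.2] with z hz using e.base_slice hm hmO hz
    have hid : (fun z => (e.chart (e.slice m z)).2) =ᶠ[𝓝 y.1] id := by
      filter_upwards [e.isOpen_fibreDom.mem_nhds y.2] with z hz
      rw [e.chart_slice hmO hz]
      rfl
    have h := (e.pushVec_eq_frame hJ hd (e.slice_mem_source hmO y.2) hgm).2 (Pi.single i 1)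
    rw [hid.fderiv_eq, fderiv_id] at h
    exact h.symm
  linearIndependent y := by
    have h := (Pi.basisFun ℝ (Fin k)).linearIndependent.map' (e.frame hJ (e.slice m y))
      (LinearMap.ker_eq_bot.2 (e.frame_injective hJ (e.slice_mem_source hmO y.2)))
    simpa [Function.comp_def] using h
  span y := by
    have h := congrArg (Submodule.map (e.frame hJ (e.slice m y))) (Pi.basisFun ℝ (Fin k)).span_eq
    rw [Submodule.map_span, Submodule.map_top, LinearMap.range_eq_top.2
      (e.frame_surjective hJ (e.slice_mem_source hmO y.2)), ← Set.range_comp] at h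
    simpa [Function.comp_def] using h

variable [MeasurableSpace S]

/-- The Liouville measure on the part of the fibre over `m` in an adapted chart. -/
def fibreMeasure (m : M) : Measure S :=
  Measure.map (e.slice m) ((volume.restrict e.fibreDom).withDensity
    fun y => ENNReal.ofReal (e.density ωt hJ (e.slice m y)))

variable [BorelSpace S]

theorem fibreMeasure_apply {m : M} (hmO : chartAt EM m₀ m ∈ O) {B : Set S} (hB : MeasurableSet B) :
    e.fibreMeasure ωt hJ m B = ∫⁻ y in e.fibreDom ∩ e.slice m ⁻¹' B,
      ENNReal.ofReal (e.density ωt hJ (e.slice m y)) :=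
  map_withDensity_apply e.isOpen_fibreDom (e.contMDiffOn_slice hmO).continuousOn _ hB

theorem fibreMeasure_restrict {m : M} (hmO : chartAt EM m₀ m ∈ O) :
    (e.fibreMeasure ωt hJ m).restrict e.chart.source = e.fibreMeasure ωt hJ m := by
  refine Measure.restrict_eq_self_of_ae_mem ?_
  rw [ae_iff]
  have hset : {s | s ∉ e.chart.source} = e.chart.sourceᶜ := rfl
  rw [hset, e.fibreMeasure_apply ωt hJ hmO e.chart.open_source.measurableSet.compl]
  have hemp : e.fibreDom ∩ e.slice m ⁻¹' e.chart.sourceᶜ = ∅ := by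
    ext y
    simp only [Set.mem_inter_iff, Set.mem_preimage, Set.mem_compl_iff, Set.mem_empty_iff_false,
      iff_false, not_and, not_not]
    exact fun hy => e.slice_mem_source hmO hy
  rw [hemp]
  simp

/-- By the change of variables formula, the density `ω^d / d!` gives the same measure in any
parametrization of a part of the fibre. -/
theorem map_fiberParam_restrict_le {m : M} (hmO : chartAt EM m₀ m ∈ O)
    (ψ : FiberParam EM ES J m) :
    (Measure.map ψ.map ((volume.restrict ψ.dom).withDensity
      fun y => ENNReal.ofReal (liouvilleDensity ωt ψ y))).restrict e.chart.source
      ≤ e.fibreMeasure ωt hJ m := by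
  refine Measure.le_iff.2 fun B hB => ?_
  rw [Measure.restrict_apply hB,
    map_withDensity_apply ψ.isOpen_dom ψ.smooth.continuousOn _
      (hB.inter e.chart.open_source.measurableSet)]
  set D := ψ.dom ∩ ψ.map ⁻¹' (B ∩ e.chart.source) with hD
  -- the dimensions can be compared only if the parametrization meets the chart
  rcases D.eq_empty_or_nonempty with hemp | ⟨y₀, hy₀⟩
  · rw [hemp]
    simp
  have hdim := e.dim_eq hJ ψ hy₀.1 hy₀.2.2
  subst hdim
  have hDm : MeasurableSet D := measurableSet_inter_preimage_of_continuousOn ψ.isOpen_dom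
    ψ.smooth.continuousOn (hB.inter e.chart.open_source.measurableSet)
  set F := fun z => (e.chart (ψ.map z)).2 with hF
  have hslice : ∀ y ∈ D, e.slice m (F y) = ψ.map y := by
    intro y hy
    have := e.slice_chart hy.2.2
    rwa [ψ.maps y hy.1] at this
  have hFd : ∀ y ∈ D, HasFDerivWithinAt F (fderiv ℝ F y) D y := by
    intro y hy
    have hd := (ψ.smooth.contMDiffAt (ψ.isOpen_dom.mem_nhds hy.1)).mdifferentiableAt (by simp)
    have hgm : ∀ᶠ z in 𝓝 y, J (ψ.map z) = m := by
      filter_upwards [ψ.isOpen_dom.mem_nhds hy.1] with z hz using ψ.maps z hz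
    exact (e.pushVec_eq_frame hJ hd hy.2.2 hgm).1.hasFDerivAt.hasFDerivWithinAt
  have hinj : Set.InjOn F D := by
    intro y hy z hz h
    refine ψ.injOn hy.1 hz.1 ?_
    rw [← hslice y hy, ← hslice z hz, h]
  have h1 : ∫⁻ y in D, ENNReal.ofReal (liouvilleDensity ωt ψ y)
      = ∫⁻ y in D, ENNReal.ofReal |(fderiv ℝ F y).det|
        * ENNReal.ofReal (e.density ωt hJ (e.slice m (F y))) := by
    refine setLIntegral_congr_fun hDm fun y hy => ?_
    rw [liouvilleDensity_eq ωt hJ ψ hy.1 e hy.2.2, ENNReal.ofReal_mul (abs_nonneg _)]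
    rw [hslice y hy]
  rw [h1, ← lintegral_image_eq_lintegral_abs_det_fderiv_mul volume hDm hFd hinj
    (fun z => ENNReal.ofReal (e.density ωt hJ (e.slice m z))), e.fibreMeasure_apply ωt hJ hmO hB]
  refine lintegral_mono_set ?_
  rintro _ ⟨y, hy, rfl⟩
  refine ⟨(e.mem_target hy.2.2).2, ?_⟩
  rw [Set.mem_preimage, hslice y hy]
  exact hy.2.1

theorem fibreMeasure_le {m : M} (hm : m ∈ (chartAt EM m₀).source) (hmO : chartAt EM m₀ m ∈ O) :
    e.fibreMeasure ωt hJ m ≤ liouvilleMeasure ωt m := by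
  have h : e.fibreMeasure ωt hJ m = Measure.map (e.fiberParam hJ hm hmO).map
      ((volume.restrict (e.fiberParam hJ hm hmO).dom).withDensity
        fun y => ENNReal.ofReal (liouvilleDensity ωt (e.fiberParam hJ hm hmO) y)) := by
    change _ = Measure.map (e.slice m) ((volume.restrict e.fibreDom).withDensity _)
    rw [fibreMeasure]
    congr 1
    refine withDensity_congr_ae ?_
    filter_upwards [ae_restrict_mem e.isOpen_fibreDom.measurableSet] with y hy
    congr 1
    have hy' : y ∈ (e.fiberParam hJ hm hmO).dom := hy
    exact (liouvilleDensity_of_mem ωt (e.fiberParam hJ hm hmO) hy').symm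
  rw [h]
  exact le_iSup (fun ψ : FiberParam EM ES J m => Measure.map ψ.map
    ((volume.restrict ψ.dom).withDensity fun y => ENNReal.ofReal (liouvilleDensity ωt ψ y))) _

/-- In an adapted chart, the Liouville measure of a fibre is given by the density `ω^d / d!`. -/
theorem liouvilleMeasure_restrict {m : M} (hm : m ∈ (chartAt EM m₀).source)
    (hmO : chartAt EM m₀ m ∈ O) :
    (liouvilleMeasure ωt m).restrict e.chart.source = e.fibreMeasure ωt hJ m := by
  have hV := e.chart.open_source.measurableSet
  refine le_antisymm ?_ ?_
  -- the measure `fibreMeasure + Ω_m|ᶜ` dominates the measures of all parametrizations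
  · have h1 : liouvilleMeasure ωt m
        ≤ e.fibreMeasure ωt hJ m + (liouvilleMeasure ωt m).restrict e.chart.sourceᶜ := by
      refine iSup_le fun ψ => ?_
      rw [← Measure.restrict_add_restrict_compl (μ := Measure.map ψ.map _) hV]
      refine add_le_add (e.map_fiberParam_restrict_le ωt hJ hmO ψ)
        (Measure.restrict_mono le_rfl ?_)
      exact le_iSup (fun ψ : FiberParam EM ES J m => Measure.map ψ.map
        ((volume.restrict ψ.dom).withDensity fun y => ENNReal.ofReal (liouvilleDensity ωt ψ y))) ψ
    have h2 := Measure.restrict_mono (le_refl e.chart.source) h1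
    rw [Measure.restrict_add, e.fibreMeasure_restrict ωt hJ hmO, Measure.restrict_restrict hV,
      Set.inter_compl_self, Measure.restrict_empty, add_zero] at h2
    exact h2
  · rw [← e.fibreMeasure_restrict ωt hJ hmO]
    exact Measure.restrict_mono le_rfl (e.fibreMeasure_le ωt hJ hm hmO)

theorem continuousOn_density_slice [FiniteDimensional ℝ ES] [T2Space S] {m : M}
    (hmO : chartAt EM m₀ m ∈ O) :
    ContinuousOn (fun y => e.density ωt hJ (e.slice m y)) e.fibreDom :=
  (e.contMDiffOn_density ωt hJ).continuousOn.comp (e.contMDiffOn_slice hmO).continuousOn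
    fun _ hy => e.slice_mem_source hmO hy

/-- The fibre integral of a function that is supported in an adapted chart. -/
theorem integral_liouvilleMeasure [FiniteDimensional ℝ ES] [T2Space S] {m : M}
    (hm : m ∈ (chartAt EM m₀).source) (hmO : chartAt EM m₀ m ∈ O)
    {f : S → ℂ} (hf : Continuous f) (hfs : Function.support f ⊆ e.chart.source) :
    ∫ s, f s ∂(liouvilleMeasure ωt m)
      = ∫ y in e.fibreDom, e.density ωt hJ (e.slice m y) • f (e.slice m y) := by
  have h1 : ∫ s in e.chart.source, f s ∂(liouvilleMeasure ωt m)
      = ∫ s, f s ∂(liouvilleMeasure ωt m) := by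
    refine setIntegral_eq_integral_of_forall_compl_eq_zero fun s hs => ?_
    by_contra h
    exact hs (hfs h)
  rw [← h1, e.liouvilleMeasure_restrict ωt hJ hm hmO, fibreMeasure,
    integral_map (aemeasurable_withDensity_of_continuousOn e.isOpen_fibreDom
      (e.contMDiffOn_slice hmO).continuousOn _) hf.aestronglyMeasurable,
    integral_withDensity_eq_integral_toReal_smul₀
      ((e.continuousOn_density_slice ωt hJ hmO).aemeasurable
        e.isOpen_fibreDom.measurableSet).ennreal_ofReal
      (Filter.Eventually.of_forall fun _ => ENNReal.ofReal_lt_top)]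
  refine integral_congr_ae (Filter.Eventually.of_forall fun y => ?_)
  beta_reduce
  rw [ENNReal.toReal_ofReal (show 0 ≤ e.density ωt hJ (e.slice m y) from Real.sqrt_nonneg _)]

include hJ in
/-- Points in the domain of an adapted chart have neighbourhoods of finite Liouville measure. -/
theorem exists_nhds_liouvilleMeasure_lt_top [FiniteDimensional ℝ ES] [T2Space S] {s : S}
    (hs : s ∈ e.chart.source) :
    ∃ V ∈ 𝓝 s, liouvilleMeasure ωt (J s) V < ⊤ := by
  have hm := e.mem_base s hs
  have hmO : chartAt EM m₀ (J s) ∈ O := by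
    rw [← e.fst_eq s hs]
    exact (e.mem_target hs).1
  obtain ⟨C, hC, hCW, hCc⟩ := local_compact_nhds (e.isOpen_fibreDom.mem_nhds (e.mem_target hs).2)
  have hcont : ContinuousAt (fun t => (e.chart t).2) s := (e.chart.continuousAt hs).snd
  refine ⟨interior (e.chart.source ∩ (fun t => (e.chart t).2) ⁻¹' C), interior_mem_nhds.2
    (Filter.inter_mem (e.chart.open_source.mem_nhds hs) (hcont hC)), ?_⟩
  set V := interior (e.chart.source ∩ (fun t => (e.chart t).2) ⁻¹' C)
  have hV : V ⊆ e.chart.source ∩ (fun t => (e.chart t).2) ⁻¹' C := interior_subset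
  rw [← Measure.restrict_eq_self _ (fun t ht => (hV ht).1), e.liouvilleMeasure_restrict ωt hJ hm hmO,
    e.fibreMeasure_apply ωt hJ hmO isOpen_interior.measurableSet]
  have hsub : e.fibreDom ∩ e.slice (J s) ⁻¹' V ⊆ C := by
    intro y hy
    have := (hV hy.2).2
    rwa [Set.mem_preimage, e.chart_slice hmO hy.1] at this
  refine (lintegral_mono_set hsub).trans_lt ?_
  have hint := ((e.continuousOn_density_slice ωt hJ hmO).mono hCW).integrableOn_compact
    (μ := volume) hCc
  exact hint.lintegral_lt_top

include hJ in
/-- The Liouville measure of a fibre is positive on open sets that meet the fibre. -/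
theorem liouvilleMeasure_pos [FiniteDimensional ℝ ES] [T2Space S] {s : S}
    (hs : s ∈ e.chart.source) {U : Set S} (hU : IsOpen U) (hsU : s ∈ U) :
    0 < liouvilleMeasure ωt (J s) U := by
  have hm := e.mem_base s hs
  have hmO : chartAt EM m₀ (J s) ∈ O := by
    rw [← e.fst_eq s hs]
    exact (e.mem_target hs).1
  refine lt_of_lt_of_le ?_ (Measure.restrict_apply_le e.chart.source U)
  rw [e.liouvilleMeasure_restrict ωt hJ hm hmO, e.fibreMeasure_apply ωt hJ hmO hU.measurableSet]
  have hopen : IsOpen (e.fibreDom ∩ e.slice (J s) ⁻¹' U) :=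
    (e.contMDiffOn_slice hmO).continuousOn.isOpen_inter_preimage e.isOpen_fibreDom hU
  have hmeas : AEMeasurable (fun y => ENNReal.ofReal (e.density ωt hJ (e.slice (J s) y)))
      (volume.restrict (e.fibreDom ∩ e.slice (J s) ⁻¹' U)) :=
    (((e.continuousOn_density_slice ωt hJ hmO).mono Set.inter_subset_left).aemeasurable
      hopen.measurableSet).ennreal_ofReal
  rw [pos_iff_ne_zero, Ne, lintegral_eq_zero_iff' hmeas]
  intro h
  rw [Filter.EventuallyEq, ae_restrict_iff' hopen.measurableSet] at h
  have h0 : volume (e.fibreDom ∩ e.slice (J s) ⁻¹' U) = 0 := by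
    refine measure_mono_null (fun y hy => ?_) h
    simp only [Set.mem_compl_iff, Set.mem_ofPred_eq, not_forall]
    refine ⟨hy, ?_⟩
    have := e.density_pos ωt hJ (e.slice_mem_source hmO hy.1)
    simp [this]
  exact (hopen.measure_pos volume ⟨(e.chart s).2, (e.mem_target hs).2, by
    rwa [Set.mem_preimage, e.slice_chart hs]⟩).ne' h0

end

end AdaptedChart

variable [MeasurableSpace S] [BorelSpace S]

/-- The Liouville measure `Ω_m` is concentrated on the fibre over `m`. -/
theorem liouvilleMeasure_compl_fibre [T1Space M] (hJ : Continuous J) (m : M) :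
    liouvilleMeasure ωt m (J ⁻¹' {m})ᶜ = 0 := by
  have hF : MeasurableSet (J ⁻¹' {m}) := (isClosed_singleton.preimage hJ).measurableSet
  have h : liouvilleMeasure ωt m ≤ (liouvilleMeasure ωt m).restrict (J ⁻¹' {m}) := by
    refine iSup_le fun ψ => ?_
    have h1 : (Measure.map ψ.map ((volume.restrict ψ.dom).withDensity
        fun y => ENNReal.ofReal (liouvilleDensity ωt ψ y))).restrict (J ⁻¹' {m})
        = Measure.map ψ.map ((volume.restrict ψ.dom).withDensity
        fun y => ENNReal.ofReal (liouvilleDensity ωt ψ y)) := by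
      refine Measure.restrict_eq_self_of_ae_mem ?_
      rw [ae_iff]
      change Measure.map ψ.map _ (J ⁻¹' {m})ᶜ = 0
      rw [map_withDensity_apply ψ.isOpen_dom ψ.smooth.continuousOn _ hF.compl]
      have hemp : ψ.dom ∩ ψ.map ⁻¹' (J ⁻¹' {m})ᶜ = ∅ := by
        ext y
        simp only [Set.mem_inter_iff, Set.mem_preimage, Set.mem_compl_iff, Set.mem_singleton_iff,
          Set.mem_empty_iff_false, iff_false, not_and, not_not]
        exact fun hy => ψ.maps y hy
      rw [hemp]
      simp
    rw [← h1]
    exact Measure.restrict_mono le_rfl (le_iSup (fun ψ : FiberParam EM ES J m => Measure.map ψ.map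
      ((volume.restrict ψ.dom).withDensity fun y => ENNReal.ofReal (liouvilleDensity ωt ψ y))) ψ)
  refine le_antisymm ((h _).trans ?_) zero_le
  rw [Measure.restrict_apply hF.compl, Set.compl_inter_self, measure_empty]

theorem ae_liouvilleMeasure [T1Space M] (hJ : Continuous J) (m : M) :
    ∀ᵐ s ∂(liouvilleMeasure ωt m), J s = m := by
  rw [ae_iff]
  exact liouvilleMeasure_compl_fibre ωt hJ m

variable [FiniteDimensional ℝ EM] [T2Space M] [FiniteDimensional ℝ ES] [T2Space S]

theorem isCompact_fibre (hJ : IsCompactFiberBundle EM ES J) (m : M) : IsCompact (J ⁻¹' {m}) := by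
  obtain ⟨K, hK, -, -, hKc⟩ := hJ.exists_isCompact_preimage (Filter.univ_mem (f := 𝓝 m))
  refine hKc.of_isClosed_subset (isClosed_singleton.preimage hJ.1.continuous)
    (Set.preimage_mono (Set.singleton_subset_iff.2 (mem_of_mem_nhds hK)))

theorem isFiniteMeasure_liouvilleMeasure (hJ : IsCompactFiberBundle EM ES J) (m : M) :
    IsFiniteMeasure (liouvilleMeasure ωt m) := by
  have h1 : liouvilleMeasure ωt m (J ⁻¹' {m}) < ⊤ := by
    refine (isCompact_fibre hJ m).measure_lt_top_of_nhdsWithin fun s hs => ?_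
    obtain ⟨k, O, hO, hmO, he⟩ := hJ.exists_adaptedChart (J s)
    obtain ⟨e, hs'⟩ := he s (mem_chart_source EM _) hmO
    obtain ⟨V, hV, hVt⟩ := e.exists_nhds_liouvilleMeasure_lt_top ωt hJ.1 hs'
    refine ⟨V, mem_nhdsWithin_of_mem_nhds hV, ?_⟩
    rwa [show J s = m from hs] at hVt
  refine ⟨?_⟩
  rw [← Set.union_compl_self (J ⁻¹' {m})]
  refine (measure_union_le _ _).trans_lt ?_
  rw [liouvilleMeasure_compl_fibre ωt hJ.1.continuous, add_zero]
  exact h1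

theorem liouvilleMeasure_pos (hJ : IsCompactFiberBundle EM ES J) {s : S} {U : Set S}
    (hU : IsOpen U) (hsU : s ∈ U) : 0 < liouvilleMeasure ωt (J s) U := by
  obtain ⟨k, O, hO, hmO, he⟩ := hJ.exists_adaptedChart (J s)
  obtain ⟨e, hs⟩ := he s (mem_chart_source EM _) hmO
  exact e.liouvilleMeasure_pos ωt hJ.1 hs hU hsU

/-- Continuous functions are integrable over the compact fibres. -/
theorem integrable_liouvilleMeasure (hJ : IsCompactFiberBundle EM ES J) (m : M)
    {f : S → ℂ} (hf : Continuous f) : Integrable f (liouvilleMeasure ωt m) := by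
  have := isFiniteMeasure_liouvilleMeasure ωt hJ m
  obtain ⟨C, hC⟩ := (isCompact_fibre hJ m).exists_bound_of_continuousOn hf.continuousOn
  refine Integrable.of_bound hf.aestronglyMeasurable C ?_
  filter_upwards [ae_liouvilleMeasure ωt hJ.1.continuous m] with s hs using hC s hs

end LiouvilleMeasure

/-! ### The Lie derivative of the Liouville density -/

section LieDerivative

variable {EM : Type*} [NormedAddCommGroup EM] [NormedSpace ℝ EM]
  {M : Type uM} [TopologicalSpace M] [ChartedSpace EM M] [IsManifold 𝓘(ℝ, EM) ∞ M]
  {FA : Type*} [NormedAddCommGroup FA] [NormedSpace ℝ FA]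
  {A : M → Type*} [∀ m, AddCommGroup (A m)] [∀ m, Module ℝ (A m)]
  [TopologicalSpace (TotalSpace FA A)] [∀ m, TopologicalSpace (A m)] [FiberBundle FA A]
  [VectorBundle ℝ FA A]
  {ES : Type*} [NormedAddCommGroup ES] [NormedSpace ℝ ES]
  {S : Type uS} [TopologicalSpace S] [ChartedSpace ES S] [IsManifold 𝓘(ℝ, ES) ∞ S]
  {𝓐 : LieAlgebroid EM FA A} {J : S → M} {ωt : PresymplecticForm ES 𝓐 J} {α : Action ES 𝓐 J}
  [CompleteSpace ES]

/-- The contraction of `ω̃` with `α(X)` is exact along the fibres, with potential `⟨μ̃, J^*X⟩`. -/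
theorem MomentumMap.form_vertical (μ : MomentumMap α ωt) (X : Cₛ^∞⟮𝓘(ℝ, EM); FA, A⟯) (s : S)
    (v : vertical EM ES J s) :
    ωt.form s (vertIncl 𝓐 J s v) ((α.leafField X).at s)
      = dirDeriv (fun t => μ.toFun t (X (J t))) s v.1 := by
  rw [μ.quantization, ωt.form_swap]

/-- The Lie derivative of the vertical form along `α(X)` vanishes, because `ω̃` is closed and its
contraction with `α(X)` is exact along the fibres. -/
theorem MomentumMap.dirDeriv_vertForm (μ : MomentumMap α ωt) (hJ : ContMDiff 𝓘(ℝ, ES) 𝓘(ℝ, EM) ∞ J)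
    (X : Cₛ^∞⟮𝓘(ℝ, EM); FA, A⟯) (u v : FieldIn (vertical EM ES J)) (s : S) :
    dirDeriv (fun t => ωt.vertForm t (u.at t) (v.at t)) s (α.toFun X s)
      = ωt.vertForm s ((α.bracketField hJ X u).at s) (v.at s)
        + ωt.vertForm s (u.at s) ((α.bracketField hJ X v).at s) := by
  -- `v`, like `α(X)`, is projectable, so the brackets below are vertical and may be inserted into
  -- the closedness of `ω̃`
  have hζ : ContMDiff 𝓘(ℝ, EM) 𝓘(ℝ, EM).tangent ∞
      (fun m => (⟨m, 0⟩ : TangentBundle 𝓘(ℝ, EM) M)) := contMDiff_zeroSection ℝ _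
  let uv : FieldIn (vertical EM ES J) :=
    verticalBracket hJ u.field (ζ := fun _ => 0) hζ u.mem v
  let vX : FieldIn (leafTangent ES 𝓐 J) :=
    ⟨-(α.bracketField hJ X v).field, fun t =>
      neg_mem (vertical_le_leafTangent 𝓐 J t ((α.bracketField hJ X v).mem t))⟩
  have hvX : IsBracket vX.field (v.toLeaf 𝓐).field (α.leafField X).field := fun t =>
    (VectorField.mlieBracket_swap_apply (V := v.field) (W := α.toFun X)).symm
  have hc := ωt.closed (α.leafField X) (u.toLeaf 𝓐) (v.toLeaf 𝓐)
    ((α.bracketField hJ X u).toLeaf 𝓐) (uv.toLeaf 𝓐) vX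
    (α.isBracket_bracketField hJ X u) (fun _ => rfl) hvX s
  -- the terms with `α(X)` in the form are derivatives of `⟨μ̃, J^*X⟩` along `u`, `v` and `[u, v]`,
  -- which cancel
  have h1 : (fun t => ωt.form t ((v.toLeaf 𝓐).at t) ((α.leafField X).at t))
      = fun t => dirDeriv (fun t => μ.toFun t (X (J t))) t (v.field t) :=
    funext fun t => μ.form_vertical X t (v.at t)
  have h2 : (fun t => ωt.form t ((α.leafField X).at t) ((u.toLeaf 𝓐).at t))
      = fun t => (-ContinuousLinearMap.id ℝ ℝ)
        (dirDeriv (fun t => μ.toFun t (X (J t))) t (u.field t)) :=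
    funext fun t => (ωt.form_swap t _ _).trans (congrArg Neg.neg (μ.form_vertical X t (u.at t)))
  have h3 := dirDeriv_mlieBracket isOpen_univ (Set.mem_univ s) (μ.smooth X).contMDiffOn
    u.field.contMDiff v.field.contMDiff
  have h4 : ωt.form s ((uv.toLeaf 𝓐).at s) ((α.leafField X).at s)
      = dirDeriv (fun t => μ.toFun t (X (J t))) s
        (VectorField.mlieBracket 𝓘(ℝ, ES) u.field v.field s) := μ.form_vertical X s (uv.at s)
  have h5 : vX.at s = -((α.bracketField hJ X v).toLeaf 𝓐).at s := rfl
  rw [h1, h2, dirDeriv_clm_comp _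
    ((contMDiff_dirDeriv (μ.smooth X) u.field.contMDiff s).mdifferentiableAt (by simp)), h4, h3, h5, map_neg, LinearMap.neg_apply,
    ωt.form_swap s (((α.bracketField hJ X v).toLeaf 𝓐).at s)] at hc
  simp only [neg_apply, ContinuousLinearMap.id_apply] at hc
  change dirDeriv (fun t => ωt.form t ((u.toLeaf 𝓐).at t) ((v.toLeaf 𝓐).at t)) s
      ((α.leafField X).field s)
    = ωt.form s (((α.bracketField hJ X u).toLeaf 𝓐).at s) ((v.toLeaf 𝓐).at s)
      + ωt.form s ((u.toLeaf 𝓐).at s) (((α.bracketField hJ X v).toLeaf 𝓐).at s)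
  have h6 : (u.toLeaf 𝓐).field = u.field := rfl
  have h7 : (v.toLeaf 𝓐).field = v.field := rfl
  rw [h6, h7] at hc
  linarith

namespace AdaptedChart

variable {m₀ : M} {O : Set EM} {k : ℕ} (e : AdaptedChart EM ES J m₀ O k)
  (hJ : ContMDiff 𝓘(ℝ, ES) 𝓘(ℝ, EM) ∞ J)

/-- The components of the vector field `α(X)` along the fibres, in an adapted chart. -/
def fibreComp (α : Action ES 𝓐 J) (X : Cₛ^∞⟮𝓘(ℝ, EM); FA, A⟯) (s : S) : Fin k → ℝ :=
  (dirDeriv e.chart s (α.toFun X s)).2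

theorem contMDiffOn_fibreComp (X : Cₛ^∞⟮𝓘(ℝ, EM); FA, A⟯) :
    ContMDiffOn 𝓘(ℝ, ES) 𝓘(ℝ, Fin k → ℝ) ∞ (e.fibreComp α X) e.chart.source :=
  contDiff_snd.contMDiff.comp_contMDiffOn (contMDiffOn_dirDeriv e.chart.open_source
    e.isSmoothChart.smooth (α.toFun X).contMDiff.contMDiffOn)

/-- The matrix of partial derivatives of the components of `α(X)` along the fibres: the rows are
indexed by the coordinates by which one differentiates. -/
def jacobian (α : Action ES 𝓐 J) (X : Cₛ^∞⟮𝓘(ℝ, EM); FA, A⟯) (s : S) :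
    Matrix (Fin k) (Fin k) ℝ :=
  Matrix.of fun i => dirDeriv (e.fibreComp α X) s (e.frame hJ s (Pi.single i 1)).1

/-- The bracket of `α(X)` with a coordinate field along the fibres is minus the derivative of the
components of `α(X)`. -/
theorem bracketField_frame (X : Cₛ^∞⟮𝓘(ℝ, EM); FA, A⟯) {s : S} (hs : s ∈ e.chart.source)
    {w : Fin k → ℝ} {Y : FieldIn (vertical EM ES J)} (hY : ∀ᶠ t in 𝓝 s, Y.at t = e.frame hJ t w) :
    (α.bracketField hJ X Y).at s
      = -e.frame hJ s (dirDeriv (e.fibreComp α X) s (e.frame hJ s w).1) := by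
  rw [← frame_dirDeriv hJ hs ((α.bracketField hJ X Y).at s), ← map_neg]
  congr 1
  have h1 := dirDeriv_mlieBracket e.chart.open_source hs e.isSmoothChart.smooth
    (α.toFun X).contMDiff Y.field.contMDiff
  have h2 : (fun t => dirDeriv e.chart t (Y.field t)) =ᶠ[𝓝 s] fun _ => (0, w) := by
    filter_upwards [hY, e.chart.open_source.mem_nhds hs] with t ht hts
    have : Y.field t = (e.frame hJ t w).1 := congrArg Subtype.val ht
    rw [this, dirDeriv_frame hJ hts]
  have h3 : Y.field s = (e.frame hJ s w).1 := congrArg Subtype.val hY.self_of_nhds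
  have hd : MDifferentiableAt 𝓘(ℝ, ES) 𝓘(ℝ, EM × (Fin k → ℝ))
      (fun t => dirDeriv e.chart t (α.toFun X t)) s :=
    ((contMDiffOn_dirDeriv e.chart.open_source e.isSmoothChart.smooth
      (α.toFun X).contMDiff.contMDiffOn).contMDiffAt
        (e.chart.open_source.mem_nhds hs)).mdifferentiableAt (by simp)
  rw [dirDeriv_congr h2, dirDeriv_const, zero_sub, h3] at h1
  have h4 := dirDeriv_clm_comp (ContinuousLinearMap.snd ℝ EM (Fin k → ℝ)) hd (e.frame hJ s w).1
  exact (congrArg Prod.snd h1).trans (congrArg Neg.neg h4.symm)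

variable [FiniteDimensional ℝ ES] [T2Space S]

/-- The invariance of the form under `α(X)`: the derivative of its matrix is an infinitesimal
congruence by the Jacobian matrix of `α(X)` along the fibres. -/
theorem dirDeriv_gram (μ : MomentumMap α ωt) (X : Cₛ^∞⟮𝓘(ℝ, EM); FA, A⟯) {s : S}
    (hs : s ∈ e.chart.source) :
    Matrix.of (dirDeriv (e.gram ωt hJ) s (α.toFun X s))
      = -(e.jacobian hJ α X s * Matrix.of (e.gram ωt hJ s)
        + Matrix.of (e.gram ωt hJ s) * (e.jacobian hJ α X s).transpose) := by
  ext i j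
  have hd : MDifferentiableAt 𝓘(ℝ, ES) 𝓘(ℝ, Fin k → Fin k → ℝ) (e.gram ωt hJ) s :=
    ((e.contMDiffOn_gram ωt hJ).contMDiffAt (e.chart.open_source.mem_nhds hs)).mdifferentiableAt
      (by simp)
  have h1 := dirDeriv_clm_comp ((ContinuousLinearMap.proj (R := ℝ) (φ := fun _ : Fin k => ℝ) j).comp
    (ContinuousLinearMap.proj (R := ℝ) (φ := fun _ : Fin k => Fin k → ℝ) i)) hd (α.toFun X s)
  obtain ⟨Y, hY⟩ := exists_fieldIn_frame hJ hs (Pi.single i 1)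
  obtain ⟨Y', hY'⟩ := exists_fieldIn_frame hJ hs (Pi.single j 1)
  have h2 : (fun t => ωt.vertForm t (Y.at t) (Y'.at t)) =ᶠ[𝓝 s] fun t => e.gram ωt hJ t i j := by
    filter_upwards [hY, hY'] with t ht ht'
    rw [ht, ht']
    rfl
  have h3 := μ.dirDeriv_vertForm hJ X Y Y' s
  rw [dirDeriv_congr h2, e.bracketField_frame hJ X hs hY, e.bracketField_frame hJ X hs hY',
    hY.self_of_nhds, hY'.self_of_nhds, map_neg, map_neg, LinearMap.neg_apply, vertForm_frame,
    vertForm_frame] at h3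
  refine (h1.symm.trans h3).trans ?_
  rw [Matrix.neg_apply, Matrix.add_apply, neg_add]
  congr 2
  · rw [Matrix.mulVec_single_one, Matrix.mul_apply']
    rfl
  · rw [single_one_dotProduct]
    rfl

/-- The Lie derivative of the Liouville density along `α(X)`: in an adapted chart, the derivative of
the density is minus the divergence of the components of `α(X)` along the fibres. -/
theorem dirDeriv_density (μ : MomentumMap α ωt) (X : Cₛ^∞⟮𝓘(ℝ, EM); FA, A⟯) {s : S}
    (hs : s ∈ e.chart.source) :
    dirDeriv (e.density ωt hJ) s (α.toFun X s)
      = -((e.jacobian hJ α X s).trace * e.density ωt hJ s) := by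
  have hd : MDifferentiableAt 𝓘(ℝ, ES) 𝓘(ℝ, Fin k → Fin k → ℝ) (e.gram ωt hJ) s :=
    ((e.contMDiffOn_gram ωt hJ).contMDiffAt (e.chart.open_source.mem_nhds hs)).mdifferentiableAt
      (by simp)
  have h1 : DifferentiableAt ℝ (fun W : Fin k → Fin k → ℝ => √(Matrix.det (Matrix.of W)))
      (e.gram ωt hJ s) :=
    (contDiff_det.differentiable (by simp) _).sqrt (e.det_gram_pos ωt hJ hs).ne'
  have h2 := dirDeriv_comp h1.mdifferentiableAt hd (α.toFun X s)
  refine h2.trans ((dirDeriv_eq_fderiv _ _ _).trans ?_)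
  exact fderiv_sqrt_det_congruence (e.det_gram_pos ωt hJ hs) _ (e.dirDeriv_gram hJ μ X hs)

end AdaptedChart

end LieDerivative

/-! ### Differentiation under the integral sign -/

section ParametricIntegral

variable {V G : Type*} [NormedAddCommGroup V] [NormedSpace ℝ V]
  [NormedAddCommGroup G] [NormedSpace ℝ G] [FiniteDimensional ℝ G] [MeasurableSpace G]
  [BorelSpace G] {ν : Measure G} [ν.IsAddHaarMeasure]
  {h : V × G → ℂ} {C : Set G} (hh : ContDiff ℝ ∞ h) (hC : IsCompact C)
  (hsupp : ∀ x, ∀ y ∉ C, h (x, y) = 0)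
include hh hC hsupp

theorem fderiv_eq_zero_of_notMem (x : V) {y : G} (hy : y ∉ C) : fderiv ℝ h (x, y) = 0 := by
  refine (hasFDerivAt_zero_of_eventually_const 0 ?_).fderiv
  have : (Set.univ : Set V) ×ˢ Cᶜ ∈ 𝓝 (x, y) :=
    (isOpen_univ.prod hC.isClosed.isOpen_compl).mem_nhds ⟨trivial, hy⟩
  filter_upwards [this] with z hz using hsupp z.1 z.2 hz.2

theorem integrable_fderiv_apply (x : V) (ζ : V × G) :
    Integrable (fun y => fderiv ℝ h (x, y) ζ) ν := by
  have hc : Continuous fun y => fderiv ℝ h (x, y) ζ :=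
    ((hh.continuous_fderiv (by simp)).comp (Continuous.prodMk_right x)).clm_apply continuous_const
  refine hc.integrable_of_hasCompactSupport (HasCompactSupport.intro hC fun y hy => ?_)
  rw [fderiv_eq_zero_of_notMem hh hC hsupp x hy]
  rfl

/-- The integral over the second variable is the value at `0` of the convolution with the constant
function `1`, whose dependence on parameters is smooth. -/
theorem contDiff_parametric_integral : ContDiff ℝ ∞ fun x => ∫ y, h (x, y) ∂ν := by
  have h1 := contDiffOn_convolution_right_with_param (n := ⊤) (μ := ν) (f := fun _ : G => (1 : ℝ))
    (ContinuousLinearMap.lsmul ℝ ℝ) (g := fun x y => h (x, y)) isOpen_univ hC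
    (fun p y _ hy => hsupp p y hy) (locallyIntegrable_const 1)
    (by rw [Set.univ_prod_univ]; exact hh.contDiffOn)
  rw [Set.univ_prod_univ, contDiffOn_univ] at h1
  have h2 := h1.comp (contDiff_prodMk_left (0 : G))
  convert h2 using 2 with x
  simp only [convolution, ContinuousLinearMap.lsmul_apply, one_smul]
  exact (integral_sub_left_eq_self (fun y => h (x, y)) ν 0).symm

theorem fderiv_parametric_integral (x ξ : V) :
    fderiv ℝ (fun x => ∫ y, h (x, y) ∂ν) x ξ = ∫ y, fderiv ℝ h (x, y) (ξ, 0) ∂ν := by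
  have h1 := hasFDerivAt_convolution_right_with_param (μ := ν) (f := fun _ : G => (1 : ℝ))
    (ContinuousLinearMap.lsmul ℝ ℝ) (g := fun x y => h (x, y)) isOpen_univ hC
    (fun p y _ hy => hsupp p y hy) (locallyIntegrable_const 1)
    (by rw [Set.univ_prod_univ]; exact (hh.of_le (WithTop.coe_le_coe.2 le_top)).contDiffOn)
    (x, 0) trivial
  have h2 := HasFDerivAt.comp (f := fun x : V => (x, (0 : G))) x h1 (hasFDerivAt_prodMk_left x 0)
  have h3 : (fun x => ∫ y, h (x, y) ∂ν) = (fun q : V × G =>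
      convolution (fun _ : G => (1 : ℝ)) (fun y => h (q.1, y)) (ContinuousLinearMap.lsmul ℝ ℝ) ν q.2)
      ∘ fun x => (x, 0) := by
    funext x
    simp only [Function.comp, convolution, ContinuousLinearMap.lsmul_apply, one_smul]
    exact (integral_sub_left_eq_self (fun y => h (x, y)) ν 0).symm
  rw [h3, h2.fderiv]
  have hc : Continuous fun y => fderiv ℝ h (x, y) :=
    (hh.continuous_fderiv (by simp)).comp (Continuous.prodMk_right x)
  have hi : Integrable (fun y => fderiv ℝ h (x, y)) ν :=
    hc.integrable_of_hasCompactSupport (HasCompactSupport.intro hC fun y hy =>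
      fderiv_eq_zero_of_notMem hh hC hsupp x hy)
  have h4 : convolution (fun _ : G => (1 : ℝ)) (fun y => fderiv ℝ h (x, y))
      ((ContinuousLinearMap.lsmul ℝ ℝ : ℝ →L[ℝ] ℂ →L[ℝ] ℂ).precompR (V × G)) ν 0
      = ∫ y, fderiv ℝ h (x, y) ∂ν := by
    rw [convolution, ← integral_sub_left_eq_self (fun y => fderiv ℝ h (x, y)) ν 0]
    refine integral_congr_ae (Filter.Eventually.of_forall fun y => ?_)
    refine ContinuousLinearMap.ext fun z => ?_
    simp [ContinuousLinearMap.precompR_apply]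
  refine (congrArg (fun T : V × G →L[ℝ] ℂ => T (ξ, 0)) h4).trans ?_
  exact ContinuousLinearMap.integral_apply hi (ξ, 0)

/-- The integral of a derivative in the direction of the second variable vanishes, by partial
integration against the constant function `1`. -/
theorem integral_fderiv_snd_eq_zero (x : V) (w : G) :
    ∫ y, fderiv ℝ h (x, y) (0, w) ∂ν = 0 := by
  have hd : Differentiable ℝ fun y => h (x, y) :=
    (hh.comp (contDiff_prodMk_right x)).differentiable (by simp)
  have h1 : ∀ y, fderiv ℝ (fun y => h (x, y)) y w = fderiv ℝ h (x, y) (0, w) := by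
    intro y
    have := ((hh.differentiable (by simp) (x, y)).hasFDerivAt.comp y (hasFDerivAt_prodMk_right x y))
    exact congrArg (fun T : G →L[ℝ] ℂ => T w) this.fderiv
  have hi := integrable_fderiv_apply (ν := ν) hh hC hsupp x (0, w)
  have hi0 : Integrable (fun y => h (x, y)) ν :=
    hd.continuous.integrable_of_hasCompactSupport (HasCompactSupport.intro hC fun y hy =>
      hsupp x y hy)
  have h2 := integral_smul_fderiv_eq_neg_fderiv_smul_of_integrable (μ := ν) (𝕜 := ℝ)
    (f := fun _ : G => (1 : ℝ)) (g := fun y => h (x, y)) (v := w) (by simp)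
    (by simpa [h1] using hi) (by simpa using hi0) (fun _ _ => differentiableAt_const _)
    (fun y _ => hd y)
  simpa [h1] using h2

end ParametricIntegral

/-! ### Integration over the fibres -/

section FibreIntegrals

variable {EM : Type*} [NormedAddCommGroup EM] [NormedSpace ℝ EM]
  {M : Type uM} [TopologicalSpace M] [ChartedSpace EM M] [IsManifold 𝓘(ℝ, EM) ∞ M]
  {FA : Type*} [NormedAddCommGroup FA] [NormedSpace ℝ FA]
  {A : M → Type*} [∀ m, AddCommGroup (A m)] [∀ m, Module ℝ (A m)]
  [TopologicalSpace (TotalSpace FA A)] [∀ m, TopologicalSpace (A m)] [FiberBundle FA A]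
  [VectorBundle ℝ FA A]
  {ES : Type*} [NormedAddCommGroup ES] [NormedSpace ℝ ES]
  {S : Type uS} [TopologicalSpace S] [ChartedSpace ES S] [IsManifold 𝓘(ℝ, ES) ∞ S]
  {𝓐 : LieAlgebroid EM FA A} {J : S → M} {ωt : PresymplecticForm ES 𝓐 J} {α : Action ES 𝓐 J}

namespace AdaptedChart

variable {m₀ : M} {O : Set EM} {k : ℕ} (e : AdaptedChart EM ES J m₀ O k)

open Classical in
/-- The coordinate expression of a function in an adapted chart, extended by zero. -/
def coord (h : S → ℂ) (z : EM × (Fin k → ℝ)) : ℂ :=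
  if z ∈ e.chart.target then h (e.chart.symm z) else 0

theorem coord_of_mem (h : S → ℂ) {z : EM × (Fin k → ℝ)} (hz : z ∈ e.chart.target) :
    e.coord h z = h (e.chart.symm z) := if_pos hz

theorem coord_eventuallyEq (h : S → ℂ) {z : EM × (Fin k → ℝ)} (hz : z ∈ e.chart.target) :
    e.coord h =ᶠ[𝓝 z] h ∘ e.chart.symm := by
  filter_upwards [e.chart.open_target.mem_nhds hz] with w hw using e.coord_of_mem h hw

section Support

variable {C : Set S} (hC : IsCompact C) (hCe : C ⊆ e.chart.source)
include hC hCe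

/-- The fibre coordinates of a compact subset of the domain of the chart. -/
theorem isCompact_fibreCoord : IsCompact ((fun s => (e.chart s).2) '' C) :=
  hC.image_of_continuousOn (continuous_snd.comp_continuousOn (e.chart.continuousOn.mono hCe))

variable {h : S → ℂ} (hsupp : ∀ s ∉ C, h s = 0)
include hsupp

omit hC hCe in
theorem coord_eq_zero_of_notMem {z : EM × (Fin k → ℝ)} (hz : z ∉ e.chart '' C) :
    e.coord h z = 0 := by
  by_cases hzt : z ∈ e.chart.target
  · rw [e.coord_of_mem h hzt]
    refine hsupp _ fun hmem => hz ⟨_, hmem, e.chart.right_inv hzt⟩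
  · exact if_neg hzt

omit hC hCe in
theorem coord_eq_zero (x : EM) : ∀ y ∉ (fun s => (e.chart s).2) '' C, e.coord h (x, y) = 0 := by
  refine fun y hy => e.coord_eq_zero_of_notMem hsupp ?_
  rintro ⟨s, hs, hsy⟩
  exact hy ⟨s, hs, congrArg Prod.snd hsy⟩

theorem coord_eventuallyEq_zero {z : EM × (Fin k → ℝ)} (hz : z ∉ e.chart.target) :
    e.coord h =ᶠ[𝓝 z] 0 := by
  have hcl : IsClosed (e.chart '' C) :=
    (hC.image_of_continuousOn (e.chart.continuousOn.mono hCe)).isClosed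
  have hzC : z ∉ e.chart '' C := by
    rintro ⟨s, hs, rfl⟩
    exact hz (e.chart.map_source (hCe hs))
  filter_upwards [hcl.isOpen_compl.mem_nhds hzC] with w hw using e.coord_eq_zero_of_notMem hsupp hw

theorem contDiff_coord (hh : ContMDiffOn 𝓘(ℝ, ES) 𝓘(ℝ, ℂ) ∞ h e.chart.source) :
    ContDiff ℝ ∞ (e.coord h) := by
  refine contDiff_iff_contDiffAt.2 fun z => ?_
  by_cases hz : z ∈ e.chart.target
  · have h1 : ContMDiffAt 𝓘(ℝ, EM × (Fin k → ℝ)) 𝓘(ℝ, ℂ) ∞ (h ∘ e.chart.symm) z :=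
      (hh.contMDiffAt (e.chart.open_source.mem_nhds (e.chart.map_target hz))).comp z
        (e.isSmoothChart.smooth_symm.contMDiffAt (e.chart.open_target.mem_nhds hz))
    exact h1.contDiffAt.congr_of_eventuallyEq (e.coord_eventuallyEq h hz)
  · exact contDiffAt_const.congr_of_eventuallyEq (e.coord_eventuallyEq_zero hC hCe hsupp hz)

end Support

theorem fderiv_coord {h : S → ℂ} {s : S} (hs : s ∈ e.chart.source)
    (hh : MDifferentiableAt 𝓘(ℝ, ES) 𝓘(ℝ, ℂ) h s) (v : TangentSpace 𝓘(ℝ, ES) s) :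
    fderiv ℝ (e.coord h) (e.chart s) (dirDeriv e.chart s v) = dirDeriv h s v := by
  rw [(e.coord_eventuallyEq h (e.chart.map_source hs)).fderiv_eq,
    e.isSmoothChart.dirDeriv_eq hs hh]

section

variable (hJ : ContMDiff 𝓘(ℝ, ES) 𝓘(ℝ, EM) ∞ J) [FiniteDimensional ℝ ES] [T2Space S]

variable (ωt) in
/-- The product of a function and the Liouville density of an adapted chart. -/
def weighted (f : S → ℂ) (s : S) : ℂ := ((e.density ωt hJ s : ℝ) : ℂ) * f s

variable {f : S → ℂ}

theorem contMDiffOn_ofReal_density :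
    ContMDiffOn 𝓘(ℝ, ES) 𝓘(ℝ, ℂ) ∞ (fun s => ((e.density ωt hJ s : ℝ) : ℂ)) e.chart.source :=
  Complex.ofRealCLM.contDiff.contMDiff.comp_contMDiffOn (e.contMDiffOn_density ωt hJ)

theorem contMDiffOn_weighted (hf : ContMDiff 𝓘(ℝ, ES) 𝓘(ℝ, ℂ) ∞ f) :
    ContMDiffOn 𝓘(ℝ, ES) 𝓘(ℝ, ℂ) ∞ (e.weighted ωt hJ f) e.chart.source :=
  (contDiff_mul (𝕜 := ℝ) (𝔸 := ℂ)).contMDiff.comp_contMDiffOn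
    ((e.contMDiffOn_ofReal_density hJ).prodMk_space hf.contMDiffOn)

theorem weighted_eq_zero {C : Set S} (hsupp : ∀ s ∉ C, f s = 0) :
    ∀ s ∉ C, e.weighted ωt hJ f s = 0 := fun s hs => by
  rw [weighted, hsupp s hs, mul_zero]

/-- The derivative along `α(X)` of the density contributes minus the divergence of `α(X)` along the
fibres. -/
theorem dirDeriv_weighted (hf : ContMDiff 𝓘(ℝ, ES) 𝓘(ℝ, ℂ) ∞ f) (μ : MomentumMap α ωt)
    (X : Cₛ^∞⟮𝓘(ℝ, EM); FA, A⟯) {s : S} (hs : s ∈ e.chart.source) :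
    dirDeriv (e.weighted ωt hJ f) s (α.toFun X s)
      = e.weighted ωt hJ (fun t => dirDeriv f t (α.toFun X t)) s
        - ((e.jacobian hJ α X s).trace : ℂ) * e.weighted ωt hJ f s := by
  have hn := e.chart.open_source.mem_nhds hs
  have hρ := ((e.contMDiffOn_density ωt hJ).contMDiffAt hn).mdifferentiableAt (by simp)
  have h1 := dirDeriv_mul (((e.contMDiffOn_ofReal_density (ωt := ωt) hJ).contMDiffAt
    hn).mdifferentiableAt (by simp)) ((hf s).mdifferentiableAt (by simp)) (α.toFun X s)
  have h2 := dirDeriv_clm_comp Complex.ofRealCLM hρ (α.toFun X s)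
  rw [e.dirDeriv_density hJ μ X hs] at h2
  refine h1.trans ?_
  have h3 : dirDeriv (fun t => ((e.density ωt hJ t : ℝ) : ℂ)) s (α.toFun X s)
    = -(((e.jacobian hJ α X s).trace : ℂ) * ((e.density ωt hJ s : ℝ) : ℂ)) := by
    refine h2.trans ?_
    simp
  rw [h3, weighted, weighted]
  ring

variable [MeasurableSpace S] [BorelSpace S]

theorem integral_liouvilleMeasure_eq_coord {m : M} (hm : m ∈ (chartAt EM m₀).source)
    (hmO : chartAt EM m₀ m ∈ O) (hf : Continuous f) (hfs : Function.support f ⊆ e.chart.source) :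
    ∫ s, f s ∂(liouvilleMeasure ωt m)
      = ∫ y, e.coord (e.weighted ωt hJ f) (chartAt EM m₀ m, y) := by
  have h1 : ∫ y in e.fibreDom, e.coord (e.weighted ωt hJ f) (chartAt EM m₀ m, y)
      = ∫ y, e.coord (e.weighted ωt hJ f) (chartAt EM m₀ m, y) := by
    refine setIntegral_eq_integral_of_forall_compl_eq_zero fun y hy => if_neg fun h => hy ?_
    rw [e.target_eq] at h
    exact h.2
  rw [e.integral_liouvilleMeasure ωt hJ hm hmO hf hfs, ← h1]
  refine setIntegral_congr_fun e.isOpen_fibreDom.measurableSet fun y hy => ?_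
  exact Complex.real_smul.trans
    (e.coord_of_mem (e.weighted ωt hJ f) (e.mem_target_of_mem_fibreDom hmO hy)).symm

variable {C : Set S} (hC : IsCompact C) (hCe : C ⊆ e.chart.source) (hsupp : ∀ s ∉ C, f s = 0)
  (hf : ContMDiff 𝓘(ℝ, ES) 𝓘(ℝ, ℂ) ∞ f) {m : M} (hm : m ∈ (chartAt EM m₀).source)
  (hmO : chartAt EM m₀ m ∈ O)
include hJ hC hCe hsupp hf hm hmO

theorem integral_eventuallyEq_coord :
    (fun m => ∫ s, f s ∂(liouvilleMeasure ωt m)) =ᶠ[𝓝 m]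
      (fun x => ∫ y, e.coord (e.weighted ωt hJ f) (x, y)) ∘ chartAt EM m₀ := by
  filter_upwards [(chartAt EM m₀).open_source.mem_nhds hm,
    ((chartAt EM m₀).continuousAt hm).preimage_mem_nhds (e.isOpen_base.mem_nhds hmO)] with m' h1 h2
  refine e.integral_liouvilleMeasure_eq_coord hJ h1 h2 hf.continuous fun s hs => hCe ?_
  by_contra h
  exact hs (hsupp s h)

theorem contMDiffAt_integral :
    ContMDiffAt 𝓘(ℝ, EM) 𝓘(ℝ, ℂ) ∞ (fun m => ∫ s, f s ∂(liouvilleMeasure ωt m)) m := by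
  have h1 := contDiff_parametric_integral (ν := (volume : Measure (Fin k → ℝ)))
    (e.contDiff_coord hC hCe (e.weighted_eq_zero (ωt := ωt) hJ hsupp)
      (e.contMDiffOn_weighted hJ hf))
    (e.isCompact_fibreCoord hC hCe) (e.coord_eq_zero (e.weighted_eq_zero hJ hsupp))
  refine ContMDiffAt.congr_of_eventuallyEq ?_
    (e.integral_eventuallyEq_coord hJ hC hCe hsupp hf hm hmO)
  exact h1.contMDiff.contMDiffAt.comp m ((isSmoothChart_chartAt m₀).smooth.contMDiffAt
    ((chartAt EM m₀).open_source.mem_nhds hm))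

/-- In an adapted chart, the derivative of the integrand along `α(X)` and that of the coordinate
expression along the anchor of `X` differ by a divergence along the fibre. -/
theorem coord_weighted_dirDeriv (μ : MomentumMap α ωt) (X : Cₛ^∞⟮𝓘(ℝ, EM); FA, A⟯)
    (y : Fin k → ℝ) :
    e.coord (e.weighted ωt hJ fun t => dirDeriv f t (α.toFun X t)) (chartAt EM m₀ m, y)
      = fderiv ℝ (e.coord (e.weighted ωt hJ f)) (chartAt EM m₀ m, y)
          (dirDeriv (chartAt EM m₀) m (𝓐.anchor m (X m)), 0)
        + ∑ i, fderiv ℝ (e.coord fun t => ((e.fibreComp α X t i : ℝ) : ℂ) * e.weighted ωt hJ f t)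
            (chartAt EM m₀ m, y) (0, Pi.single i 1) := by
  have hw := e.weighted_eq_zero (ωt := ωt) hJ hsupp
  by_cases hy : y ∈ e.fibreDom
  · have hs := e.slice_mem_source hmO hy
    have hz := e.chart_slice hmO hy
    have hJs := e.base_slice hm hmO hy
    set s := e.slice m y with hs_def
    have hn := e.chart.open_source.mem_nhds hs
    have hwd : MDifferentiableAt 𝓘(ℝ, ES) 𝓘(ℝ, ℂ) (e.weighted ωt hJ f) s :=
      ((e.contMDiffOn_weighted hJ hf).contMDiffAt hn).mdifferentiableAt (by simp)
    have had : MDifferentiableAt 𝓘(ℝ, ES) 𝓘(ℝ, Fin k → ℝ) (e.fibreComp α X) s :=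
      ((e.contMDiffOn_fibreComp X).contMDiffAt hn).mdifferentiableAt (by simp)
    let Λ : Fin k → (Fin k → ℝ) →L[ℝ] ℂ := fun i =>
      Complex.ofRealCLM.comp (ContinuousLinearMap.proj (R := ℝ) (φ := fun _ : Fin k => ℝ) i)
    have haid : ∀ i, MDifferentiableAt 𝓘(ℝ, ES) 𝓘(ℝ, ℂ) (fun t => Λ i (e.fibreComp α X t)) s :=
      fun i => (Λ i).differentiable.mdifferentiable.mdifferentiableAt.comp s had
    have hmuld : ∀ i, MDifferentiableAt 𝓘(ℝ, ES) 𝓘(ℝ, ℂ)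
        (fun t => Λ i (e.fibreComp α X t) * e.weighted ωt hJ f t) s := fun i =>
      ((contDiff_mul (𝕜 := ℝ) (𝔸 := ℂ) (n := ∞)).contMDiff.mdifferentiable (by simp) _).comp s
        ((haid i).prodMk_space hwd)
    have hξ : dirDeriv (chartAt EM m₀) m (𝓐.anchor m (X m))
        = (dirDeriv e.chart s (α.toFun X s)).1 := by
      rw [e.fst_dirDeriv hJ hs, α.anchor X s, hJs]
    -- the components of `α(X)` along the fibre are moved into the function that is differentiated,
    -- at the expense of the divergence
    have hdec : ((dirDeriv e.chart s (α.toFun X s)).1, (0 : Fin k → ℝ))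
        = dirDeriv e.chart s (α.toFun X s)
          - ∑ i, e.fibreComp α X s i • ((0 : EM), (Pi.single i 1 : Fin k → ℝ)) := by
      refine Prod.ext ?_ ?_
      · simp [Prod.fst_sum]
      · simp only [Prod.snd_sub, Prod.snd_sum, Prod.smul_snd]
        exact (sub_eq_zero.2 ((pi_eq_sum_univ' (e.fibreComp α X s)).trans
          (Finset.sum_congr rfl fun i _ => by
            congr 1))).symm
    rw [e.coord_of_mem _ (e.mem_target_of_mem_fibreDom hmO hy), hξ, ← hz, hdec, map_sub,
      e.fderiv_coord hs hwd, e.dirDeriv_weighted hJ hf μ X hs, map_sum]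
    have hi : ∀ i, fderiv ℝ (e.coord fun t => ((e.fibreComp α X t i : ℝ) : ℂ)
          * e.weighted ωt hJ f t) (e.chart s) (0, Pi.single i 1)
        = fderiv ℝ (e.coord (e.weighted ωt hJ f)) (e.chart s)
            (e.fibreComp α X s i • ((0 : EM), (Pi.single i 1 : Fin k → ℝ)))
          + (((e.jacobian hJ α X s).diag i : ℝ) : ℂ) * e.weighted ωt hJ f s := by
      intro i
      rw [map_smul, ← dirDeriv_frame hJ hs, e.fderiv_coord hs hwd]
      refine (e.fderiv_coord hs (hmuld i) _).trans ?_
      refine (dirDeriv_mul (haid i) hwd _).trans ?_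
      rw [dirDeriv_clm_comp (Λ i) had, Complex.real_smul]
      rfl
    simp_rw [hi]
    rw [Finset.sum_add_distrib, ← Finset.sum_mul, Matrix.trace]
    rw [e.chart.left_inv hs, Complex.ofReal_sum]
    ring
  -- outside the chart, all functions vanish near the point
  · have hz : (chartAt EM m₀ m, y) ∉ e.chart.target := fun h => hy (by
      rw [e.target_eq] at h
      exact h.2)
    have h1 := (e.coord_eventuallyEq_zero hC hCe hw hz).fderiv_eq (𝕜 := ℝ)
    have h2 : ∀ i, fderiv ℝ (e.coord fun t => ((e.fibreComp α X t i : ℝ) : ℂ)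
        * e.weighted ωt hJ f t) (chartAt EM m₀ m, y) = fderiv ℝ 0 (chartAt EM m₀ m, y) := fun i =>
      (e.coord_eventuallyEq_zero hC hCe (fun s hs => by rw [hw s hs, mul_zero]) hz).fderiv_eq
    simp only [h1, h2]
    simp [coord, hz]

/-- The derivative of a fibre integral along the anchor of `X` is the fibre integral of the
derivative along `α(X)`, for integrands with compact support in an adapted chart. -/
theorem dirDeriv_integral (μ : MomentumMap α ωt) (X : Cₛ^∞⟮𝓘(ℝ, EM); FA, A⟯) :
    dirDeriv (fun m => ∫ s, f s ∂(liouvilleMeasure ωt m)) m (𝓐.anchor m (X m))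
      = ∫ s, dirDeriv f s (α.toFun X s) ∂(liouvilleMeasure ωt m) := by
  have hw := e.weighted_eq_zero (ωt := ωt) hJ hsupp
  have hk := e.isCompact_fibreCoord hC hCe
  have hsm := e.contDiff_coord hC hCe hw (e.contMDiffOn_weighted hJ hf)
  have hκ := (isSmoothChart_chartAt (EB := EM) m₀).mdifferentiableAt hm
  have hai : ∀ i, ContMDiffOn 𝓘(ℝ, ES) 𝓘(ℝ, ℂ) ∞
      (fun t => ((e.fibreComp α X t i : ℝ) : ℂ) * e.weighted ωt hJ f t) e.chart.source := fun i =>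
    (contDiff_mul (𝕜 := ℝ) (𝔸 := ℂ)).contMDiff.comp_contMDiffOn
      (((Complex.ofRealCLM.comp (ContinuousLinearMap.proj (R := ℝ) (φ := fun _ : Fin k => ℝ)
        i)).contDiff.contMDiff.comp_contMDiffOn (e.contMDiffOn_fibreComp X)).prodMk_space
        (e.contMDiffOn_weighted hJ hf))
  have hwi : ∀ i, ∀ s ∉ C, ((e.fibreComp α X s i : ℝ) : ℂ) * e.weighted ωt hJ f s = 0 :=
    fun i s hs => by rw [hw s hs, mul_zero]
  have hsmi := fun i => e.contDiff_coord hC hCe (hwi i) (hai i)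
  have hDf : Continuous fun s => dirDeriv f s (α.toFun X s) :=
    (contMDiff_dirDeriv hf (α.toFun X).contMDiff).continuous
  have hDfs : Function.support (fun s => dirDeriv f s (α.toFun X s)) ⊆ e.chart.source := by
    intro s hs
    by_contra h
    refine hs ?_
    have h0 : f =ᶠ[𝓝 s] fun _ => 0 := by
      filter_upwards [hC.isClosed.isOpen_compl.mem_nhds fun h' => h (hCe h')] with t ht
        using hsupp t ht
    exact (dirDeriv_congr h0 _).trans (dirDeriv_const 0 s _)
  rw [dirDeriv_congr (e.integral_eventuallyEq_coord (ωt := ωt) hJ hC hCe hsupp hf hm hmO),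
    e.integral_liouvilleMeasure_eq_coord hJ hm hmO hDf hDfs]
  simp_rw [e.coord_weighted_dirDeriv hJ hC hCe hsupp hf hm hmO μ X]
  rw [integral_add (integrable_fderiv_apply hsm hk (e.coord_eq_zero hw) _ _)
    (integrable_finsetSum _ fun i _ =>
      integrable_fderiv_apply (hsmi i) hk (e.coord_eq_zero (hwi i)) _ _),
    integral_finsetSum _ fun i _ =>
      integrable_fderiv_apply (hsmi i) hk (e.coord_eq_zero (hwi i)) _ _,
    Finset.sum_eq_zero fun i _ =>
      integral_fderiv_snd_eq_zero (hsmi i) hk (e.coord_eq_zero (hwi i)) _ _, add_zero,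
    ← fderiv_parametric_integral hsm hk (e.coord_eq_zero hw)]
  have hI := (contDiff_parametric_integral (ν := (volume : Measure (Fin k → ℝ))) hsm hk
    (e.coord_eq_zero hw)).differentiable (by simp) (chartAt EM m₀ m)
  exact (dirDeriv_comp hI.mdifferentiableAt hκ _).trans (dirDeriv_eq_fderiv _ _ _)

end

end AdaptedChart

end FibreIntegrals

/-! ### Fibre integrals and the Lie algebroid action -/

section GlobalFibreIntegrals

variable {EM : Type*} [NormedAddCommGroup EM] [NormedSpace ℝ EM] [FiniteDimensional ℝ EM]
  {M : Type uM} [TopologicalSpace M] [ChartedSpace EM M] [IsManifold 𝓘(ℝ, EM) ∞ M] [T2Space M]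
  {FA : Type*} [NormedAddCommGroup FA] [NormedSpace ℝ FA]
  {A : M → Type*} [∀ m, AddCommGroup (A m)] [∀ m, Module ℝ (A m)]
  [TopologicalSpace (TotalSpace FA A)] [∀ m, TopologicalSpace (A m)] [FiberBundle FA A]
  [VectorBundle ℝ FA A]
  {ES : Type*} [NormedAddCommGroup ES] [NormedSpace ℝ ES] [FiniteDimensional ℝ ES]
  {S : Type uS} [TopologicalSpace S] [ChartedSpace ES S] [IsManifold 𝓘(ℝ, ES) ∞ S]
  [T2Space S] [SigmaCompactSpace S]
  {𝓐 : LieAlgebroid EM FA A} {J : S → M} {ωt : PresymplecticForm ES 𝓐 J} {α : Action ES 𝓐 J}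

/-- Near a fibre, a smooth function is a finite sum of smooth functions with compact supports in
adapted charts. -/
theorem IsCompactFiberBundle.exists_sum_eq (hJ : IsCompactFiberBundle EM ES J) (m₀ : M) {f : S → ℂ}
    (hf : ContMDiff 𝓘(ℝ, ES) 𝓘(ℝ, ℂ) ∞ f) :
    ∃ (k : ℕ) (O : Set EM) (T : Finset (AdaptedChart EM ES J m₀ O k))
      (g : AdaptedChart EM ES J m₀ O k → S → ℂ), chartAt EM m₀ m₀ ∈ O ∧
      (∀ e, ContMDiff 𝓘(ℝ, ES) 𝓘(ℝ, ℂ) ∞ (g e)) ∧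
      (∀ e, ∃ C, IsCompact C ∧ C ⊆ e.chart.source ∧ ∀ s ∉ C, g e s = 0) ∧
      ∀ᶠ m in 𝓝 m₀, ∀ s, J s = m → f s = ∑ e ∈ T, g e s := by
  obtain ⟨k, O, hO, hmO, he⟩ := hJ.exists_adaptedChart m₀
  have hV : (chartAt EM m₀).source ∩ chartAt EM m₀ ⁻¹' O ∈ 𝓝 m₀ := Filter.inter_mem
    ((chartAt EM m₀).open_source.mem_nhds (mem_chart_source EM m₀))
    (((chartAt EM m₀).continuousAt (mem_chart_source EM m₀)).preimage_mem_nhds (hO.mem_nhds hmO))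
  obtain ⟨K, hK, hKV, hKcl, hKc⟩ := hJ.exists_isCompact_preimage hV
  obtain ⟨K', hK', hKK', hKcl', hKc'⟩ := hJ.exists_isCompact_preimage (interior_mem_nhds.2 hK)
  -- over the larger neighbourhood `K` of `m₀`, the supports are compact; over the smaller one `K'`,
  -- the functions add up to `1` and only finitely many of them are nonzero
  obtain ⟨χ, hχ⟩ := SmoothPartitionOfUnity.exists_isSubordinate 𝓘(ℝ, ES)
    (hKcl'.preimage hJ.1.continuous)
    (fun e : AdaptedChart EM ES J m₀ O k => e.chart.source ∩ J ⁻¹' interior K)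
    (fun e => e.chart.open_source.inter (isOpen_interior.preimage hJ.1.continuous)) (by
      intro s hs
      have hsK := interior_subset (hKK' hs)
      obtain ⟨e, hse⟩ := he s (hKV hsK).1 (hKV hsK).2
      exact Set.mem_iUnion.2 ⟨e, hse, hKK' hs⟩)
  have hfin := χ.locallyFinite.finite_nonempty_inter_compact hKc'
  refine ⟨k, O, hfin.toFinset, fun e s => ((χ e s : ℝ) : ℂ) * f s, hmO, fun e => ?_, fun e => ?_, ?_⟩
  · exact (contDiff_mul (𝕜 := ℝ) (𝔸 := ℂ)).contMDiff.comp
      ((Complex.ofRealCLM.contDiff.contMDiff.comp (χ e).contMDiff).prodMk_space hf)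
  · refine ⟨tsupport (χ e), hKc.of_isClosed_subset (isClosed_tsupport _) fun s hs =>
      interior_subset (s := K) (hχ e hs).2, fun s hs => (hχ e hs).1, fun s hs => ?_⟩
    change ((χ e s : ℝ) : ℂ) * f s = 0
    rw [image_eq_zero_of_notMem_tsupport hs, Complex.ofReal_zero, zero_mul]
  · filter_upwards [hK'] with m hm s hs
    have hsK : s ∈ J ⁻¹' K' := by rwa [Set.mem_preimage, hs]
    have h1 := χ.sum_eq_one hsK
    rw [finsum_eq_sum_of_support_subset (s := hfin.toFinset) _ fun e hes =>
      hfin.mem_toFinset.2 ⟨s, hes, hsK⟩] at h1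
    rw [← Finset.sum_mul, ← Complex.ofReal_sum, h1, Complex.ofReal_one, one_mul]

variable [MeasurableSpace S] [BorelSpace S] (hJ : IsCompactFiberBundle EM ES J) {f : S → ℂ}

include hJ in
theorem integral_eventuallyEq_sum {m₀ : M} {ι : Type*} {T : Finset ι} {g : ι → S → ℂ}
    (hg : ∀ i, Continuous (g i)) (hfg : ∀ᶠ m in 𝓝 m₀, ∀ s, J s = m → f s = ∑ i ∈ T, g i s) :
    (fun m => ∫ s, f s ∂(liouvilleMeasure ωt m)) =ᶠ[𝓝 m₀]
      fun m => ∑ i ∈ T, ∫ s, g i s ∂(liouvilleMeasure ωt m) := by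
  filter_upwards [hfg] with m hm
  rw [← integral_finsetSum _ fun i _ => integrable_liouvilleMeasure ωt hJ m (hg i)]
  refine integral_congr_ae ?_
  filter_upwards [ae_liouvilleMeasure ωt hJ.1.continuous m] with s hs using hm s hs

variable (hf : ContMDiff 𝓘(ℝ, ES) 𝓘(ℝ, ℂ) ∞ f)
include hJ hf

/-- The integral of a smooth function over the fibres is a smooth function on the base. -/
theorem contMDiff_integral_liouvilleMeasure :
    ContMDiff 𝓘(ℝ, EM) 𝓘(ℝ, ℂ) ∞ (fun m => ∫ s, f s ∂(liouvilleMeasure ωt m)) := by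
  intro m₀
  obtain ⟨k, O, T, g, hmO, hg, hgC, hfg⟩ := hJ.exists_sum_eq m₀ hf
  have h1 := integral_eventuallyEq_sum (ωt := ωt) hJ (fun e => (hg e).continuous) hfg
  refine ContMDiffAt.congr_of_eventuallyEq ?_ h1
  refine ContMDiffAt.sum fun e _ => ?_
  obtain ⟨C, hC, hCe, hsupp⟩ := hgC e
  exact e.contMDiffAt_integral hJ.1 hC hCe hsupp (hg e) (mem_chart_source EM m₀) hmO

/-- The derivative of a fibre integral along the anchor of `X` is the fibre integral of the
derivative of the integrand along `α(X)`. -/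
theorem dirDeriv_integral_liouvilleMeasure (μ : MomentumMap α ωt) (X : Cₛ^∞⟮𝓘(ℝ, EM); FA, A⟯)
    (m₀ : M) :
    dirDeriv (fun m => ∫ s, f s ∂(liouvilleMeasure ωt m)) m₀ (𝓐.anchor m₀ (X m₀))
      = ∫ s, dirDeriv f s (α.toFun X s) ∂(liouvilleMeasure ωt m₀) := by
  have := FiniteDimensional.complete ℝ ES
  obtain ⟨k, O, T, g, hmO, hg, hgC, hfg⟩ := hJ.exists_sum_eq m₀ hf
  have h1 := integral_eventuallyEq_sum (ωt := ωt) hJ (fun e => (hg e).continuous) hfg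
  have h2 : ∀ e ∈ T, MDifferentiableAt 𝓘(ℝ, EM) 𝓘(ℝ, ℂ)
      (fun m => ∫ s, g e s ∂(liouvilleMeasure ωt m)) m₀ := by
    intro e _
    obtain ⟨C, hC, hCe, hsupp⟩ := hgC e
    exact (e.contMDiffAt_integral hJ.1 hC hCe hsupp (hg e) (mem_chart_source EM m₀)
      hmO).mdifferentiableAt (by simp)
  rw [dirDeriv_congr h1, dirDeriv_sum h2]
  have h3 : ∀ e ∈ T, dirDeriv (fun m => ∫ s, g e s ∂(liouvilleMeasure ωt m)) m₀
      (𝓐.anchor m₀ (X m₀)) = ∫ s, dirDeriv (g e) s (α.toFun X s) ∂(liouvilleMeasure ωt m₀) := by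
    intro e _
    obtain ⟨C, hC, hCe, hsupp⟩ := hgC e
    exact e.dirDeriv_integral hJ.1 hC hCe hsupp (hg e) (mem_chart_source EM m₀) hmO μ X
  rw [Finset.sum_congr rfl h3, ← integral_finsetSum _ fun e _ => integrable_liouvilleMeasure ωt hJ m₀
    (contMDiff_dirDeriv (hg e) (α.toFun X).contMDiff).continuous]
  refine integral_congr_ae ?_
  filter_upwards [ae_liouvilleMeasure ωt hJ.1.continuous m₀] with s hs
  -- the decomposition holds on the fibres over a neighbourhood of `m₀`, hence near `s`
  have h4 : f =ᶠ[𝓝 s] fun t => ∑ e ∈ T, g e t := by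
    have := hJ.1.continuous.continuousAt (x := s)
    rw [ContinuousAt, hs] at this
    filter_upwards [this.eventually hfg] with t ht using ht t rfl
  rw [dirDeriv_congr h4, dirDeriv_sum fun e _ => (hg e s).mdifferentiableAt (by simp)]

end GlobalFibreIntegrals

/-! ### The Hermitian metric on the quantization bundle -/

section Metric

variable {EM : Type*} [NormedAddCommGroup EM] [NormedSpace ℝ EM] [FiniteDimensional ℝ EM]
  {M : Type uM} [TopologicalSpace M] [ChartedSpace EM M] [IsManifold 𝓘(ℝ, EM) ∞ M] [T2Space M]
  {FA : Type*} [NormedAddCommGroup FA] [NormedSpace ℝ FA]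
  {A : M → Type*} [∀ m, AddCommGroup (A m)] [∀ m, Module ℝ (A m)]
  [TopologicalSpace (TotalSpace FA A)] [∀ m, TopologicalSpace (A m)] [FiberBundle FA A]
  [VectorBundle ℝ FA A]
  {ES : Type*} [NormedAddCommGroup ES] [NormedSpace ℝ ES] [FiniteDimensional ℝ ES]
  {S : Type uS} [TopologicalSpace S] [ChartedSpace ES S] [IsManifold 𝓘(ℝ, ES) ∞ S]
  [T2Space S] [SigmaCompactSpace S] [MeasurableSpace S] [BorelSpace S]
  {L : S → Type*} [∀ s, AddCommGroup (L s)] [∀ s, Module ℂ (L s)]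
  [TopologicalSpace (TotalSpace ℂ L)] [∀ s, TopologicalSpace (L s)] [FiberBundle ℂ L]
  [VectorBundle ℂ ℂ L] [VectorBundle ℝ ℂ L]
  {𝓐 : LieAlgebroid EM FA A} {J : S → M} {ωt : PresymplecticForm ES 𝓐 J}
  (P : Prequantization L ωt) {c : AlmostComplex EM ES J}

theorem holomorphicSections.exists_extension {m : M} (q : holomorphicSections P c m) :
    ∃ σ : Cₛ^∞⟮𝓘(ℝ, ES); ℂ, L⟯, ∀ s (h : J s = m), q.1 ⟨s, h⟩ = σ s := by
  obtain ⟨σ, hσ⟩ := q.2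
  exact ⟨σ, fun s h => (hσ ⟨s, h⟩).1.symm⟩

open Classical in
/-- The function `h(q, r)` on the fibre over `m`, extended by zero to `S`. -/
def fibreProduct {m : M} (q r : holomorphicSections P c m) (s : S) : ℂ :=
  if h : J s = m then P.h.inner s (q.1 ⟨s, h⟩) (r.1 ⟨s, h⟩) else 0

theorem fibreProduct_of_eq {m : M} (q r : holomorphicSections P c m) {s : S} (h : J s = m) :
    fibreProduct P q r s = P.h.inner s (q.1 ⟨s, h⟩) (r.1 ⟨s, h⟩) := dif_pos h

variable (hJ : IsCompactFiberBundle EM ES J)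
include hJ

/-- Extensions to smooth sections over `S` may be used to compute integrals over the fibre. -/
theorem fibreProduct_ae_eq {m : M} {q r : holomorphicSections P c m}
    {σ τ : Cₛ^∞⟮𝓘(ℝ, ES); ℂ, L⟯} (hσ : ∀ s (h : J s = m), q.1 ⟨s, h⟩ = σ s)
    (hτ : ∀ s (h : J s = m), r.1 ⟨s, h⟩ = τ s) :
    fibreProduct P q r =ᵐ[liouvilleMeasure ωt m] fun s => P.h.inner s (σ s) (τ s) := by
  filter_upwards [ae_liouvilleMeasure ωt hJ.1.continuous m] with s hs
  rw [fibreProduct_of_eq P q r hs, hσ s hs, hτ s hs]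

theorem integrable_fibreProduct {m : M} (q r : holomorphicSections P c m) :
    Integrable (fibreProduct P q r) (liouvilleMeasure ωt m) := by
  obtain ⟨σ, hσ⟩ := holomorphicSections.exists_extension P q
  obtain ⟨τ, hτ⟩ := holomorphicSections.exists_extension P r
  exact (integrable_liouvilleMeasure ωt hJ m (P.h.smooth σ τ).continuous).congr
    (fibreProduct_ae_eq P hJ hσ hτ).symm

theorem integral_fibreProduct_congr {m : M} {f g : S → ℂ} (h : ∀ s, J s = m → f s = g s) :
    ∫ s, f s ∂(liouvilleMeasure ωt m) = ∫ s, g s ∂(liouvilleMeasure ωt m) := by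
  refine integral_congr_ae ?_
  filter_upwards [ae_liouvilleMeasure ωt hJ.1.continuous m] with s hs using h s hs

/-- The `L²` inner product of holomorphic sections of `L` over the fibre at `m`. -/
def fibreInner (m : M) : holomorphicSections P c m →ₗ⋆[ℂ] holomorphicSections P c m →ₗ[ℂ] ℂ :=
  LinearMap.mk₂'ₛₗ (starRingEnd ℂ) (RingHom.id ℂ)
    (fun q r => ∫ s, fibreProduct P q r s ∂(liouvilleMeasure ωt m))
    (fun q q' r => by
      rw [← integral_add (integrable_fibreProduct P hJ q r) (integrable_fibreProduct P hJ q' r)]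
      refine integral_fibreProduct_congr hJ fun s hs => ?_
      simp only [fibreProduct_of_eq P _ _ hs]
      exact LinearMap.map_add₂ _ _ _ _)
    (fun a q r => by
      rw [smul_eq_mul, ← integral_const_mul]
      refine integral_fibreProduct_congr hJ fun s hs => ?_
      simp only [fibreProduct_of_eq P _ _ hs]
      exact LinearMap.map_smulₛₗ₂ _ _ _ _)
    (fun q r r' => by
      rw [← integral_add (integrable_fibreProduct P hJ q r) (integrable_fibreProduct P hJ q r')]
      refine integral_fibreProduct_congr hJ fun s hs => ?_
      simp only [fibreProduct_of_eq P _ _ hs]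
      exact map_add _ _ _)
    (fun a q r => by
      rw [RingHom.id_apply, smul_eq_mul, ← integral_const_mul]
      refine integral_fibreProduct_congr hJ fun s hs => ?_
      simp only [fibreProduct_of_eq P _ _ hs]
      exact map_smul _ _ _)

theorem fibreInner_apply {m : M} (q r : holomorphicSections P c m) :
    fibreInner P hJ m q r = ∫ s, fibreProduct P q r s ∂(liouvilleMeasure ωt m) := rfl

theorem conj_fibreInner {m : M} (q r : holomorphicSections P c m) :
    starRingEnd ℂ (fibreInner P hJ m q r) = fibreInner P hJ m r q := by
  rw [fibreInner_apply, fibreInner_apply, ← integral_conj]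
  refine integral_fibreProduct_congr hJ fun s hs => ?_
  rw [fibreProduct_of_eq P _ _ hs, fibreProduct_of_eq P _ _ hs, P.h.conj_symm]

/-- The integrand is nonnegative, and positive on an open set that meets the fibre. -/
theorem fibreInner_self_pos {m : M} {q : holomorphicSections P c m} (hq : q ≠ 0) :
    0 < (fibreInner P hJ m q q).re := by
  obtain ⟨σ, hσ⟩ := holomorphicSections.exists_extension P q
  obtain ⟨s, hs⟩ : ∃ s : J ⁻¹' {m}, q.1 s ≠ 0 := by
    by_contra! h
    exact hq (Subtype.ext (funext h))
  have hσs : σ s.1 ≠ 0 := by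
    rw [← hσ s.1 s.2]
    exact hs
  have hc : Continuous fun t => P.h.inner t (σ t) (σ t) := (P.h.smooth σ σ).continuous
  have hi := integrable_liouvilleMeasure ωt hJ m hc
  have h0 : ∀ t, 0 ≤ (P.h.inner t (σ t) (σ t)).re := by
    intro t
    by_cases ht : σ t = 0
    · rw [ht, map_zero, Complex.zero_re]
    · exact (P.h.pos t _ ht).le
  rw [fibreInner_apply, integral_congr_ae (fibreProduct_ae_eq P hJ hσ hσ)]
  have hre : (∫ t, P.h.inner t (σ t) (σ t) ∂(liouvilleMeasure ωt m)).re
      = ∫ t, (P.h.inner t (σ t) (σ t)).re ∂(liouvilleMeasure ωt m) :=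
    (integral_re hi).symm
  rw [hre, integral_pos_iff_support_of_nonneg h0 hi.re]
  have hopen : IsOpen (Function.support fun t => (P.h.inner t (σ t) (σ t)).re) :=
    (Complex.continuous_re.comp hc).isOpen_support
  have hJs : J s.1 = m := s.2
  rw [← hJs]
  exact liouvilleMeasure_pos ωt hJ hopen (P.h.pos _ _ hσs).ne'

variable {FQ : Type*} [NormedAddCommGroup FQ] [NormedSpace ℂ FQ]
  {Q : M → Type*} [∀ m, AddCommGroup (Q m)] [∀ m, Module ℂ (Q m)]
  [TopologicalSpace (TotalSpace FQ Q)] [∀ m, TopologicalSpace (Q m)] [FiberBundle FQ Q]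
  [VectorBundle ℂ FQ Q] [VectorBundle ℝ FQ Q] {P}
  (𝓠 : QuantizationBundle FQ Q P c)

theorem fibreInner_ev (σ τ : Cₛ^∞⟮𝓘(ℝ, EM); FQ, Q⟯) (m : M) :
    fibreInner P hJ m (𝓠.ev m (σ m)) (𝓠.ev m (τ m))
      = ∫ s, P.h.inner s (𝓠.toSection σ s) (𝓠.toSection τ s) ∂(liouvilleMeasure ωt m) :=
  integral_congr_ae (fibreProduct_ae_eq P hJ (fun s h => 𝓠.ev_apply σ ⟨s, h⟩)
    fun s h => 𝓠.ev_apply τ ⟨s, h⟩)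

/-- The `L²` metric on the quantization bundle. -/
def quantizationMetric : HermitianMetric EM FQ Q where
  inner m := ((fibreInner P hJ m).comp (𝓠.ev m).toLinearMap).compl₂ (𝓠.ev m).toLinearMap
  conj_symm _ _ _ := conj_fibreInner P hJ _ _
  pos m _ hv := fibreInner_self_pos P hJ fun h => hv ((𝓠.ev m).map_eq_zero_iff.1 h)
  smooth σ τ := (contMDiff_integral_liouvilleMeasure hJ (P.h.smooth (𝓠.toSection σ)
    (𝓠.toSection τ))).congr (fibreInner_ev hJ 𝓠 σ τ)

theorem quantizationMetric_apply (σ τ : Cₛ^∞⟮𝓘(ℝ, EM); FQ, Q⟯) (m : M) :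
    (quantizationMetric hJ 𝓠).inner m (σ m) (τ m)
      = ∫ s, P.h.inner s (𝓠.toSection σ s) (𝓠.toSection τ s) ∂(liouvilleMeasure ωt m) :=
  fibreInner_ev hJ 𝓠 σ τ m

end Metric

end KahlerQuantization

end

theorem mainTheorem5
    {EM : Type*} [NormedAddCommGroup EM] [NormedSpace ℝ EM] [FiniteDimensional ℝ EM]
    {M : Type*} [TopologicalSpace M] [ChartedSpace EM M] [IsManifold 𝓘(ℝ, EM) ∞ M]
    [T2Space M] [SigmaCompactSpace M]
    {ES : Type*} [NormedAddCommGroup ES] [NormedSpace ℝ ES] [FiniteDimensional ℝ ES]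
    {S : Type*} [TopologicalSpace S] [ChartedSpace ES S] [IsManifold 𝓘(ℝ, ES) ∞ S]
    [T2Space S] [SigmaCompactSpace S] [MeasurableSpace S] [BorelSpace S]
    {FA : Type*} [NormedAddCommGroup FA] [NormedSpace ℝ FA] [FiniteDimensional ℝ FA]
    {A : M → Type*} [∀ m, AddCommGroup (A m)] [∀ m, Module ℝ (A m)]
    [TopologicalSpace (Bundle.TotalSpace FA A)] [∀ m, TopologicalSpace (A m)] [FiberBundle FA A]
    [VectorBundle ℝ FA A] [ContMDiffVectorBundle ∞ FA A 𝓘(ℝ, EM)]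
    {L : S → Type*} [∀ s, AddCommGroup (L s)] [∀ s, Module ℂ (L s)]
    [TopologicalSpace (Bundle.TotalSpace ℂ L)] [∀ s, TopologicalSpace (L s)] [FiberBundle ℂ L]
    [VectorBundle ℂ ℂ L] [VectorBundle ℝ ℂ L] [ContMDiffVectorBundle ∞ ℂ L 𝓘(ℝ, ES)]
    {FQ : Type*} [NormedAddCommGroup FQ] [NormedSpace ℂ FQ] [FiniteDimensional ℂ FQ]
    {Q : M → Type*} [∀ m, AddCommGroup (Q m)] [∀ m, Module ℂ (Q m)]
    [TopologicalSpace (Bundle.TotalSpace FQ Q)] [∀ m, TopologicalSpace (Q m)] [FiberBundle FQ Q]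
    [VectorBundle ℂ FQ Q] [VectorBundle ℝ FQ Q] [ContMDiffVectorBundle ∞ FQ Q 𝓘(ℝ, EM)]
    (𝓐 : KahlerQuantization.LieAlgebroid EM FA A) (hreg : 𝓐.IsRegular)
    (J : S → M) (hJ : KahlerQuantization.IsCompactFiberBundle EM ES J)
    (α : KahlerQuantization.Action ES 𝓐 J)
    (ωt : KahlerQuantization.PresymplecticForm ES 𝓐 J)
    (μ : KahlerQuantization.MomentumMap α ωt)
    (c : KahlerQuantization.AlmostComplex EM ES J)
    (hkahler : KahlerQuantization.IsKahler ωt c)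
    (hequiv : KahlerQuantization.IsEquivariant α c)
    (P : KahlerQuantization.Prequantization L ωt)
    (𝓠 : KahlerQuantization.QuantizationBundle FQ Q P c) :
    ∃ (rep : KahlerQuantization.Representation FQ Q 𝓐)
      (g : KahlerQuantization.HermitianMetric EM FQ Q),
      (∀ (σ τ : Cₛ^∞⟮𝓘(ℝ, EM); FQ, Q⟯) (m : M),
        MeasureTheory.Integrable
          (fun s => P.h.inner s (𝓠.toSection σ s) (𝓠.toSection τ s))
          (KahlerQuantization.liouvilleMeasure ωt m) ∧
        g.inner m (σ m) (τ m)
          = ∫ s, P.h.inner s (𝓠.toSection σ s) (𝓠.toSection τ s)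
              ∂(KahlerQuantization.liouvilleMeasure ωt m)) ∧
      rep.IsHermitian g ∧
      (∀ (X : Cₛ^∞⟮𝓘(ℝ, EM); FA, A⟯) (σ : Cₛ^∞⟮𝓘(ℝ, EM); FQ, Q⟯) (s : S),
        𝓠.toSection (rep.toFun X σ) s
          = KahlerQuantization.prequantRep P μ X (𝓠.toSection σ) s) := by
  let rep := KahlerQuantization.quantizationRep hJ μ hequiv 𝓠
  have hrep := KahlerQuantization.toSection_quantizationRep hJ μ hequiv 𝓠
  have hint : ∀ (σ τ : Cₛ^∞⟮𝓘(ℝ, ES); ℂ, L⟯) (m : M),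
      MeasureTheory.Integrable (fun s => P.h.inner s (σ s) (τ s))
        (KahlerQuantization.liouvilleMeasure ωt m) := fun σ τ m =>
    KahlerQuantization.integrable_liouvilleMeasure ωt hJ m (P.h.smooth σ τ).continuous
  refine ⟨rep, KahlerQuantization.quantizationMetric hJ 𝓠, fun σ τ m =>
    ⟨hint _ _ m, KahlerQuantization.quantizationMetric_apply hJ 𝓠 σ τ m⟩, fun X σ τ m => ?_,
    fun X σ s => ?_⟩
  · have hfun := funext (KahlerQuantization.quantizationMetric_apply hJ 𝓠 σ τ)
    rw [KahlerQuantization.quantizationMetric_apply, KahlerQuantization.quantizationMetric_apply,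
      hfun, KahlerQuantization.dirDeriv_integral_liouvilleMeasure hJ
        (P.h.smooth (𝓠.toSection σ) (𝓠.toSection τ)) μ X m, hrep, hrep,
      ← MeasureTheory.integral_add (hint _ _ m) (hint _ _ m)]
    exact MeasureTheory.integral_congr_ae (Filter.Eventually.of_forall fun s =>
      KahlerQuantization.hermitian_prequantSection μ X _ _ s)
  · rw [hrep]
    rfl
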